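/- \textbf{Definitions.} A \emph{pDAG} is a finite directed acyclic graph whose nodes are partitioned into visible and latent ones. Given a vector $\vec c$ of cardinalities of the visible variables, a distribution $P$ of the visible variables is \emph{realizable} by a pDAG $\mathcal G$ if there are finite state spaces (of arbitrary cardinality) for the latent variables and for one error variable $E_x$ per node $x$, functions $f_x$ and distributions $P(E_x)$ such that $P(X_{V})=\sum_{X_{L}}\sum_{E}\prod_{x}\delta_{X_x,\,f_x(X_{\mathrm{pa}(x)},E_x)}\,P(E_x)$, where $V$ and $L$ are the sets of visible and latent nodes; $\mathcal M(\mathcal G,\vec c)$ is the set of these distributions. For pDAGs with the same visible nodes, $\mathcal G$ \emph{observationally dominates} $\mathcal G'$ if $\mathcal M(\mathcal G',\vec c)\subseteq\mathcal M(\mathcal G,\vec c)$ for every $\vec c$, and the two are \emph{observationally equivalent} if equality holds for every $\vec c$. $\mathcal G$ is \emph{algebraic} if for every $\vec c$ the set $\mathcal M(\mathcal G,\vec c)$ is the intersection of the probability simplex with a real algebraic set, and \emph{nonalgebraic} otherwise. An \emph{mDAG} is a pair of a DAG and a simplicial complex (containing all singletons) on the same finite set of nodes; its \emph{canonical pDAG}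 is the DAG, with all nodes visible, together with one parentless latent node for each facet $A$, whose set of children is $A$. All notions above, and d-separation among visible nodes, apply to an mDAG through its canonical pDAG. The \emph{skeleton} of an mDAG joins two distinct nodes if there is a directed edge between them or a face containing both. An mDAG is \emph{consistent with the nodal ordering} $(a,b,c)$ if no node is an ancestor of an earlier one. Write $x\leftrightarrow y$ if some face contains $x\ne y$. \textbf{Theorem.} There are exactly $72$ mDAGs with nodes $a,b,c$ consistent with the nodal ordering $(a,b,c)$, and they fall into exactly $15$ observational equivalence classes, namely: \begin{itemize} \item \texttt{Factorizing}: the mDAG with empty skeleton ($1$ mDAG); \item \texttt{Factorizing AB|C}, \texttt{Factorizing AC|B}, \texttt{Factorizing BC|A}: the mDAGs whose skeleton has the single edge $ab$, $ac$, $bc$, respectively ($3$ each); \item \texttt{Collider C}: all mDAGs whose skeleton has exactly the edges $ac,bc$ ($9$); \item among the mDAGs whose skeleton has exactly the edges $ab,bc$: \texttt{Collider B} if $b\leftrightarrow c$ but not $b\to c$ ($3$), \texttt{Chain} if $b\to c$ but not $b\leftrightarrow c$ ($3$), \texttt{Instrumental ABC} if $b\to c$ and $b\leftrightarrow c$ ($3$);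 \item among the mDAGs whose skeleton has exactly the edges $ab,ac$: \texttt{Fork} if not both $a\leftrightarrow b$ and $a\leftrightarrow c$ ($5$); and, if both $a\leftrightarrow b$ and $a\leftrightarrow c$, \texttt{Collider A} if there is no directed edge, \texttt{Instrumental CAB} if the only directed edge is $a\to b$, \texttt{Instrumental BAC} if the only directed edge is $a\to c$, and \texttt{Evans} if the directed edges are $a\to b$ and $a\to c$ ($1$ each); \item \texttt{Triangle}: no directed edges and facets $\{a,b\},\{a,c\},\{b,c\}$ ($1$); \item \texttt{Saturated}: all other mDAGs whose skeleton is complete ($34$). \end{itemize} An mDAG of one class observationally dominates an mDAG of another class if and only if there is a descending path from the first class to the second in the following diagram, whose lines are exactly the strict dominances between classes with no class strictly in between: \texttt{Saturated} has lines down to \texttt{Triangle}, \texttt{Evans}, \texttt{Instrumental ABC}; \texttt{Evans} to \texttt{Instrumental BAC}, \texttt{Instrumental CAB}; \texttt{Triangle} to \texttt{Collider A}, \texttt{Collider B}, \texttt{Collider C}; \texttt{Instrumental ABC} to \texttt{Collider B}, \texttt{Chain}; each of \texttt{Instrumental BAC} and \texttt{Instrumental CAB} to \texttt{Collider A}, \texttt{Fork};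 each of \texttt{Collider A} and \texttt{Fork} to \texttt{Factorizing AB|C}, \texttt{Factorizing AC|B}; each of \texttt{Collider B} and \texttt{Chain} to \texttt{Factorizing AB|C}, \texttt{Factorizing BC|A}; \texttt{Collider C} to \texttt{Factorizing AC|B}, \texttt{Factorizing BC|A}; and each of these three to \texttt{Factorizing}. Exactly five of the classes consist of nonalgebraic mDAGs: \texttt{Triangle}, \texttt{Evans}, \texttt{Instrumental ABC}, \texttt{Instrumental BAC} and \texttt{Instrumental CAB}; the mDAGs of the other ten are algebraic. The mDAGs of these five classes and of \texttt{Saturated} have no d-separation relation between nonempty sets, and those of the other nine classes have one. Call a class \emph{singled out} by certain features if every mDAG consistent with $(a,b,c)$ that has the same features as a member of the class belongs to the class. Exactly these nine other classes are singled out by their d-separation relations alone. Exactly ten classes are singled out by their d-separation relations together with their skeletons: these nine and \texttt{Instrumental ABC}. -/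

import Mathlib

namespace CausalOrder

/-! ### Partitioned DAGs -/

/-- A partitioned DAG (pDAG): a directed acyclic graph whose nodes are split into the visible
nodes `V` and the latent nodes `L`; the whole set of nodes is the disjoint union `V ⊕ L`. -/
structure PDAG (V L : Type) where
  /-- `edge x y`: there is a directed edge from `x` to `y`. -/
  edge : V ⊕ L → V ⊕ L → Prop
  acyclic : ∀ x, ¬ Relation.TransGen edge x x

namespace PDAG

variable {V L L' : Type}

/-- `x` is an ancestor of `y`; equivalently, `y` is a descendant of `x`. -/
def Ancestor (G : PDAG V L) (x y : V ⊕ L) : Prop := Relation.TransGen G.edge x y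

/-- Consistency with the nodal ordering `(π 0, …, π (n - 1))` of the visible nodes: no node is an
ancestor of a node that comes earlier in the ordering. -/
def ConsistentWith {n : ℕ} (G : PDAG V L) (π : Fin n ≃ V) : Prop :=
  ∀ i j : Fin n, i < j → ¬ G.Ancestor (Sum.inl (π j)) (Sum.inl (π i))

/-- State spaces of all nodes: the visible node `v` has `c v` values, the latent node `l` has the
state space `Lat l`. -/
def State (c : V → ℕ) (Lat : L → Type) : V ⊕ L → Type
  | Sum.inl v => Fin (c v)
  | Sum.inr l => Lat l

/-- The joint value of all the variables, from the values of the visible and latent ones. -/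
def joint {c : V → ℕ} {Lat : L → Type} (xV : ∀ v, Fin (c v)) (xL : ∀ l, Lat l) :
    ∀ x : V ⊕ L, State c Lat x
  | Sum.inl v => xV v
  | Sum.inr l => xL l

/-- A causal model with classical unrestricted semantics on the pDAG `G`, where the visible
variables have cardinalities `c`: finite state spaces of arbitrary cardinality for the latent
variables and for the error variables, a function that determines each variable from its parents
and its error variable, and a probability distribution for each error variable. -/
structure Model (G : PDAG V L) (c : V → ℕ) where
  Lat : L → Type
  latFintype : ∀ l, Fintype (Lat l)
  Err : V ⊕ L → Type
  errFintype : ∀ x, Fintype (Err x)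
  f : ∀ x, (∀ y : {y // G.edge y x}, State c Lat y.1) → Err x → State c Lat x
  errDist : ∀ x, Err x → ℝ
  errDist_nonneg : ∀ x e, 0 ≤ errDist x e
  errDist_sum : ∀ x, ∑ e, errDist x e = 1

attribute [instance] Model.latFintype Model.errFintype

variable [Fintype V] [DecidableEq V] [Fintype L] [DecidableEq L] [Fintype L'] [DecidableEq L']

open Classical in
/-- The distribution over the visible variables that a causal model yields:
`P(x_V) = ∑_{x_L} ∑_e ∏_x δ(x_x, f_x(x_{pa(x)}, e_x)) P(e_x)`. -/
noncomputable def Model.dist {G : PDAG V L} {c : V → ℕ} (M : G.Model c) :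
    (∀ v, Fin (c v)) → ℝ := fun xV =>
  ∑ xL : ∀ l, M.Lat l, ∑ e : ∀ x, M.Err x, ∏ x : V ⊕ L,
    (if joint (Lat := M.Lat) xV xL x = M.f x (fun y => joint xV xL y.1) (e x) then 1 else 0) *
      M.errDist x (e x)

/-- The distributions with visible cardinalities `c` that are realizable by `G`. -/
def Realizable (G : PDAG V L) (c : V → ℕ) : Set ((∀ v, Fin (c v)) → ℝ) :=
  Set.range fun M : G.Model c => M.dist

/-- `G` observationally dominates `G'`. -/
def Dominates (G : PDAG V L) (G' : PDAG V L') : Prop :=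
  ∀ c : V → ℕ, G'.Realizable c ⊆ G.Realizable c

/-- `G` and `G'` are observationally equivalent. -/
def ObsEquiv (G : PDAG V L) (G' : PDAG V L') : Prop :=
  ∀ c : V → ℕ, G'.Realizable c = G.Realizable c

/-- `G` is algebraic: for all cardinalities of the visible variables, the realizable distributions
are the points of the probability simplex that satisfy some family of polynomial equations. -/
def Algebraic (G : PDAG V L) : Prop :=
  ∀ c : V → ℕ, ∃ S : Set (MvPolynomial (∀ v, Fin (c v)) ℝ),
    G.Realizable c =
      {P | P ∈ stdSimplex ℝ (∀ v, Fin (c v)) ∧ ∀ p ∈ S, MvPolynomial.eval P p = 0}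

/-- `p` is a path from `x` to `y`: a list of distinct nodes, consecutive ones being joined by an
edge in one direction or the other. -/
def IsPath (G : PDAG V L) (x y : V ⊕ L) (p : List (V ⊕ L)) : Prop :=
  p.IsChain (fun u w => G.edge u w ∨ G.edge w u) ∧ p.Nodup ∧
    p.head? = some x ∧ p.getLast? = some y

/-- The path `p` is blocked by the set `C` of visible nodes: it has a collider `u → m ← w` such
that neither `m` nor any descendant of `m` is in `C`, or an inner node `m` that is in `C` and is
not a collider on the path. -/
def Blocked (G : PDAG V L) (C : Finset V) (p : List (V ⊕ L)) : Prop :=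
  ∃ u m w, [u, m, w] <:+: p ∧
    ((G.edge u m ∧ G.edge w m ∧ ∀ z ∈ C, m ≠ Sum.inl z ∧ ¬ G.Ancestor m (Sum.inl z)) ∨
      (¬ (G.edge u m ∧ G.edge w m) ∧ ∃ z ∈ C, m = Sum.inl z))

/-- `A` and `B` are d-separated by `C`. -/
def DSep (G : PDAG V L) (A B C : Finset V) : Prop :=
  ∀ u ∈ A, ∀ w ∈ B, ∀ p, G.IsPath (Sum.inl u) (Sum.inl w) p → G.Blocked C p

end PDAG

/-! ### mDAGs -/

/-- An mDAG with set of nodes `V`: a directed acyclic graph on `V` together with a simplicial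
complex over `V`, given by its set of faces. -/
@[ext]
structure MDAG (V : Type) where
  edges : Finset (V × V)
  acyclic : ∀ v, ¬ Relation.TransGen (fun u w => (u, w) ∈ edges) v v
  faces : Finset (Finset V)
  singleton_mem : ∀ v, {v} ∈ faces
  down_closed : ∀ A B, A ⊆ B → B ∈ faces → A ∈ faces

namespace MDAG

variable {V : Type} [DecidableEq V]

/-- The facets: the inclusion-maximal faces. -/
def facets (G : MDAG V) : Finset (Finset V) :=
  G.faces.filter fun A => ∀ B ∈ G.faces, A ⊆ B → A = B

/-- The edges of the canonical pDAG: those of the directed structure, and for each facet `A` an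
edge from the latent node `A` to each element of `A`. -/
def canonicalEdge (G : MDAG V) : V ⊕ {A // A ∈ G.facets} → V ⊕ {A // A ∈ G.facets} → Prop
  | Sum.inl u, Sum.inl w => (u, w) ∈ G.edges
  | Sum.inr A, Sum.inl w => w ∈ A.1
  | _, Sum.inr _ => False

theorem transGen_canonicalEdge (G : MDAG V) {u : V} {y : V ⊕ {A // A ∈ G.facets}}
    (h : Relation.TransGen G.canonicalEdge (Sum.inl u) y) :
    ∃ w, y = Sum.inl w ∧ Relation.TransGen (fun u w => (u, w) ∈ G.edges) u w := by
  induction h with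
  | @single y h =>
    cases y with
    | inl w => exact ⟨w, rfl, .single h⟩
    | inr A => exact h.elim
  | @tail y z _ h ih =>
    obtain ⟨w, rfl, hw⟩ := ih
    cases z with
    | inl w' => exact ⟨w', rfl, .tail hw h⟩
    | inr A => exact h.elim

/-- The canonical pDAG of an mDAG: one latent node for each facet. -/
def canonical (G : MDAG V) : PDAG V {A // A ∈ G.facets} where
  edge := G.canonicalEdge
  acyclic := by
    rintro (v | A) h
    · obtain ⟨w, hw, h⟩ := G.transGen_canonicalEdge h
      obtain rfl := Sum.inl.inj hw
      exact G.acyclic _ h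
    · obtain ⟨y, -, h⟩ := Relation.TransGen.tail'_iff.1 h
      cases y <;> exact h.elim

/-- The skeleton: `u` and `w` are adjacent if there is a directed edge between them or if some
face contains both. -/
def skeleton (G : MDAG V) : SimpleGraph V where
  Adj u w := u ≠ w ∧ ((u, w) ∈ G.edges ∨ (w, u) ∈ G.edges ∨ ∃ B ∈ G.faces, u ∈ B ∧ w ∈ B)
  symm := ⟨by
    rintro u w ⟨h, h' | h' | ⟨B, hB, hu, hw⟩⟩
    · exact ⟨h.symm, .inr (.inl h')⟩
    · exact ⟨h.symm, .inl h'⟩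
    · exact ⟨h.symm, .inr (.inr ⟨B, hB, hw, hu⟩)⟩⟩
  loopless := ⟨fun _ h => h.1 rfl⟩

/-- The mDAG has a d-separation relation between two nonempty sets of nodes. -/
def HasDSepRelation (G : MDAG V) : Prop :=
  ∃ A B C : Finset V, A.Nonempty ∧ B.Nonempty ∧ Disjoint A B ∧ Disjoint A C ∧ Disjoint B C ∧
    G.canonical.DSep A B C

/-- The two mDAGs have the same d-separation relations. -/
def SameDSep (G H : MDAG V) : Prop :=
  ∀ A B C : Finset V, Disjoint A B → Disjoint A C → Disjoint B C →
    (G.canonical.DSep A B C ↔ H.canonical.DSep A B C)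

/-- The two mDAGs have the same d-separation relations and the same skeleton. -/
def SameDSepSkeleton (G H : MDAG V) : Prop :=
  G.SameDSep H ∧ G.skeleton = H.skeleton

/-- The simplicial complex as drawn: its facets with at least two elements. -/
def confounders (G : MDAG V) : Finset (Finset V) :=
  G.facets.filter fun A => 2 ≤ A.card

variable [Fintype V]

/-- `G` observationally dominates `H`. -/
def Dominates (G H : MDAG V) : Prop := G.canonical.Dominates H.canonical

/-- `G` and `H` are observationally equivalent. -/
def ObsEquiv (G H : MDAG V) : Prop := G.canonical.ObsEquiv H.canonical

/-- `G` is algebraic. -/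
def Algebraic (G : MDAG V) : Prop := G.canonical.Algebraic

end MDAG

/-! ### The three-node mDAGs with nodal ordering `(a, b, c)`

The nodes `a`, `b`, `c` are the elements `0`, `1`, `2` of `Fin 3`. -/

/-- The three-node mDAGs consistent with the nodal ordering `(a, b, c)`. -/
def ordered : Set (MDAG (Fin 3)) :=
  {G | G.canonical.ConsistentWith (Equiv.refl (Fin 3))}

/-- The observational equivalence classes of the ordered three-node mDAGs. -/
def obsClasses : Set (Set (MDAG (Fin 3))) :=
  {K | ∃ G ∈ ordered, K = {H | H ∈ ordered ∧ G.ObsEquiv H}}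

/-- The class `K` strictly dominates the class `K'`. -/
def StrictlyDominates (K K' : Set (MDAG (Fin 3))) : Prop :=
  ∀ G ∈ K, ∀ H ∈ K', G.Dominates H ∧ ¬ G.ObsEquiv H

/-- The class `K` is singled out, among the ordered three-node mDAGs, by the features that the
relation `R` compares: an ordered mDAG that has the same features as a member of `K` is in `K`. -/
def SingledOutBy (R : MDAG (Fin 3) → MDAG (Fin 3) → Prop) (K : Set (MDAG (Fin 3))) : Prop :=
  ∀ G ∈ K, ∀ H ∈ ordered, R G H → H ∈ K

/-- The names of the fifteen classes. -/
inductive ClassName where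
  | saturated
  | triangle
  | evans
  | instrumentalABC
  | instrumentalBAC
  | instrumentalCAB
  | colliderA
  | colliderB
  | colliderC
  | fork
  | chain
  | factorizingAB_C
  | factorizingAC_B
  | factorizingBC_A
  | factorizing
  deriving DecidableEq

namespace ClassName

/-- The directed edge `a → b`. -/
abbrev ab : Fin 3 × Fin 3 := (0, 1)
/-- The directed edge `a → c`. -/
abbrev ac : Fin 3 × Fin 3 := (0, 2)
/-- The directed edge `b → c`. -/
abbrev bc : Fin 3 × Fin 3 := (1, 2)
/-- The facet `{a, b}`. -/
abbrev AB : Finset (Fin 3) := {0, 1}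
/-- The facet `{a, c}`. -/
abbrev AC : Finset (Fin 3) := {0, 2}
/-- The facet `{b, c}`. -/
abbrev BC : Finset (Fin 3) := {1, 2}
/-- The facet `{a, b, c}`. -/
abbrev ABC : Finset (Fin 3) := {0, 1, 2}

/-- The mDAGs in each class, each given by its directed edges and by its facets with at least two
elements. -/
def table : ClassName → List (Finset (Fin 3 × Fin 3) × Finset (Finset (Fin 3)))
  | factorizing => [(∅, ∅)]
  | factorizingAB_C => [({ab}, ∅), (∅, {AB}), ({ab}, {AB})]
  | factorizingAC_B => [({ac}, ∅), (∅, {AC}), ({ac}, {AC})]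
  | factorizingBC_A => [({bc}, ∅), (∅, {BC}), ({bc}, {BC})]
  | chain => [({ab, bc}, ∅), ({bc}, {AB}), ({ab, bc}, {AB})]
  | fork => [({ab, ac}, ∅), ({ac}, {AB}), ({ab}, {AC}), ({ab, ac}, {AB}), ({ab, ac}, {AC})]
  | colliderA => [(∅, {AB, AC})]
  | colliderB => [(∅, {AB, BC}), ({ab}, {BC}), ({ab}, {AB, BC})]
  | colliderC => [(∅, {AC, BC}), ({ac, bc}, ∅), ({ac}, {BC}), ({bc}, {AC}), ({ac}, {AC, BC}),
      ({bc}, {AC, BC}), ({ac, bc}, {AC}), ({ac, bc}, {BC}), ({ac, bc}, {AC, BC})]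
  | instrumentalABC => [({bc}, {AB, BC}), ({ab, bc}, {BC}), ({ab, bc}, {AB, BC})]
  | instrumentalBAC => [({ac}, {AB, AC})]
  | instrumentalCAB => [({ab}, {AB, AC})]
  | evans => [({ab, ac}, {AB, AC})]
  | triangle => [(∅, {AB, AC, BC})]
  | saturated => [(∅, {ABC}),
      ({ab}, {AC, BC}), ({ab}, {AB, AC, BC}), ({ab}, {ABC}),
      ({ac}, {AB, BC}), ({ac}, {AB, AC, BC}), ({ac}, {ABC}),
      ({bc}, {AB, AC}), ({bc}, {AB, AC, BC}), ({bc}, {ABC}),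
      ({ab, ac}, {BC}), ({ab, ac}, {AB, BC}), ({ab, ac}, {AC, BC}),
      ({ab, ac}, {AB, AC, BC}), ({ab, ac}, {ABC}),
      ({ab, bc}, {AC}), ({ab, bc}, {AB, AC}), ({ab, bc}, {AC, BC}),
      ({ab, bc}, {AB, AC, BC}), ({ab, bc}, {ABC}),
      ({ac, bc}, {AB}), ({ac, bc}, {AB, AC}), ({ac, bc}, {AB, BC}),
      ({ac, bc}, {AB, AC, BC}), ({ac, bc}, {ABC}),
      ({ab, ac, bc}, ∅), ({ab, ac, bc}, {AB}), ({ab, ac, bc}, {AC}), ({ab, ac, bc}, {BC}),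
      ({ab, ac, bc}, {AB, AC}), ({ab, ac, bc}, {AB, BC}), ({ab, ac, bc}, {AC, BC}),
      ({ab, ac, bc}, {AB, AC, BC}), ({ab, ac, bc}, {ABC})]

/-- The set of mDAGs in the class. -/
def members (k : ClassName) : Set (MDAG (Fin 3)) :=
  {G | (G.edges, G.confounders) ∈ k.table}

/-- The classes at the lower ends of the lines of the diagram that start at a given class. -/
def below : ClassName → List ClassName
  | saturated => [triangle, evans, instrumentalABC]
  | evans => [instrumentalBAC, instrumentalCAB]
  | triangle => [colliderA, colliderB, colliderC]
  | instrumentalABC => [colliderB, chain]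
  | instrumentalBAC => [colliderA, fork]
  | instrumentalCAB => [colliderA, fork]
  | colliderA => [factorizingAB_C, factorizingAC_B]
  | colliderB => [factorizingAB_C, factorizingBC_A]
  | colliderC => [factorizingAC_B, factorizingBC_A]
  | fork => [factorizingAB_C, factorizingAC_B]
  | chain => [factorizingAB_C, factorizingBC_A]
  | factorizingAB_C => [factorizing]
  | factorizingAC_B => [factorizing]
  | factorizingBC_A => [factorizing]
  | factorizing => []

/-- There is a line of the diagram from `k` down to `l`. -/
def Line (k l : ClassName) : Prop := l ∈ k.below

end ClassName

end CausalOrder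

/-! All classes are compared through one explicit representative each. Error variables are first
averaged into stochastic kernels, so that realizability becomes a statement about independent latent
variables and kernels (`MDAG.realizable_eq`); facets with at most one element do not matter. If some
cardinality is 0, nothing is realizable, so positive cardinalities may be assumed.

Equivalences inside a class rest on two exchanges between `v` and a node `w` that reads everything
`v` reads. An edge `v → w` can be traded for a common latent variable, which carries the whole
response function of `v` (`kernelRealizable_insert_edge`). Conversely, next to an edge `v → w`, a
common latent variable can be averaged out by Bayes' rule (`kernelRealizable_addLatent`). If `u` has
no parents and no other latent variables, then an edge `u → w`, a confounder, and both together are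
thus interchangeable, and a finite check moves every nonsaturated member to its representative. The
saturated members are caught between the full simplex and eight minimal members, each of which
realizes the full simplex.

Dominance along the lines is inclusion of edges and faces. The absence of any other dominance
follows by transitivity from nine critical pairs. These are settled by supports: when latent values
behind two possible outcomes are recombined, nodes that read nothing new can behave as before, and
this forces further outcomes to be possible. The witnesses are perfect correlation, parity, the
three-bit perfectly correlated distribution, and a ternary distribution for the two instrumental
classes with common cause `a`.

Ten representatives are DAGs without latent variables. For these, realizability is the ordered
Markov property (`faceRealizable_empty_eq`), which is polynomial once cross-multiplied, so these
classes are algebraic. For each of the other five there is a line with a realizable segment and a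
nonrealizable point in the simplex; a polynomial that vanishes on the segment vanishes on the line
(`PDAG.not_algebraic_of_line`).

With three nodes, d-separation of two nonadjacent nodes depends only on the links at the third node.
D-separation and skeletons thus become decidable functions of edges and confounders that are
constant on classes, and the remaining claims are finite checks. -/

namespace CausalOrder

/-! ### Kernel models

A form of the causal models with stochastic kernels instead of error variables and with an
arbitrary finite family of parentless latent variables. -/

/-- A model with visible nodes `V`, directed edges `E` between them, and one parentless latent
variable for each `i`, whose set of children is `T i`. -/
structure KernelModel {V ι : Type} [Fintype V] [Fintype ι] [DecidableEq V] [DecidableEq ι]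
    (E : Finset (V × V)) (T : ι → Finset V) (c : V → ℕ) where
  Lat : ι → Type
  latFintype : ∀ i, Fintype (Lat i)
  weight : ∀ i, Lat i → ℝ
  kernel : ∀ v, (∀ u, Fin (c u)) → (∀ i, Lat i) → Fin (c v) → ℝ
  weight_nonneg : ∀ i l, 0 ≤ weight i l
  weight_sum : ∀ i, ∑ l, weight i l = 1
  kernel_nonneg : ∀ v x l y, 0 ≤ kernel v x l y
  kernel_sum : ∀ v x l, ∑ y, kernel v x l y = 1
  kernel_congr : ∀ v x x' l l', (∀ u, (u, v) ∈ E → x u = x' u) →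
    (∀ i, v ∈ T i → l i = l' i) → kernel v x l = kernel v x' l'

attribute [instance] KernelModel.latFintype

section KernelModel

variable {V ι κ : Type} [Fintype V] [Fintype ι] [Fintype κ] [DecidableEq V] [DecidableEq ι]
  [DecidableEq κ] {E E' : Finset (V × V)} {T : ι → Finset V} {T' : κ → Finset V} {c : V → ℕ}

/-- The distribution of the visible variables. -/
def KernelModel.dist (M : KernelModel E T c) (x : ∀ v, Fin (c v)) : ℝ :=
  ∑ l, (∏ i, M.weight i (l i)) * ∏ v, M.kernel v x l (x v)

/-- The distributions that have a kernel model. -/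
def kernelRealizable (E : Finset (V × V)) (T : ι → Finset V) (c : V → ℕ) :
    Set ((∀ v, Fin (c v)) → ℝ) :=
  Set.range fun M : KernelModel E T c => M.dist

theorem KernelModel.lat_nonempty (M : KernelModel E T c) (i : ι) : Nonempty (M.Lat i) := by
  by_contra h
  rw [not_nonempty_iff] at h
  simpa using M.weight_sum i

/-- A latent variable `j` on the right carries the tuple of all independent latent variables `i`
with `g i = j`; every node that read `i` also reads `j` and picks out its component. -/
theorem kernelRealizable_mono (hE : E ⊆ E') (g : ι → κ) (hg : ∀ i, T i ⊆ T' (g i)) :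
    kernelRealizable E T c ⊆ kernelRealizable E' T' c := by
  rintro _ ⟨M, rfl⟩
  refine ⟨{ Lat := fun j => ∀ i : {i // g i = j}, M.Lat i.1
            latFintype := fun j => inferInstance
            weight := fun j l => ∏ i, M.weight i.1 (l i)
            kernel := fun v x l => M.kernel v x fun i => l (g i) ⟨i, rfl⟩
            weight_nonneg := fun j l => Finset.prod_nonneg fun i _ => M.weight_nonneg _ _
            weight_sum := fun j => ?_
            kernel_nonneg := fun v x l y => M.kernel_nonneg _ _ _ _
            kernel_sum := fun v x l => M.kernel_sum _ _ _
            kernel_congr := fun v x x' l l' hx hl => M.kernel_congr _ _ _ _ _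
              (fun u hu => hx u (hE hu)) fun i hi => by rw [hl _ (hg i hi)] }, ?_⟩
  · rw [← Fintype.prod_sum]
    exact Finset.prod_eq_one fun i _ => M.weight_sum _
  · funext x
    refine Fintype.sum_equiv
      { toFun := fun l i => l (g i) ⟨i, rfl⟩
        invFun := fun m j (i : {i // g i = j}) => m i.1
        left_inv := fun l => by
          funext j ⟨i, hi⟩
          subst hi
          rfl
        right_inv := fun m => rfl } _ _ fun l => ?_
    simp only [Equiv.coe_fn_mk]
    rw [← Fintype.prod_fiberwise g]
    congr 1
    refine Finset.prod_congr rfl fun j _ => Finset.prod_congr rfl fun i _ => ?_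
    obtain ⟨i, rfl⟩ := i
    rfl

/-- Latent variables with a single child can be absorbed into the kernel of that child. -/
theorem kernelRealizable_sumElim_singleton :
    kernelRealizable E (Sum.elim T fun v => {v}) c ⊆ kernelRealizable E T c := by
  rintro _ ⟨M, rfl⟩
  -- Filler values for the private latent variables of the other nodes; the kernel of `v` does not
  -- read them.
  let m₀ := fun v => (M.lat_nonempty (Sum.inr v)).some
  let e := Equiv.sumPiEquivProdPi M.Lat
  refine ⟨{ Lat := fun i => M.Lat (Sum.inl i)
            latFintype := fun i => inferInstance
            weight := fun i => M.weight (Sum.inl i)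
            kernel := fun v x l y => ∑ m, M.weight (Sum.inr v) m *
              M.kernel v x (e.symm (l, Function.update m₀ v m)) y
            weight_nonneg := fun i l => M.weight_nonneg _ _
            weight_sum := fun i => M.weight_sum _
            kernel_nonneg := fun v x l y => Finset.sum_nonneg fun m _ =>
              mul_nonneg (M.weight_nonneg _ _) (M.kernel_nonneg _ _ _ _)
            kernel_sum := fun v x l => ?_
            kernel_congr := fun v x x' l l' hx hl => ?_ }, ?_⟩
  · rw [Finset.sum_comm]
    simp_rw [← Finset.mul_sum, M.kernel_sum, mul_one, M.weight_sum]
  · funext y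
    refine Finset.sum_congr rfl fun m _ => ?_
    rw [M.kernel_congr v x x' (e.symm (l, Function.update m₀ v m))
      (e.symm (l', Function.update m₀ v m)) hx]
    rintro (i | u) h
    · exact hl i h
    · rfl
  · funext x
    simp only [KernelModel.dist]
    rw [← Fintype.sum_equiv e.symm _ _ fun _ => rfl, Fintype.sum_prod_type]
    refine Finset.sum_congr rfl fun l _ => ?_
    rw [Fintype.prod_sum, Finset.mul_sum]
    refine Finset.sum_congr rfl fun m _ => ?_
    rw [Fintype.prod_sum_type, Finset.prod_mul_distrib, mul_assoc]
    congr 2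
    refine Finset.prod_congr rfl fun v _ => ?_
    refine congrFun (M.kernel_congr _ _ _ _ _ (fun _ _ => rfl) ?_) _
    rintro (i | u) h
    · rfl
    · obtain rfl : v = u := by simpa using h
      simp [e]

/-- Draw a random function `e` whose values `e p` are independent with laws `k p`: its value at `p₀`
then has law `k p₀`. Kernels can thus be replaced by randomness drawn in advance and deterministic
evaluation. -/
theorem sum_response {D Y : Type} [Fintype D] [DecidableEq D] [Fintype Y]
    (k : D → Y → ℝ) (hk : ∀ p, ∑ y, k p y = 1) (p₀ : D) (h : Y → ℝ) :
    ∑ e : D → Y, (∏ p, k p (e p)) * h (e p₀) = ∑ y, k p₀ y * h y := by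
  have : ∀ e : D → Y, (∏ p, k p (e p)) * h (e p₀) =
      ∏ p, k p (e p) * (if p = p₀ then h (e p) else 1) := fun e => by
    rw [Finset.prod_mul_distrib, Finset.prod_ite_eq' Finset.univ p₀ fun p => h (e p)]
    simp
  simp_rw [this]
  rw [← Fintype.prod_sum fun p y => k p y * (if p = p₀ then h y else 1),
    Finset.prod_eq_single p₀]
  · simp
  · intro p _ hp
    simp [hp, hk]
  · simp

/-- Values of a family of latent variables together with one more. -/
def optionCons {L : Option ι → Type} (m : L none) (l : ∀ i, L (some i)) : ∀ o, L o
  | none => m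
  | some i => l i

theorem sum_optionCons {L : Option ι → Type} [∀ o, Fintype (L o)] (f : (∀ o, L o) → ℝ) :
    ∑ l, f l = ∑ l : ∀ i, L (some i), ∑ m : L none, f (optionCons m l) := by
  rw [← Fintype.sum_prod_type']
  refine Fintype.sum_equiv
    { toFun := fun l => (fun i => l (some i), l none)
      invFun := fun p => optionCons p.2 p.1
      left_inv := fun l => by
        funext o
        cases o <;> rfl
      right_inv := fun p => rfl } _ _ fun l => ?_
  congr 1
  funext o
  cases o <;> rfl

theorem prod_update_kernel {k : ∀ v, Fin (c v) → ℝ} (x : ∀ v, Fin (c v)) (v : V) :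
    ∏ u, k u (x u) = k v (x v) * ∏ u ∈ Finset.univ.erase v, k u (x u) :=
  (Finset.mul_prod_erase _ _ (Finset.mem_univ v)).symm

instance optionElimFintype {L₀ : Type} {L : ι → Type} [Fintype L₀] [∀ i, Fintype (L i)] :
    ∀ o : Option ι, Fintype (o.elim L₀ L)
  | none => inferInstanceAs (Fintype L₀)
  | some i => inferInstanceAs (Fintype (L i))

variable (T) in
/-- The children of the latent variables after adding one with the children `v` and `w`. -/
def addLatent (v w : V) (o : Option ι) : Finset V := o.elim {v, w} T

/-- Packages a model whose new latent variable is specified apart from the old ones, so that the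
dependent family over `Option ι` is handled only here. -/
theorem mem_kernelRealizable_option {S : Option ι → Finset V} {L₀ : Type} [Fintype L₀]
    {L : ι → Type} [∀ i, Fintype (L i)] (q₀ : L₀ → ℝ) (q : ∀ i, L i → ℝ)
    (K : ∀ v, (∀ u, Fin (c u)) → L₀ → (∀ i, L i) → Fin (c v) → ℝ)
    (hq₀ : ∀ m, 0 ≤ q₀ m) (hq₀s : ∑ m, q₀ m = 1) (hq : ∀ i l, 0 ≤ q i l)
    (hqs : ∀ i, ∑ l, q i l = 1) (hK : ∀ v x m l y, 0 ≤ K v x m l y)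
    (hKs : ∀ v x m l, ∑ y, K v x m l y = 1)
    (hKc : ∀ v x x' m m' l l', (∀ u, (u, v) ∈ E → x u = x' u) → (v ∈ S none → m = m') →
      (∀ i, v ∈ S (some i) → l i = l' i) → K v x m l = K v x' m' l')
    {P : (∀ v, Fin (c v)) → ℝ}
    (hP : ∀ x, P x = ∑ l : ∀ i, L i, ∑ m, (q₀ m * ∏ i, q i (l i)) * ∏ v, K v x m l (x v)) :
    P ∈ kernelRealizable E S c := by
  refine ⟨{ Lat := fun o => o.elim L₀ L
            latFintype := fun o => inferInstance
            weight := fun o => match o with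
              | none => q₀
              | some i => q i
            kernel := fun v x l => K v x (l none) fun i => l (some i)
            weight_nonneg := fun o => ?_
            weight_sum := fun o => ?_
            kernel_nonneg := fun v x l y => hK _ _ _ _ _
            kernel_sum := fun v x l => hKs _ _ _ _
            kernel_congr := fun v x x' l l' hx hl => hKc _ _ _ _ _ _ _ hx (hl none)
              fun i => hl (some i) }, ?_⟩
  · cases o
    exacts [hq₀, hq _]
  · cases o
    exacts [hq₀s, hqs _]
  · funext x
    rw [hP]
    simp only [KernelModel.dist]
    rw [sum_optionCons]
    simp only [Fintype.prod_option]
    rfl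

/-- If `w` knows all that determines `v`, then an edge `v → w` can be replaced by a latent variable
shared by `v` and `w`. -/
theorem kernelRealizable_insert_edge {v w : V} (hvw : v ≠ w)
    (hpa : ∀ u, (u, v) ∈ E → (u, w) ∈ E) (hlat : ∀ i, v ∈ T i → w ∈ T i) (hc : ∀ v, c v ≠ 0) :
    kernelRealizable (insert (v, w) E) T c ⊆ kernelRealizable E (addLatent T v w) c := by
  classical
  rintro _ ⟨M, rfl⟩
  let x₀ : ∀ u, Fin (c u) := fun u => ⟨0, Nat.pos_of_ne_zero (hc u)⟩
  let l₀ := fun i => (M.lat_nonempty i).some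
  -- `D` collects everything that `v` reads, and `k` is the kernel of `v` as a function of it; the
  -- fillers `x₀` and `l₀` do not affect `k`.
  let D := (∀ u : {u // (u, v) ∈ E}, Fin (c u)) × (∀ i : {i // v ∈ T i}, M.Lat i)
  let res : (∀ u, Fin (c u)) → (∀ i, M.Lat i) → D := fun x l => (fun u => x u, fun i => l i)
  let k : D → Fin (c v) → ℝ := fun p => M.kernel v
    (fun u => if h : (u, v) ∈ E then p.1 ⟨u, h⟩ else x₀ u)
    (fun i => if h : v ∈ T i then p.2 ⟨i, h⟩ else l₀ i)
  have hk : ∀ x l, k (res x l) = M.kernel v x l := fun x l =>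
    M.kernel_congr _ _ _ _ _ (fun u hu => by
      have : (u, v) ∈ E := by simpa [hvw] using hu
      simp [res, this]) fun i hi => by simp [res, hi]
  have hres : ∀ x x' l l', (∀ u, (u, v) ∈ E → x u = x' u) → (∀ i, v ∈ T i → l i = l' i) →
      res x l = res x' l' := fun x x' l l' hx hl =>
    Prod.ext (funext fun u => hx _ u.2) (funext fun i => hl _ i.2)
  have hk0 : ∀ p y, 0 ≤ k p y := fun p y => M.kernel_nonneg _ _ _ _
  have hk1 : ∀ p, ∑ y, k p y = 1 := fun p => M.kernel_sum _ _ _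
  -- The new latent variable is the response function `e` of `v`. Since `w` also sees all inputs of
  -- `v`, it computes `e (res x l)` instead of reading the value of `v`.
  refine mem_kernelRealizable_option (L₀ := D → Fin (c v)) (L := M.Lat)
    (fun e => ∏ p, k p (e p)) M.weight
    (fun u x e l => Function.update (β := fun u => Fin (c u) → ℝ)
      (fun u => M.kernel u (if u = w then Function.update x v (e (res x l)) else x) l)
      v (fun y => if y = e (res x l) then 1 else 0) u)
    (fun e => Finset.prod_nonneg fun p _ => hk0 _ _)
    ((Fintype.prod_sum k).symm.trans (Finset.prod_eq_one fun p _ => hk1 p))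
    M.weight_nonneg M.weight_sum (fun u x e l y => ?_) (fun u x e l => ?_)
    (fun u x x' e e' l l' hx he hl => ?_) (fun x => ?_)
  · by_cases h : u = v
    · subst h
      simp only [Function.update_self]
      split_ifs <;> simp
    · simp only [Function.update_of_ne h]
      exact M.kernel_nonneg _ _ _ _
  · by_cases h : u = v
    · subst h
      simp
    · simp only [Function.update_of_ne h]
      exact M.kernel_sum _ _ _
  · by_cases h : u = v
    · subst h
      simp only [Function.update_self]
      rw [he (by simp [addLatent]), hres x x' _ _ hx hl]
    · simp only [Function.update_of_ne h]
      refine M.kernel_congr _ _ _ _ _ (fun t ht => ?_) hl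
      split_ifs with hw
      · subst hw
        rw [he (by simp [addLatent]), hres x x' _ _ (fun t ht => hx t (hpa t ht))
          fun i hi => hl i (hlat i hi)]
        by_cases htv : t = v
        · subst htv
          simp
        · simpa [htv] using hx t (by simpa [htv] using ht)
      · exact hx t (by simpa [hw] using ht)
  · simp only [KernelModel.dist]
    refine Finset.sum_congr rfl fun l _ => ?_
    have key := sum_response k hk1 (res x l) fun y =>
      if x v = y then ∏ u ∈ Finset.univ.erase v, M.kernel u x l (x u) else 0
    rw [hk] at key
    rw [prod_update_kernel x v, ← (by simpa using key :
      _ = M.kernel v x l (x v) * ∏ u ∈ Finset.univ.erase v, M.kernel u x l (x u)),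
      Finset.mul_sum]
    refine Finset.sum_congr rfl fun e _ => ?_
    rw [prod_update_kernel x v]
    simp only [Function.update_self]
    by_cases he : x v = e (res x l)
    · rw [if_pos he, if_pos he, one_mul]
      have : ∏ u ∈ Finset.univ.erase v, Function.update (β := fun u => Fin (c u) → ℝ)
          (fun u => M.kernel u (if u = w then Function.update x v (e (res x l)) else x) l) v
          (fun y => if y = e (res x l) then 1 else 0) u (x u) =
          ∏ u ∈ Finset.univ.erase v, M.kernel u x l (x u) := by
        refine Finset.prod_congr rfl fun u hu => ?_
        rw [Function.update_of_ne (Finset.ne_of_mem_erase hu), ← he, Function.update_eq_self,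
          ite_self]
      rw [this]
      ring
    · simp [he]

/-- A latent variable shared by `v` and `w` is redundant if there is an edge `v → w` and `w` knows
all else that determines `v`. -/
theorem kernelRealizable_addLatent {v w : V} (hvw : v ≠ w) (he : (v, w) ∈ E)
    (hpa : ∀ u, (u, v) ∈ E → (u, w) ∈ E) (hlat : ∀ i, v ∈ T i → w ∈ T i) :
    kernelRealizable E (addLatent T v w) c ⊆ kernelRealizable E T c := by
  rintro _ ⟨M, rfl⟩
  let m₀ := (M.lat_nonempty none).some
  let kv : (∀ u, Fin (c u)) → (∀ i, M.Lat (some i)) → Fin (c v) → ℝ := fun x l y =>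
    ∑ m, M.weight none m * M.kernel v x (optionCons m l) y
  -- Bayes' rule: `kv` is the law of `v` with the latent variable averaged out, and `kw` the
  -- conditional law of `w` given the value of `v`. On values of `v` of probability 0, any law will
  -- do.
  let kw : (∀ u, Fin (c u)) → (∀ i, M.Lat (some i)) → Fin (c w) → ℝ := fun x l z =>
    if kv x l (x v) = 0 then M.kernel w x (optionCons m₀ l) z else
      (∑ m, M.weight none m * M.kernel v x (optionCons m l) (x v) *
        M.kernel w x (optionCons m l) z) / kv x l (x v)
  have kv0 : ∀ x l y, 0 ≤ kv x l y := fun x l y => Finset.sum_nonneg fun m _ =>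
    mul_nonneg (M.weight_nonneg _ _) (M.kernel_nonneg _ _ _ _)
  have hcons : ∀ (u : V) (x x' : ∀ u, Fin (c u)) (l l' : ∀ i, M.Lat (some i)) (m : M.Lat none),
      (∀ t, (t, u) ∈ E → x t = x' t) → (∀ i, u ∈ T i → l i = l' i) →
      M.kernel u x (optionCons m l) = M.kernel u x' (optionCons m l') :=
    fun u x x' l l' m hx hl => M.kernel_congr _ _ _ _ _ hx fun o ho => by
      cases o with
      | none => rfl
      | some i => exact hl i ho
  have kv_congr : ∀ (x x' : ∀ u, Fin (c u)) (l l' : ∀ i, M.Lat (some i)),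
      (∀ t, (t, v) ∈ E → x t = x' t) → (∀ i, v ∈ T i → l i = l' i) → kv x l = kv x' l' :=
    fun x x' l l' hx hl => funext fun y => Finset.sum_congr rfl fun m _ => by
      rw [hcons v x x' l l' m hx hl]
  refine ⟨{ Lat := fun i => M.Lat (some i)
            latFintype := fun i => inferInstance
            weight := fun i => M.weight (some i)
            kernel := fun u x l => Function.update (β := fun u => Fin (c u) → ℝ)
              (Function.update (β := fun u => Fin (c u) → ℝ)
                (fun u => M.kernel u x (optionCons m₀ l)) w (kw x l)) v (kv x l) u
            weight_nonneg := fun i => M.weight_nonneg _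
            weight_sum := fun i => M.weight_sum _
            kernel_nonneg := fun u x l y => ?_
            kernel_sum := fun u x l => ?_
            kernel_congr := fun u x x' l l' hx hl => ?_ }, ?_⟩
  · by_cases hv : u = v
    · subst hv
      simpa using kv0 x l y
    by_cases hw : u = w
    · subst hw
      simp only [Function.update_of_ne hv, Function.update_self, kw]
      split_ifs
      · exact M.kernel_nonneg _ _ _ _
      · exact div_nonneg (Finset.sum_nonneg fun m _ => mul_nonneg (mul_nonneg
          (M.weight_nonneg _ _) (M.kernel_nonneg _ _ _ _)) (M.kernel_nonneg _ _ _ _)) (kv0 _ _ _)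
    · simp only [Function.update_of_ne hv, Function.update_of_ne hw]
      exact M.kernel_nonneg _ _ _ _
  · by_cases hv : u = v
    · subst hv
      simp only [Function.update_self, kv]
      rw [Finset.sum_comm]
      simp_rw [← Finset.mul_sum, M.kernel_sum, mul_one, M.weight_sum]
    by_cases hw : u = w
    · subst hw
      simp only [Function.update_of_ne hv, Function.update_self, kw]
      split_ifs with h
      · exact M.kernel_sum _ _ _
      · rw [← Finset.sum_div, div_eq_one_iff_eq h, Finset.sum_comm]
        simp_rw [← Finset.mul_sum, M.kernel_sum, mul_one]
        rfl
    · simp only [Function.update_of_ne hv, Function.update_of_ne hw]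
      exact M.kernel_sum _ _ _
  · by_cases hv : u = v
    · subst hv
      simpa using kv_congr x x' l l' hx hl
    by_cases hw : u = w
    · subst hw
      have hx' := fun t ht => hx t (hpa t ht)
      have hl' := fun i hi => hl i (hlat i hi)
      have h1 := kv_congr x x' l l' hx' hl'
      have h2 := fun m => hcons v x x' l l' m hx' hl'
      have h3 := fun m => hcons u x x' l l' m hx hl
      simp only [Function.update_of_ne hv, Function.update_self, kw, h1, h2, h3, hx v he]
    · simp only [Function.update_of_ne hv, Function.update_of_ne hw]
      exact hcons u x x' l l' m₀ hx hl
  · funext x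
    simp only [KernelModel.dist]
    rw [sum_optionCons]
    refine Finset.sum_congr rfl fun l _ => ?_
    have hsplit : ∀ k : ∀ u, Fin (c u) → ℝ, ∏ u, k u (x u) =
        k v (x v) * (k w (x w) * ∏ u ∈ (Finset.univ.erase v).erase w, k u (x u)) := fun k => by
      rw [prod_update_kernel x v, Finset.mul_prod_erase _ (fun u => k u (x u))
        (Finset.mem_erase.2 ⟨hvw.symm, Finset.mem_univ w⟩)]
    have hrest : ∀ m, ∏ u ∈ (Finset.univ.erase v).erase w, M.kernel u x (optionCons m l) (x u) =
        ∏ u ∈ (Finset.univ.erase v).erase w, M.kernel u x (optionCons m₀ l) (x u) := fun m => by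
      refine Finset.prod_congr rfl fun u hu => congrFun (M.kernel_congr _ _ _ _ _
        (fun _ _ => rfl) fun o ho => ?_) _
      cases o with
      | none =>
        simp only [Finset.mem_erase] at hu
        simp [addLatent, hu.1, hu.2.1] at ho
      | some i => rfl
    -- The chain rule for `v` and `w`; when the value of `v` has probability 0, every summand on the
    -- right vanishes.
    have hprod : kv x l (x v) * kw x l (x w) = ∑ m, M.weight none m *
        M.kernel v x (optionCons m l) (x v) * M.kernel w x (optionCons m l) (x w) := by
      simp only [kw]
      split_ifs with h
      · rw [h, zero_mul, eq_comm]
        have h' := (Finset.sum_eq_zero_iff_of_nonneg fun m _ => mul_nonneg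
          (M.weight_nonneg _ _) (M.kernel_nonneg _ _ _ _)).1 h
        exact Finset.sum_eq_zero fun m hm => by rw [h' m hm, zero_mul]
      · exact mul_div_cancel₀ _ h
    rw [hsplit]
    have hrest' : ∏ u ∈ (Finset.univ.erase v).erase w, Function.update
        (β := fun u => Fin (c u) → ℝ) (Function.update (β := fun u => Fin (c u) → ℝ)
          (fun u => M.kernel u x (optionCons m₀ l)) w (kw x l)) v (kv x l) u (x u) =
        ∏ u ∈ (Finset.univ.erase v).erase w, M.kernel u x (optionCons m₀ l) (x u) := by
      refine Finset.prod_congr rfl fun u hu => ?_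
      simp only [Finset.mem_erase] at hu
      rw [Function.update_of_ne hu.2.1, Function.update_of_ne hu.1]
    rw [hrest', Function.update_self, Function.update_of_ne hvw.symm, Function.update_self,
      ← mul_assoc (kv x l (x v)), hprod, Finset.sum_mul, Finset.mul_sum]
    refine Finset.sum_congr rfl fun m _ => ?_
    rw [hsplit, hrest m, Fintype.prod_option]
    simp only [optionCons]
    ring

end KernelModel

/-! ### Realizability for a given family of faces -/

section FaceRealizable

variable {V : Type} [Fintype V] [DecidableEq V] {E E' : Finset (V × V)}
  {F F' : Finset (Finset V)} {c : V → ℕ}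

/-- The distributions that have a kernel model with one latent variable for each member of `F`. -/
def faceRealizable (E : Finset (V × V)) (F : Finset (Finset V)) (c : V → ℕ) :
    Set ((∀ v, Fin (c v)) → ℝ) :=
  kernelRealizable E (fun A : {A // A ∈ F} => A.1) c

/-- Larger faces of `F` merge into faces of `F'`; those with at most one element go to private
latent variables, which are then absorbed into kernels. -/
theorem faceRealizable_mono [Nonempty V] (hE : E ⊆ E')
    (hF : ∀ A ∈ F, A.card ≤ 1 ∨ ∃ B ∈ F', A ⊆ B) :
    faceRealizable E F c ⊆ faceRealizable E' F' c := by
  have : ∀ A : {A // A ∈ F}, ∃ j : {B // B ∈ F'} ⊕ V, A.1 ⊆ Sum.elim (fun B => B.1)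
      (fun v => {v}) j := by
    rintro ⟨A, hA⟩
    obtain h | ⟨B, hB, h⟩ := hF A hA
    · obtain ⟨v, hv⟩ := Finset.card_le_one_iff_subset_singleton.1 h
      exact ⟨Sum.inr v, hv⟩
    · exact ⟨Sum.inl ⟨B, hB⟩, h⟩
  choose g hg using this
  exact (kernelRealizable_mono hE g hg).trans kernelRealizable_sumElim_singleton

/-- The latent variable that replaces the edge need not be added: it merges into the one for the
face `B`. -/
theorem faceRealizable_insert_edge {v w : V} (hvw : v ≠ w)
    (hpa : ∀ u, (u, v) ∈ E → (u, w) ∈ E) (hlat : ∀ A ∈ F, v ∈ A → w ∈ A)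
    (hF : ∃ B ∈ F, v ∈ B ∧ w ∈ B) (hc : ∀ v, c v ≠ 0) :
    faceRealizable (insert (v, w) E) F c ⊆ faceRealizable E F c := by
  obtain ⟨B, hB, hv, hw⟩ := hF
  refine (kernelRealizable_insert_edge hvw hpa (fun A => hlat A.1 A.2) hc).trans
    (kernelRealizable_mono subset_rfl (fun o => o.elim ⟨B, hB⟩ id) ?_)
  rintro (_ | A)
  · simp [addLatent, Finset.insert_subset_iff, hv, hw]
  · exact subset_rfl

theorem faceRealizable_insert_pair {v w : V} (hvw : v ≠ w) (he : (v, w) ∈ E)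
    (hpa : ∀ u, (u, v) ∈ E → (u, w) ∈ E) (hlat : ∀ A ∈ F, v ∈ A → w ∈ A) :
    faceRealizable E (insert {v, w} F) c ⊆ faceRealizable E F c := by
  refine (kernelRealizable_mono subset_rfl
    -- The case split is needed because `{v, w}` may already belong to `F`.
    (fun A => if h : A.1 ∈ F then some ⟨A.1, h⟩ else none) fun A => ?_).trans
    (kernelRealizable_addLatent hvw he hpa fun A => hlat A.1 A.2)
  split_ifs with h
  · exact subset_rfl
  · rw [(Finset.mem_insert.1 A.2).resolve_right h]
    exact subset_rfl

/-- If `u` has no other parents, then an edge `u → w`, a latent variable shared by `u` and `w`,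
and both together are equivalent. -/
theorem faceRealizable_edge_eq_both [Nonempty V] {u w : V} (huw : u ≠ w)
    (hE : ∀ y, (y, u) ∉ E) (hF : ∀ A ∈ F, u ∉ A) :
    faceRealizable (insert (u, w) E) F c =
      faceRealizable (insert (u, w) E) (insert {u, w} F) c :=
  (faceRealizable_mono subset_rfl fun A hA => .inr ⟨A, by simp [hA], subset_rfl⟩).antisymm
    (faceRealizable_insert_pair huw (by simp) (fun y hy => by simp [hE, huw] at hy)
      fun A hA h => (hF A hA h).elim)

theorem faceRealizable_pair_eq_both [Nonempty V] {u w : V} (huw : u ≠ w)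
    (hE : ∀ y, (y, u) ∉ E) (hF : ∀ A ∈ F, u ∉ A) (hc : ∀ v, c v ≠ 0) :
    faceRealizable E (insert {u, w} F) c =
      faceRealizable (insert (u, w) E) (insert {u, w} F) c :=
  (faceRealizable_mono (Finset.subset_insert _ _) fun A hA => .inr ⟨A, hA, subset_rfl⟩).antisymm
    (faceRealizable_insert_edge huw (fun y hy => (hE y hy).elim)
      (fun A hA h => by
        obtain rfl | hA := Finset.mem_insert.1 hA
        · simp
        · exact (hF A hA h).elim) ⟨{u, w}, by simp⟩ hc)

end FaceRealizable

/-! ### Causal models and kernel models -/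

theorem sum_sum_indicator_mul {X Y : Type} [Fintype X] [Fintype Y] [DecidableEq Y] (g : X → Y)
    (p : X → ℝ) : ∑ y, ∑ e, (if y = g e then 1 else 0) * p e = ∑ e, p e := by
  rw [Finset.sum_comm]
  simp

open Classical in
-- Each factor involves only the error variable of its own node, so the sum over all errors
-- distributes over the product and leaves one kernel per node.
theorem PDAG.Model.dist_eq {V L : Type} [Fintype V] [DecidableEq V] [Fintype L] [DecidableEq L]
    {G : PDAG V L} {c : V → ℕ} (M : G.Model c) (x : ∀ v, Fin (c v)) :
    M.dist x = ∑ l : ∀ i, M.Lat i, ∏ z : V ⊕ L, ∑ e : M.Err z,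
      (if PDAG.joint (Lat := M.Lat) x l z = M.f z (fun y => PDAG.joint x l y.1) e then 1 else 0) *
        M.errDist z e :=
  Finset.sum_congr rfl fun l _ => (Fintype.prod_sum fun (z : V ⊕ L) (e : M.Err z) =>
      (if PDAG.joint (Lat := M.Lat) x l z = M.f z (fun y => PDAG.joint x l y.1) e then 1 else 0) *
        M.errDist z e).symm

section Canonical

variable {V : Type} [DecidableEq V] {c : V → ℕ}

/-- By well-founded induction along the edges: values of the parents and an error value yield a
value of the node. -/
theorem PDAG.Model.state_nonempty {V L : Type} [Finite V] [Finite L] {G : PDAG V L} {c : V → ℕ}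
    (M : G.Model c) (x : V ⊕ L) : Nonempty (PDAG.State c M.Lat x) := by
  have : IsTrans (V ⊕ L) (Relation.TransGen G.edge) := ⟨fun _ _ _ => Relation.TransGen.trans⟩
  have : Std.Irrefl (Relation.TransGen G.edge) := ⟨G.acyclic⟩
  induction x using (Finite.wellFounded_of_trans_of_irrefl (Relation.TransGen G.edge)).induction
  rename_i x ih
  have : Nonempty (M.Err x) := by
    by_contra h
    rw [not_nonempty_iff] at h
    simpa using M.errDist_sum x
  exact ⟨M.f x (fun y => (ih y.1 (.single y.2)).some) (Classical.arbitrary _)⟩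

/-- Disposes of zero cardinalities, for which the results on kernel models are not available. -/
theorem PDAG.realizable_eq_empty {V L : Type} [Fintype V] [DecidableEq V] [Fintype L]
    [DecidableEq L] {G : PDAG V L} {c : V → ℕ} (hc : ¬ ∀ v, c v ≠ 0) : G.Realizable c = ∅ := by
  push Not at hc
  obtain ⟨v, hv⟩ := hc
  refine Set.eq_empty_of_forall_notMem ?_
  rintro _ ⟨M, -⟩
  obtain ⟨y⟩ := M.state_nonempty (Sum.inl v)
  have y' : Fin (c v) := y
  exact (Fin.cast hv y').elim0

variable [Fintype V]

/-- Averaging over the error of a visible node gives its kernel. A latent node has no parents, so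
averaging over its error gives its weight. -/
theorem MDAG.realizable_subset (G : MDAG V) :
    G.canonical.Realizable c ⊆ faceRealizable G.edges G.facets c := by
  classical
  rintro _ ⟨M, rfl⟩
  have hno : ∀ (A : {A // A ∈ G.facets}) (y : V ⊕ {A // A ∈ G.facets}),
      ¬ G.canonical.edge y (Sum.inr A) := by
    rintro A (y | y) h <;> exact h
  refine ⟨{ Lat := M.Lat
            latFintype := M.latFintype
            weight := fun A l => ∑ e, (if l = M.f (Sum.inr A) (fun y => (hno A _ y.2).elim) e
              then 1 else 0) * M.errDist (Sum.inr A) e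
            kernel := fun v x l y => ∑ e, (if y = M.f (Sum.inl v)
              (fun z => PDAG.joint (Lat := M.Lat) x l z.1) e then 1 else 0) * M.errDist (Sum.inl v) e
            weight_nonneg := fun A l => Finset.sum_nonneg fun e _ => mul_nonneg
              (by split_ifs <;> simp) (M.errDist_nonneg _ _)
            weight_sum := fun A => ?_
            kernel_nonneg := fun v x l y => Finset.sum_nonneg fun e _ => mul_nonneg
              (by split_ifs <;> simp) (M.errDist_nonneg _ _)
            kernel_sum := fun v x l => ?_
            kernel_congr := fun v x x' l l' hx hl => ?_ }, ?_⟩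
  · exact (sum_sum_indicator_mul _ _).trans (M.errDist_sum (Sum.inr A))
  · exact (@sum_sum_indicator_mul _ (Fin (c v)) _ _ (fun _ _ => Classical.propDecidable _)
      (M.f (Sum.inl v) fun z => PDAG.joint x l z.1) _).trans
      (M.errDist_sum (Sum.inl v))
  · have : (fun z : {z // G.canonical.edge z (Sum.inl v)} => PDAG.joint (Lat := M.Lat) x l z.1) =
        fun z : {z // G.canonical.edge z (Sum.inl v)} => PDAG.joint (Lat := M.Lat) x' l' z.1 := by
      funext ⟨z, hz⟩
      rcases z with u | A
      · exact hx u hz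
      · exact hl A hz
    funext y
    rw [this]
  · funext x
    simp only [KernelModel.dist, PDAG.Model.dist_eq]
    refine Finset.sum_congr rfl fun l _ => ?_
    rw [Fintype.prod_sum_type, mul_comm]
    congr 1
    refine Finset.prod_congr rfl fun A _ => Finset.sum_congr rfl fun e _ => ?_
    have : (fun y : {y // G.canonical.edge y (Sum.inr A)} => PDAG.joint (Lat := M.Lat) x l y.1) =
        fun y => (hno A _ y.2).elim := funext fun y => (hno A _ y.2).elim
    rw [this]
    rfl

/-- The error of a visible node is its random response function, as in `sum_response`; the error of
a latent node is its value. -/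
theorem MDAG.subset_realizable (G : MDAG V) (hc : ∀ v, c v ≠ 0) :
    faceRealizable G.edges G.facets c ⊆ G.canonical.Realizable c := by
  classical
  rintro _ ⟨M, rfl⟩
  let x₀ : ∀ u, Fin (c u) := fun u => ⟨0, Nat.pos_of_ne_zero (hc u)⟩
  let l₀ := fun i => (M.lat_nonempty i).some
  let D := (∀ u, Fin (c u)) × (∀ i, M.Lat i)
  -- Values of the parents are extended by fillers to all nodes, because kernels formally take full
  -- assignments; `hext` shows that the fillers do not matter.
  let ext : ∀ v, (∀ y : {y // G.canonical.edge y (Sum.inl v)}, PDAG.State c M.Lat y.1) → D :=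
    fun v p => (fun u => if h : G.canonical.edge (Sum.inl u) (Sum.inl v) then p ⟨Sum.inl u, h⟩
        else x₀ u,
      fun A => if h : G.canonical.edge (Sum.inr A) (Sum.inl v) then p ⟨Sum.inr A, h⟩ else l₀ A)
  have hext : ∀ v x l, M.kernel v (ext v fun y => PDAG.joint x l y.1).1
      (ext v fun y => PDAG.joint x l y.1).2 = M.kernel v x l := fun v x l =>
    M.kernel_congr _ _ _ _ _ (fun u hu => dif_pos hu) fun A hA => dif_pos hA
  refine ⟨{ Lat := M.Lat
            latFintype := M.latFintype
            Err := fun z => match z with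
              | Sum.inl v => D → Fin (c v)
              | Sum.inr A => M.Lat A
            errFintype := fun z => match z with
              | Sum.inl v => inferInstanceAs (Fintype (D → Fin (c v)))
              | Sum.inr A => M.latFintype A
            f := fun z => match z with
              | Sum.inl v => fun p e => e (ext v p)
              | Sum.inr A => fun _ e => e
            errDist := fun z => match z with
              | Sum.inl v => fun e => ∏ p : D, M.kernel v p.1 p.2 (e p)
              | Sum.inr A => M.weight A
            errDist_nonneg := fun z => ?_
            errDist_sum := fun z => ?_ }, ?_⟩
  · rcases z with v | A
    · exact fun e => Finset.prod_nonneg fun p _ => M.kernel_nonneg _ _ _ _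
    · exact M.weight_nonneg A
  · rcases z with v | A
    · exact (Fintype.prod_sum fun (p : D) y => M.kernel v p.1 p.2 y).symm.trans
        (Finset.prod_eq_one fun p _ => M.kernel_sum _ _ _)
    · exact M.weight_sum A
  · funext x
    simp only [KernelModel.dist, PDAG.Model.dist_eq]
    refine Finset.sum_congr rfl fun l _ => ?_
    rw [Fintype.prod_sum_type, mul_comm]
    congr 1
    · refine Finset.prod_congr rfl fun A _ => ?_
      have : ∀ e : M.Lat A, (if l A = e then (1 : ℝ) else 0) * M.weight A e =
          if l A = e then M.weight A e else 0 := fun e => by split_ifs <;> simp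
      refine (Finset.sum_congr rfl fun e _ => this e).trans ?_
      simp
    · refine Finset.prod_congr rfl fun v _ => ?_
      have := sum_response (fun (p : D) y => M.kernel v p.1 p.2 y)
        (fun p => M.kernel_sum _ _ _) (ext v fun y => PDAG.joint x l y.1)
        fun y => @ite ℝ (x v = y) (Classical.propDecidable _) 1 0
      rw [hext] at this
      refine (Finset.sum_congr rfl fun e _ => mul_comm _ _).trans (this.trans ?_)
      simp

theorem MDAG.facets_eq_confounders [Nonempty V] (G : MDAG V) (E : Finset (V × V)) :
    faceRealizable E G.facets c = faceRealizable E G.confounders c := by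
  refine (faceRealizable_mono subset_rfl fun A hA => ?_).antisymm
    (faceRealizable_mono subset_rfl fun A hA =>
      .inr ⟨A, (Finset.mem_filter.1 hA).1, subset_rfl⟩)
  by_cases h : A.card ≤ 1
  · exact .inl h
  · exact .inr ⟨A, Finset.mem_filter.2 ⟨hA, by omega⟩, subset_rfl⟩

theorem MDAG.realizable_eq [Nonempty V] (G : MDAG V) (hc : ∀ v, c v ≠ 0) :
    G.canonical.Realizable c = faceRealizable G.edges G.confounders c := by
  rw [← G.facets_eq_confounders]
  exact G.realizable_subset.antisymm (G.subset_realizable hc)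

end Canonical

/-! ### Directed acyclic graphs without latent variables -/

section Marginal

variable {V : Type} [Fintype V] [DecidableEq V] {c : V → ℕ}

/-- Exchanging `y v` with `t` is an involution on pairs. It allows a single coordinate to be summed
out while keeping sums over full assignments. -/
theorem sum_sum_update (v : V) (F : (∀ u, Fin (c u)) → ℝ) :
    ∑ y, ∑ t, F (Function.update y v t) = c v * ∑ y, F y := by
  rw [← Fintype.sum_prod_type']
  have := Fintype.sum_equiv (M := ℝ)
    { toFun := fun p : (∀ u, Fin (c u)) × Fin (c v) => (Function.update p.1 v p.2, p.1 v)
      invFun := fun p => (Function.update p.1 v p.2, p.1 v)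
      left_inv := fun p => by simp
      right_inv := fun p => by simp } (fun p => F (Function.update p.1 v p.2)) (fun p => F p.1)
    fun p => rfl
  rw [this, Fintype.sum_prod_type]
  simp [Finset.mul_sum]

/-- The probability, according to `P`, of agreeing with `x` on `S`. -/
def marginal (S : Finset V) (P : (∀ v, Fin (c v)) → ℝ) (x : ∀ v, Fin (c v)) : ℝ :=
  ∑ y, if ∀ u ∈ S, y u = x u then P y else 0

theorem marginal_nonneg {P : (∀ v, Fin (c v)) → ℝ} (hP : ∀ x, 0 ≤ P x) (S : Finset V)
    (x : ∀ v, Fin (c v)) : 0 ≤ marginal S P x :=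
  Finset.sum_nonneg fun y _ => by
    split_ifs
    exacts [hP y, le_rfl]

theorem marginal_congr (S : Finset V) (P : (∀ v, Fin (c v)) → ℝ) {x x' : ∀ v, Fin (c v)}
    (h : ∀ u ∈ S, x u = x' u) : marginal S P x = marginal S P x' :=
  Finset.sum_congr rfl fun y _ => by
    congr 1
    exact propext (forall₂_congr fun u hu => by rw [h u hu])

theorem marginal_anti {P : (∀ v, Fin (c v)) → ℝ} (hP : ∀ x, 0 ≤ P x) {S S' : Finset V}
    (h : S ⊆ S') (x : ∀ v, Fin (c v)) : marginal S' P x ≤ marginal S P x :=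
  Finset.sum_le_sum fun y _ => by
    split_ifs with h1 h2
    · exact le_rfl
    · exact (h2 fun u hu => h1 u (h hu)).elim
    · exact hP y
    · exact le_rfl

theorem marginal_univ (P : (∀ v, Fin (c v)) → ℝ) (x : ∀ v, Fin (c v)) :
    marginal Finset.univ P x = P x := by
  simp [marginal, ← funext_iff]

theorem marginal_empty (P : (∀ v, Fin (c v)) → ℝ) (x : ∀ v, Fin (c v)) :
    marginal ∅ P x = ∑ y, P y := by
  simp [marginal]

theorem sum_marginal_insert {S : Finset V} {v : V} (hv : v ∉ S) (P : (∀ v, Fin (c v)) → ℝ)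
    (x : ∀ v, Fin (c v)) :
    ∑ t, marginal (insert v S) P (Function.update x v t) = marginal S P x := by
  simp only [marginal]
  rw [Finset.sum_comm]
  refine Finset.sum_congr rfl fun y _ => ?_
  have h : ∀ t, (∀ u ∈ insert v S, y u = Function.update x v t u) ↔
      y v = t ∧ ∀ u ∈ S, y u = x u := fun t => by
    rw [Finset.forall_mem_insert, Function.update_self]
    refine and_congr_right fun _ => forall₂_congr fun u hu => ?_
    rw [Function.update_of_ne (ne_of_mem_of_not_mem hu hv)]
  simp only [h, ite_and]
  simp

end Marginal

/-! ### Summing out kernels in decreasing order of rank -/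

theorem kernel_update_of_rank_le {V : Type} [DecidableEq V] {c : V → ℕ} {E : Finset (V × V)}
    {r : V → ℕ} {K : ∀ v, (∀ u, Fin (c u)) → Fin (c v) → ℝ} (hE : ∀ u w, (u, w) ∈ E → r u < r w)
    (hcongr : ∀ v x x', (∀ u, (u, v) ∈ E → x u = x' u) → K v x = K v x') {v u : V}
    (h : r v ≤ r u) (y : ∀ u, Fin (c u)) (t : Fin (c u)) :
    K v (Function.update y u t) = K v y := by
  refine hcongr _ _ _ fun z hz => Function.update_of_ne (fun h' => ?_) _ _
  rw [h'] at hz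
  have := hE _ _ hz
  omega

section Ranked

variable {V : Type} [Fintype V] [DecidableEq V] {c : V → ℕ} {E : Finset (V × V)} {r : V → ℕ}
  {K : ∀ v, (∀ u, Fin (c u)) → Fin (c v) → ℝ}

theorem filter_rank_le (hr : Function.Injective r) (v : V) :
    Finset.univ.filter (fun w => r v ≤ r w) =
      insert v (Finset.univ.filter fun w => r v + 1 ≤ r w) := by
  ext w
  have := @hr v w
  simp only [Finset.mem_filter, Finset.mem_univ, true_and, Finset.mem_insert]
  constructor
  · intro h
    by_cases h' : r v = r w
    · exact .inl (this h').symm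
    · right; omega
  · rintro (rfl | h)
    · exact le_rfl
    · omega

theorem filter_rank_lt (hr : Function.Injective r) (v : V) :
    Finset.univ.filter (fun w => r w < r v + 1) =
      insert v (Finset.univ.filter fun w => r w < r v) := by
  ext w
  have := @hr v w
  simp only [Finset.mem_filter, Finset.mem_univ, true_and, Finset.mem_insert]
  constructor
  · intro h
    by_cases h' : r v = r w
    · exact .inl (this h').symm
    · right; omega
  · rintro (rfl | h)
    · omega
    · omega

/-- As `g` ignores the nodes of rank at least `k`, their kernels sum to 1 one after another,
starting from the top. Replacing them by uniform weights expresses this without sums over partial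
assignments. -/
theorem sum_mul_prod_kernel (hr : Function.Injective r) (hE : ∀ u w, (u, w) ∈ E → r u < r w)
    (hc : ∀ v, c v ≠ 0) (hsum : ∀ v x, ∑ y, K v x y = 1)
    (hcongr : ∀ v x x', (∀ u, (u, v) ∈ E → x u = x' u) → K v x = K v x') (k : ℕ)
    (g : (∀ u, Fin (c u)) → ℝ) (hg : ∀ y v t, k ≤ r v → g (Function.update y v t) = g y) :
    ∑ y, g y * ∏ w with k ≤ r w, K w y (y w) = ∑ y, g y * ∏ w with k ≤ r w, (c w : ℝ)⁻¹ := by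
  obtain ⟨n, hn⟩ : ∃ n, ∀ w, r w < n :=
    ⟨Finset.univ.sup r + 1, fun w => Nat.lt_succ_of_le (Finset.le_sup (Finset.mem_univ w))⟩
  -- The induction goes downward in `k`; `d` bounds the number of ranks that remain below `n`.
  obtain ⟨d, hd⟩ : ∃ d, n ≤ k + d := ⟨n, by omega⟩
  induction d generalizing k g with
  | zero =>
    have : Finset.univ.filter (fun w => k ≤ r w) = ∅ :=
      Finset.filter_eq_empty_iff.2 fun w _ => by have := hn w; omega
    simp [this]
  | succ d ih =>
    by_cases hk : ∃ v, r v = k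
    · obtain ⟨v, rfl⟩ := hk
      have hself : ∀ y v t, K v (Function.update y v t) = K v y := fun y v t =>
        kernel_update_of_rank_le hE hcongr le_rfl y t
      rw [filter_rank_le hr v]
      have hv : v ∉ Finset.univ.filter fun w => r v + 1 ≤ r w := by simp
      simp only [Finset.prod_insert hv, ← mul_assoc]
      rw [ih (r v + 1) (fun y => g y * K v y (y v)) (fun y w t hw => ?_) (by omega),
        ← Finset.sum_mul, ← Finset.sum_mul, ← Finset.sum_mul]
      · congr 1
        -- Resampling the coordinate `v` sums its kernel to 1, at the cost of a factor `c v` that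
        -- cancels the uniform weight.
        have := sum_sum_update v fun y => g y * K v y (y v)
        simp only [hg _ _ _ le_rfl, Function.update_self, hself, ← Finset.mul_sum, hsum,
          mul_one] at this
        rw [this, mul_comm (c v : ℝ), mul_assoc, mul_inv_cancel₀ (by exact_mod_cast hc v), mul_one]
      · have hwv : v ≠ w := fun h => by subst h; omega
        rw [hg _ _ _ (by omega), Function.update_of_ne hwv,
          kernel_update_of_rank_le hE hcongr (by omega)]
    · have : Finset.univ.filter (fun w => k ≤ r w) = Finset.univ.filter fun w => k + 1 ≤ r w :=
        Finset.filter_congr fun w _ => by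
          have : r w ≠ k := fun h => hk ⟨w, h⟩
          omega
      rw [this]
      exact ih (k + 1) g (fun y v t hv => hg y v t (by omega)) (by omega)

theorem sum_prod_kernel (hr : Function.Injective r) (hE : ∀ u w, (u, w) ∈ E → r u < r w)
    (hc : ∀ v, c v ≠ 0) (hsum : ∀ v x, ∑ y, K v x y = 1)
    (hcongr : ∀ v x x', (∀ u, (u, v) ∈ E → x u = x' u) → K v x = K v x') :
    ∑ y, ∏ w, K w y (y w) = 1 := by
  have := sum_mul_prod_kernel hr hE hc hsum hcongr 0 (fun _ => 1) fun _ _ _ _ => rfl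
  simp only [zero_le, Finset.filter_true, one_mul] at this
  rw [this]
  simp only [Finset.sum_const, Finset.card_univ, Fintype.card_pi, Fintype.card_fin, nsmul_eq_mul,
    Nat.cast_prod, Finset.prod_inv_distrib]
  exact mul_inv_cancel₀ (Finset.prod_ne_zero_iff.2 fun v _ => by exact_mod_cast hc v)

/-- The kernel of `v` gives the conditional distribution of `v` given the nodes of lower rank. -/
theorem marginal_insert_prod_kernel (hr : Function.Injective r)
    (hE : ∀ u w, (u, w) ∈ E → r u < r w)
    (hc : ∀ v, c v ≠ 0) (hsum : ∀ v x, ∑ y, K v x y = 1)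
    (hcongr : ∀ v x x', (∀ u, (u, v) ∈ E → x u = x' u) → K v x = K v x') (v : V)
    (S : Finset V) (hS : ∀ u ∈ S, r u < r v) (hpa : ∀ u, (u, v) ∈ E → u ∈ S)
    (x : ∀ u, Fin (c u)) :
    marginal (insert v S) (fun y => ∏ w, K w y (y w)) x =
      marginal S (fun y => ∏ w, K w y (y w)) x * K v x (x v) := by
  have hvS : v ∉ S := fun h => (hS v h).false
  -- `f` contains the kernels of lower rank and the condition on `S`, hence ignores ranks from `r v`
  -- on. Below, `g` adds the kernel of `v` and the condition at `v`, hence ignores ranks from `r v +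
  -- 1` on.
  let f : (∀ u, Fin (c u)) → ℝ := fun y =>
    (∏ w with ¬ r v ≤ r w, K w y (y w)) * if ∀ u ∈ S, y u = x u then 1 else 0
  have hf : ∀ y u t, r v ≤ r u → f (Function.update y u t) = f y := fun y u t hu => by
    have h1 : ∀ w, ¬ r v ≤ r w → Function.update y u t w = y w := fun w hw =>
      Function.update_of_ne (fun h => hw (by rw [h]; exact hu)) _ _
    have h2 : (∀ w ∈ S, Function.update y u t w = x w) ↔ ∀ w ∈ S, y w = x w :=
      forall₂_congr fun w hw => by rw [h1 w (by have := hS w hw; omega)]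
    simp only [f, h2]
    congr 1
    refine Finset.prod_congr rfl fun w hw => ?_
    have hw : ¬ r v ≤ r w := (Finset.mem_filter.1 hw).2
    rw [h1 w hw, kernel_update_of_rank_le hE hcongr (by omega)]
  have hsplit : ∀ (y : ∀ u, Fin (c u)), ∏ w, K w y (y w) =
      (∏ w with ¬ r v ≤ r w, K w y (y w)) * ∏ w with r v ≤ r w, K w y (y w) := fun y => by
    rw [mul_comm, Finset.prod_filter_mul_prod_filter_not]
  have hv : v ∉ Finset.univ.filter fun w => r v + 1 ≤ r w := by simp
  have h1 : marginal S (fun y => ∏ w, K w y (y w)) x =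
      ∑ y, f y * ∏ w with r v ≤ r w, K w y (y w) :=
    Finset.sum_congr rfl fun y _ => by
      simp only [f]
      split_ifs
      · rw [hsplit, mul_one]
      · simp
  let g : (∀ u, Fin (c u)) → ℝ := fun y => f y * K v y (y v) * if y v = x v then 1 else 0
  have h2 : marginal (insert v S) (fun y => ∏ w, K w y (y w)) x =
      ∑ y, g y * ∏ w with r v + 1 ≤ r w, K w y (y w) :=
    Finset.sum_congr rfl fun y _ => by
      simp only [Finset.forall_mem_insert, f, g]
      by_cases hy : y v = x v <;> by_cases hyS : ∀ u ∈ S, y u = x u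
      · rw [if_pos ⟨hy, hyS⟩, if_pos hy, if_pos hyS, hsplit, filter_rank_le hr v,
          Finset.prod_insert hv]
        ring
      · rw [if_neg fun h => hyS h.2, if_neg hyS]
        simp
      · rw [if_neg fun h => hy h.1, if_neg hy]
        simp
      · rw [if_neg fun h => hyS h.2, if_neg hyS]
        simp
  rw [h1, h2, sum_mul_prod_kernel hr hE hc hsum hcongr (r v) f hf,
    sum_mul_prod_kernel hr hE hc hsum hcongr (r v + 1) g fun y u t hu => ?_,
    filter_rank_le hr v, Finset.prod_insert hv, ← Finset.sum_mul, ← Finset.sum_mul]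
  · have h3 := sum_sum_update v g
    have h4 : ∀ y, f y * K v y (x v) = f y * K v x (x v) := fun y => by
      by_cases hy : ∀ u ∈ S, y u = x u
      · rw [hcongr v y x fun u hu => hy u (hpa u hu)]
      · simp [f, hy]
    simp only [g, hf _ _ _ le_rfl, kernel_update_of_rank_le hE hcongr le_rfl,
      Function.update_self, mul_ite, mul_one, mul_zero, Finset.sum_ite_eq', Finset.mem_univ,
      if_true, h4, ← Finset.sum_mul] at h3
    have hcv : (c v : ℝ) ≠ 0 := by exact_mod_cast hc v
    have h5 : ∑ y, g y = (c v : ℝ)⁻¹ * ((∑ y, f y) * K v x (x v)) := by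
      rw [eq_inv_mul_iff_mul_eq₀ hcv, h3]
      simp [g]
    rw [h5]
    ring
  · have hvu : v ≠ u := fun h => by subst h; omega
    simp only [g]
    rw [hf _ _ _ (by omega), Function.update_of_ne hvu,
      kernel_update_of_rank_le hE hcongr (by omega)]

end Ranked

/-! ### The ordered Markov property and algebraicity -/

section Markov

variable {V : Type} [Fintype V] [DecidableEq V] {c : V → ℕ} {E : Finset (V × V)} {r : V → ℕ}

/-- The parents of `v`. -/
def parents (E : Finset (V × V)) (v : V) : Finset V := Finset.univ.filter fun u => (u, v) ∈ E

/-- The nodes of lower rank than `v`. -/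
def predecessors (r : V → ℕ) (v : V) : Finset V := Finset.univ.filter fun u => r u < r v

/-- Each node is independent of the nodes of lower rank given its parents. -/
def IsMarkov (E : Finset (V × V)) (r : V → ℕ) (P : (∀ v, Fin (c v)) → ℝ) : Prop :=
  ∀ v x, marginal (insert v (predecessors r v)) P x * marginal (parents E v) P x =
    marginal (predecessors r v) P x * marginal (insert v (parents E v)) P x

theorem mem_faceRealizable_empty {P : (∀ v, Fin (c v)) → ℝ} :
    P ∈ faceRealizable E ∅ c ↔ ∃ K : ∀ v, (∀ u, Fin (c u)) → Fin (c v) → ℝ,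
      (∀ v x y, 0 ≤ K v x y) ∧ (∀ v x, ∑ y, K v x y = 1) ∧
      (∀ v x x', (∀ u, (u, v) ∈ E → x u = x' u) → K v x = K v x') ∧
      ∀ x, P x = ∏ v, K v x (x v) := by
  have : IsEmpty {A // A ∈ (∅ : Finset (Finset V))} := ⟨fun A => absurd A.2 (Finset.notMem_empty _)⟩
  constructor
  · rintro ⟨M, rfl⟩
    refine ⟨fun v x => M.kernel v x isEmptyElim, fun v x y => M.kernel_nonneg _ _ _ _,
      fun v x => M.kernel_sum _ _ _, fun v x x' h => M.kernel_congr _ _ _ _ _ h isEmptyElim,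
      fun x => ?_⟩
    simp only [KernelModel.dist]
    rw [Fintype.sum_unique, Fintype.prod_empty, one_mul, Subsingleton.elim default]
  · rintro ⟨K, h0, h1, h2, h3⟩
    refine ⟨{ Lat := fun _ => Unit
              latFintype := fun _ => inferInstance
              weight := isEmptyElim
              kernel := fun v x _ => K v x
              weight_nonneg := isEmptyElim
              weight_sum := isEmptyElim
              kernel_nonneg := fun v x _ => h0 v x
              kernel_sum := fun v x _ => h1 v x
              kernel_congr := fun v x x' _ _ hx _ => h2 v x x' hx }, ?_⟩
    funext x
    simp [KernelModel.dist, h3]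

/-- For fixed values of the latent variables the kernels form a DAG model of total mass 1; the
weights average these. -/
theorem kernelRealizable_subset_stdSimplex {ι : Type} [Fintype ι] [DecidableEq ι]
    {T : ι → Finset V} (hr : Function.Injective r) (hE : ∀ u w, (u, w) ∈ E → r u < r w)
    (hc : ∀ v, c v ≠ 0) : kernelRealizable E T c ⊆ stdSimplex ℝ (∀ v, Fin (c v)) := by
  rintro _ ⟨M, rfl⟩
  refine ⟨fun x => Finset.sum_nonneg fun l _ => mul_nonneg
    (Finset.prod_nonneg fun i _ => M.weight_nonneg _ _)
    (Finset.prod_nonneg fun v _ => M.kernel_nonneg _ _ _ _), ?_⟩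
  simp only [KernelModel.dist]
  rw [Finset.sum_comm]
  have : ∀ l, ∑ x : ∀ v, Fin (c v), ∏ v, M.kernel v x l (x v) = 1 := fun l =>
    sum_prod_kernel (K := fun v x => M.kernel v x l) hr hE hc (fun v x => M.kernel_sum _ _ _)
      fun v x x' h => M.kernel_congr _ _ _ _ _ h fun _ _ => rfl
  simp_rw [← Finset.mul_sum, this, mul_one]
  rw [← Fintype.prod_sum]
  exact Finset.prod_eq_one fun i _ => M.weight_sum i

/-- The chain rule in the order of rank, with the Markov property reducing each conditional to the
parents. The factors are prescribed only where the conditional probability exists. -/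
theorem prod_conditional_eq_marginal (hr : Function.Injective r)
    (hE : ∀ u w, (u, w) ∈ E → r u < r w)
    {P : (∀ v, Fin (c v)) → ℝ} (hP : P ∈ stdSimplex ℝ (∀ v, Fin (c v))) (hM : IsMarkov E r P)
    (k : V → ℝ) (x : ∀ v, Fin (c v))
    (hk : ∀ v, marginal (parents E v) P x ≠ 0 →
      k v = marginal (insert v (parents E v)) P x / marginal (parents E v) P x) (n : ℕ) :
    ∏ v with r v < n, k v = marginal (Finset.univ.filter fun v => r v < n) P x := by
  induction n with
  | zero => simp [marginal_empty, hP.2]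
  | succ n ih =>
    by_cases hn : ∃ v, r v = n
    · obtain ⟨v, rfl⟩ := hn
      have hle : marginal (predecessors r v) P x ≤ marginal (parents E v) P x :=
        marginal_anti hP.1 (fun u hu => by
          simp only [parents, predecessors, Finset.mem_filter, Finset.mem_univ, true_and] at hu ⊢
          exact hE _ _ hu) x
      rw [filter_rank_lt hr v, Finset.prod_insert (by simp), ih]
      have hv := hM v x
      -- Parents are predecessors, so in this case the product is already 0 and the factor of `v` is
      -- irrelevant.
      by_cases h0 : marginal (parents E v) P x = 0
      · have h1 : marginal (predecessors r v) P x = 0 :=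
          le_antisymm (h0 ▸ hle) (marginal_nonneg hP.1 _ _)
        have h2 : marginal (insert v (predecessors r v)) P x = 0 :=
          le_antisymm (h1 ▸ marginal_anti hP.1 (Finset.subset_insert _ _) x)
            (marginal_nonneg hP.1 _ _)
        exact (congrArg (k v * ·) h1).trans ((mul_zero _).trans h2.symm)
      · rw [hk v h0]
        change _ / _ * marginal (predecessors r v) P x =
          marginal (insert v (predecessors r v)) P x
        rw [div_mul_eq_mul_div, div_eq_iff h0, hv, mul_comm]
    · have : Finset.univ.filter (fun v => r v < n + 1) = Finset.univ.filter fun v => r v < n :=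
        Finset.filter_congr fun w _ => by
          have : r w ≠ n := fun h => hn ⟨w, h⟩
          omega
      rw [this, ih]

/-- The distributions realizable by a DAG without latent variables are those that satisfy the
ordered Markov property. -/
theorem faceRealizable_empty_eq (hr : Function.Injective r)
    (hE : ∀ u w, (u, w) ∈ E → r u < r w) (hc : ∀ v, c v ≠ 0) :
    faceRealizable E ∅ c = {P | P ∈ stdSimplex ℝ (∀ v, Fin (c v)) ∧ IsMarkov E r P} := by
  ext P
  constructor
  · intro h
    refine ⟨kernelRealizable_subset_stdSimplex hr hE hc h, fun v x => ?_⟩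
    obtain ⟨K, -, h1, h2, h3⟩ := mem_faceRealizable_empty.1 h
    obtain rfl : P = fun x => ∏ v, K v x (x v) := funext h3
    rw [marginal_insert_prod_kernel hr hE hc h1 h2 v (predecessors r v) (by simp [predecessors])
      (fun u hu => by simpa [predecessors] using hE u v hu),
      marginal_insert_prod_kernel hr hE hc h1 h2 v (parents E v)
      (fun u hu => hE u v (by simpa [parents] using hu)) fun u hu => by simpa [parents] using hu]
    ring
  · rintro ⟨hP, hM⟩
    have hvv : ∀ v, v ∉ parents E v := fun v hv => by
      simp only [parents, Finset.mem_filter] at hv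
      exact (hE v v hv.2).false
    -- The kernel is the conditional distribution given the parents, and uniform where that is
    -- undefined.
    refine mem_faceRealizable_empty.2 ⟨fun v x y => if marginal (parents E v) P x = 0 then
      (c v : ℝ)⁻¹ else marginal (insert v (parents E v)) P (Function.update x v y) /
        marginal (parents E v) P x, fun v x y => ?_, fun v x => ?_, fun v x x' h => ?_,
      fun x => ?_⟩
    · dsimp only
      split_ifs
      · positivity
      · exact div_nonneg (marginal_nonneg hP.1 _ _) (marginal_nonneg hP.1 _ _)
    · dsimp only
      split_ifs with h
      · have : (c v : ℝ) ≠ 0 := by exact_mod_cast hc v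
        simp [this]
      · rw [← Finset.sum_div, sum_marginal_insert (hvv v), div_self h]
    · funext y
      dsimp only
      rw [marginal_congr (parents E v) P (x := x) (x' := x') fun u hu => h u (by
        simpa [parents] using hu), marginal_congr (insert v (parents E v)) P
        (x := Function.update x v y) (x' := Function.update x' v y) fun u hu => ?_]
      obtain rfl | hu := Finset.mem_insert.1 hu
      · simp
      · rw [Function.update_of_ne (ne_of_mem_of_not_mem hu (hvv v)),
          Function.update_of_ne (ne_of_mem_of_not_mem hu (hvv v))]
        exact h u (by simpa [parents] using hu)
    · have := prod_conditional_eq_marginal hr hE hP hM (fun v =>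
        if marginal (parents E v) P x = 0 then (c v : ℝ)⁻¹ else
          marginal (insert v (parents E v)) P (Function.update x v (x v)) /
            marginal (parents E v) P x) x (fun v hv => by simp [hv]) (Finset.univ.sup r + 1)
      have hall : Finset.univ.filter (fun v => r v < Finset.univ.sup r + 1) = Finset.univ :=
        Finset.filter_true_of_mem fun v _ => Nat.lt_succ_of_le (Finset.le_sup (Finset.mem_univ v))
      rw [hall, marginal_univ] at this
      exact this.symm

/-- All distributions are realizable by a complete DAG. -/
theorem stdSimplex_subset_faceRealizable (hr : Function.Injective r)
    (hE : ∀ u w, (u, w) ∈ E ↔ r u < r w) (hc : ∀ v, c v ≠ 0) :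
    stdSimplex ℝ (∀ v, Fin (c v)) ⊆ faceRealizable E ∅ c := by
  rw [faceRealizable_empty_eq hr (fun u w h => (hE u w).1 h) hc]
  refine fun P hP => ⟨hP, fun v x => ?_⟩
  have : parents E v = predecessors r v := by simp [parents, predecessors, hE]
  rw [this, mul_comm]

/-- The marginal probability as a polynomial. -/
noncomputable def marginalPoly (S : Finset V) (x : ∀ v, Fin (c v)) :
    MvPolynomial (∀ v, Fin (c v)) ℝ :=
  ∑ y, if ∀ u ∈ S, y u = x u then MvPolynomial.X y else 0

theorem eval_marginalPoly (S : Finset V) (x : ∀ v, Fin (c v)) (P : (∀ v, Fin (c v)) → ℝ) :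
    MvPolynomial.eval P (marginalPoly S x) = marginal S P x := by
  simp only [marginalPoly, marginal, map_sum]
  refine Finset.sum_congr rfl fun y _ => ?_
  split_ifs <;> simp

/-- A graph whose realizable distributions are those of a DAG without latent variables is
algebraic. -/
theorem PDAG.algebraic_of_realizable_eq {L : Type} [Fintype L] [DecidableEq L] {G : PDAG V L}
    (hr : Function.Injective r) (hE : ∀ u w, (u, w) ∈ E → r u < r w)
    (h : ∀ c : V → ℕ, (∀ v, c v ≠ 0) → G.Realizable c = faceRealizable E ∅ c) : G.Algebraic := by
  intro c
  by_cases hc : ∀ v, c v ≠ 0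
  · refine ⟨Set.range fun p : V × (∀ v, Fin (c v)) =>
      marginalPoly (insert p.1 (predecessors r p.1)) p.2 * marginalPoly (parents E p.1) p.2 -
        marginalPoly (predecessors r p.1) p.2 * marginalPoly (insert p.1 (parents E p.1)) p.2, ?_⟩
    rw [h c hc, faceRealizable_empty_eq hr hE hc]
    ext P
    simp only [Set.mem_ofPred_eq, Set.forall_mem_range, Prod.forall, map_sub, map_mul,
      eval_marginalPoly, sub_eq_zero, IsMarkov]
  -- The polynomial 1 has no zeros, which matches the empty set of realizable distributions.
  · refine ⟨{1}, ?_⟩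
    rw [PDAG.realizable_eq_empty hc]
    simp

/-- A graph is not algebraic if some line meets its set of realizable distributions infinitely often
but has a point in the simplex that is not realizable. -/
theorem PDAG.not_algebraic_of_line {L : Type} [Fintype L] [DecidableEq L] {G : PDAG V L}
    {P₀ P₁ : (∀ v, Fin (c v)) → ℝ} {s : Set ℝ} (hs : s.Infinite)
    (h : ∀ t ∈ s, P₀ + t • P₁ ∈ G.Realizable c) {t : ℝ}
    (ht : P₀ + t • P₁ ∈ stdSimplex ℝ (∀ v, Fin (c v))) (ht' : P₀ + t • P₁ ∉ G.Realizable c) :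
    ¬ G.Algebraic := by
  intro hG
  obtain ⟨S, hS⟩ := hG c
  refine ht' (hS ▸ ⟨ht, fun p hp => ?_⟩)
  -- Substituting the line into `p` gives a univariate polynomial with infinitely many roots, hence
  -- 0.
  let f : (∀ v, Fin (c v)) → Polynomial ℝ := fun x =>
    Polynomial.C (P₀ x) + Polynomial.C (P₁ x) * Polynomial.X
  have hq : ∀ (p : MvPolynomial (∀ v, Fin (c v)) ℝ) s,
      (MvPolynomial.aeval f p).eval s = MvPolynomial.eval (P₀ + s • P₁) p := fun p s => by
    induction p using MvPolynomial.induction_on with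
    | C a => simp
    | add p p' h h' => rw [map_add, Polynomial.eval_add, h, h', map_add]
    | mul_X p x h => simp [h, f, mul_comm s]
  have hq0 : MvPolynomial.aeval f p = 0 :=
    Polynomial.eq_zero_of_infinite_isRoot _ (hs.mono fun s hs => by
      have := h s hs
      rw [hS] at this
      exact (hq p s).trans (this.2 p hp))
  rw [← hq, hq0, Polynomial.eval_zero]

end Markov

/-! ### Supports of realizable distributions -/

section Support

variable {V ι : Type} [Fintype V] [Fintype ι] [DecidableEq V] [DecidableEq ι]
  {E : Finset (V × V)} {T : ι → Finset V} {c : V → ℕ}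

/-- A sum of nonnegative terms is positive as soon as one term is. The impossibility arguments use
only this possibilistic content of a model. -/
theorem KernelModel.dist_pos_iff (M : KernelModel E T c) (x : ∀ v, Fin (c v)) :
    0 < M.dist x ↔ ∃ l, (∀ i, 0 < M.weight i (l i)) ∧ ∀ v, 0 < M.kernel v x l (x v) := by
  have h1 : ∀ l : ∀ i, M.Lat i, 0 ≤ ∏ i, M.weight i (l i) := fun l =>
    Finset.prod_nonneg fun i _ => M.weight_nonneg _ _
  have h2 : ∀ l : ∀ i, M.Lat i, 0 ≤ ∏ v, M.kernel v x l (x v) := fun l =>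
    Finset.prod_nonneg fun v _ => M.kernel_nonneg _ _ _ _
  constructor
  · intro h
    obtain ⟨l, -, hl⟩ := Finset.exists_ne_zero_of_sum_ne_zero h.ne'
    have hl1 := Finset.prod_ne_zero_iff.1 (left_ne_zero_of_mul hl)
    have hl2 := Finset.prod_ne_zero_iff.1 (right_ne_zero_of_mul hl)
    exact ⟨l, fun i => (M.weight_nonneg _ _).lt_of_ne' (hl1 i (Finset.mem_univ i)),
      fun v => (M.kernel_nonneg _ _ _ _).lt_of_ne' (hl2 v (Finset.mem_univ v))⟩
  · rintro ⟨l, hl1, hl2⟩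
    exact Finset.sum_pos' (fun l _ => mul_nonneg (h1 l) (h2 l)) ⟨l, Finset.mem_univ l,
      mul_pos (Finset.prod_pos fun i _ => hl1 i) (Finset.prod_pos fun v _ => hl2 v)⟩

theorem KernelModel.exists_kernel_pos (M : KernelModel E T c) (v : V) (x : ∀ v, Fin (c v))
    (l : ∀ i, M.Lat i) : ∃ y, 0 < M.kernel v x l y := by
  have h : ∑ y, M.kernel v x l y ≠ 0 := by rw [M.kernel_sum]; exact one_ne_zero
  obtain ⟨y, -, hy⟩ := Finset.exists_ne_zero_of_sum_ne_zero h
  exact ⟨y, (M.kernel_nonneg _ _ _ _).lt_of_ne' hy⟩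

theorem KernelModel.kernel_pos_congr (M : KernelModel E T c) {v : V} {x x' : ∀ v, Fin (c v)}
    {l l' : ∀ i, M.Lat i} {y : Fin (c v)} (h : 0 < M.kernel v x l y)
    (hx : ∀ u, (u, v) ∈ E → x u = x' u) (hl : ∀ i, v ∈ T i → l i = l' i) :
    0 < M.kernel v x' l' y := by
  rwa [← M.kernel_congr v x x' l l' hx hl]

theorem mem_kernelRealizable_unit {A : Finset V} {W : Type} [Fintype W] (q : W → ℝ)
    (K : ∀ v, (∀ u, Fin (c u)) → W → Fin (c v) → ℝ) (hq : ∀ m, 0 ≤ q m) (hqs : ∑ m, q m = 1)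
    (hK : ∀ v x m y, 0 ≤ K v x m y) (hKs : ∀ v x m, ∑ y, K v x m y = 1)
    (hKc : ∀ v x x' m m', (∀ u, (u, v) ∈ E → x u = x' u) → (v ∈ A → m = m') →
      K v x m = K v x' m')
    {P : (∀ v, Fin (c v)) → ℝ} (hP : ∀ x, P x = ∑ m, q m * ∏ v, K v x m (x v)) :
    P ∈ kernelRealizable E (fun _ : Unit => A) c := by
  refine ⟨{ Lat := fun _ => W
            latFintype := fun _ => inferInstance
            weight := fun _ => q
            kernel := fun v x l => K v x (l ())
            weight_nonneg := fun _ => hq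
            weight_sum := fun _ => hqs
            kernel_nonneg := fun v x l => hK v x (l ())
            kernel_sum := fun v x l => hKs v x (l ())
            kernel_congr := fun v x x' l l' hx hl => hKc v x x' _ _ hx (hl ()) }, ?_⟩
  funext x
  rw [hP]
  exact Fintype.sum_equiv (Equiv.funUnique Unit W) _ _ fun l => by simp

theorem faceRealizable_singleton (A : Finset V) :
    faceRealizable E {A} c = kernelRealizable E (fun _ : Unit => A) c :=
  (kernelRealizable_mono subset_rfl (fun _ => ()) fun B => by
    rw [Finset.mem_singleton.1 B.2]).antisymm
    (kernelRealizable_mono subset_rfl (fun _ => ⟨A, by simp⟩) fun _ => subset_rfl)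

end Support

/-! ### Obstructions to realizability for three nodes -/

section ThreeNodes

theorem prod_fin_three {u v w : Fin 3} (huv : u ≠ v) (huw : u ≠ w) (hvw : v ≠ w)
    (f : Fin 3 → ℝ) : ∏ i, f i = f u * (f v * f w) := by
  have : (Finset.univ : Finset (Fin 3)) = {u, v, w} := by
    revert u v w
    decide
  rw [this, Finset.prod_insert (by simp [huv, huw]), Finset.prod_insert (by simp [hvw]),
    Finset.prod_singleton]

theorem forall_fin_three {u v w : Fin 3} (huv : u ≠ v) (huw : u ≠ w) (hvw : v ≠ w)
    {p : Fin 3 → Prop} (hu : p u) (hv : p v) (hw : p w) (i : Fin 3) : p i := by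
  have : ∀ u v w i : Fin 3, u ≠ v → u ≠ w → v ≠ w → i = u ∨ i = v ∨ i = w := by decide
  obtain rfl | rfl | rfl := this u v w i huv huw hvw <;> assumption

variable {c : Fin 3 → ℕ} {u v w : Fin 3} {P : (∀ v, Fin (c v)) → ℝ}

/-- In the instrumental scenario with instrument `u`, if one value of `u` forces a value of `v` that
occurs with another value of `u`, then it also allows the same value of `w`. -/
theorem pos_of_mem_instrumental (huv : u ≠ v) (huw : u ≠ w) (hvw : v ≠ w)
    (hP : P ∈ faceRealizable {(u, v), (v, w)} {{v, w}} c) {x x' : ∀ v, Fin (c v)}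
    (hx : 0 < P x) (hx' : 0 < P x') (h : ∀ y, y u = x' u → 0 < P y → y v = x v) :
    0 < P (Function.update x u (x' u)) := by
  rw [faceRealizable_singleton] at hP
  obtain ⟨M, rfl⟩ := hP
  -- The latent value `l` behind `x` is kept, while `u`, which reads nothing, takes its value from
  -- `x'`.
  obtain ⟨l, hl, hxl⟩ := (M.dist_pos_iff x).1 hx
  obtain ⟨l', -, hxl'⟩ := (M.dist_pos_iff x').1 hx'
  set y₁ := Function.update x u (x' u) with hy₁
  have hu : ∀ y, y u = x' u → 0 < M.kernel u y l (y u) := fun y hy => by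
    rw [hy]
    exact M.kernel_pos_congr (hxl' u) (by simp [huv, huw]) (by simp [huv, huw])
  obtain ⟨a, ha⟩ := M.exists_kernel_pos v y₁ l
  obtain ⟨b, hb⟩ := M.exists_kernel_pos w (Function.update y₁ v a) l
  have hpos : 0 < M.dist (Function.update (Function.update y₁ v a) w b) := by
    refine (M.dist_pos_iff _).2 ⟨l, hl, forall_fin_three huv huw hvw (hu _ ?_) ?_ ?_⟩
    · simp [huv, huw, hy₁]
    · rw [Function.update_of_ne hvw, Function.update_self]
      refine M.kernel_pos_congr ha (fun z hz => ?_) fun _ _ => rfl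
      obtain rfl : z = u := by simpa [hvw] using hz
      simp [huv, huw]
    · rw [Function.update_self]
      refine M.kernel_pos_congr hb (fun z hz => ?_) fun _ _ => rfl
      obtain rfl : z = v := by simpa [hvw.symm] using hz
      simp [hvw]
  -- By `h`, the value `a` that `v` can take is `x v`; then `w` sees the same inputs as behind `x`
  -- and can again give `x w`.
  have hav := h _ (by simp [huv, huw, hy₁]) hpos
  rw [Function.update_of_ne hvw, Function.update_self] at hav
  refine (M.dist_pos_iff _).2 ⟨l, hl, forall_fin_three huv huw hvw (hu _ (by simp [hy₁])) ?_ ?_⟩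
  · rw [hy₁, Function.update_of_ne huv.symm, ← hav]
    exact ha
  · rw [hy₁, Function.update_of_ne huw.symm]
    refine M.kernel_pos_congr (hxl w) (fun z hz => ?_) fun _ _ => rfl
    obtain rfl : z = v := by simpa [hvw.symm] using hz
    rw [Function.update_of_ne huv.symm]

/-- In a DAG in which `w` has no parents except `v`, and no children, values of `w` can be exchanged
between outcomes with the same value of `v`. -/
theorem pos_of_mem_noncollider {E : Finset (Fin 3 × Fin 3)} (hw : ∀ z, (w, z) ∉ E)
    (hv : ∀ z, (z, w) ∈ E → z = v) (hvw : v ≠ w) (hP : P ∈ faceRealizable E ∅ c)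
    {x x' : ∀ v, Fin (c v)} (hx : 0 < P x) (hx' : 0 < P x') (h : x v = x' v) :
    0 < P (Function.update x w (x' w)) := by
  obtain ⟨K, h0, -, hK, hP⟩ := mem_faceRealizable_empty.1 hP
  rw [hP] at hx hx' ⊢
  have hpos : ∀ {x : ∀ v, Fin (c v)}, 0 < ∏ v, K v x (x v) → ∀ v, 0 < K v x (x v) := fun h v =>
    (h0 _ _ _).lt_of_ne' (Finset.prod_ne_zero_iff.1 h.ne' v (Finset.mem_univ v))
  refine Finset.prod_pos fun z _ => ?_
  by_cases hz : z = w
  · subst hz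
    rw [Function.update_self, hK z _ x' fun t ht => by
      rw [hv t ht, Function.update_of_ne hvw, h]]
    exact hpos hx' z
  · rw [Function.update_of_ne hz, hK z _ x fun t ht => Function.update_of_ne (fun h => by
      rw [h] at ht; exact hw _ ht) _ _]
    exact hpos hx z

/-- In a DAG with a collider at `v`, the values of `u` and `w` can be combined freely. -/
theorem exists_pos_of_mem_collider (huv : u ≠ v) (huw : u ≠ w) (hvw : v ≠ w)
    (hP : P ∈ faceRealizable {(u, v), (w, v)} ∅ c) {x x' : ∀ v, Fin (c v)} (hx : 0 < P x)
    (hx' : 0 < P x') : ∃ y, 0 < P y ∧ y u = x u ∧ y w = x' w := by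
  obtain ⟨K, h0, h1, hK, hP⟩ := mem_faceRealizable_empty.1 hP
  simp only [hP] at hx hx' ⊢
  have hpos : ∀ {x : ∀ v, Fin (c v)}, 0 < ∏ v, K v x (x v) → ∀ v, 0 < K v x (x v) := fun h v =>
    (h0 _ _ _).lt_of_ne' (Finset.prod_ne_zero_iff.1 h.ne' v (Finset.mem_univ v))
  have h : ∑ y, K v (Function.update x w (x' w)) y ≠ 0 := by rw [h1]; exact one_ne_zero
  obtain ⟨a, -, ha⟩ := Finset.exists_ne_zero_of_sum_ne_zero h
  refine ⟨Function.update (Function.update x w (x' w)) v a, Finset.prod_pos fun z _ =>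
    forall_fin_three (p := fun z => 0 < K z (Function.update (Function.update x w (x' w)) v a)
      (Function.update (Function.update x w (x' w)) v a z)) huv huw hvw ?_ ?_ ?_ z, by simp [huv, huw], by simp [hvw.symm]⟩
  · rw [Function.update_of_ne huv, Function.update_of_ne huw, hK u _ x (by simp [huv])]
    exact hpos hx u
  · rw [Function.update_self, hK v _ (Function.update x w (x' w)) fun z hz =>
      Function.update_of_ne (by rintro rfl; simp [hvw, huv.symm] at hz) _ _]
    exact (h0 _ _ _).lt_of_ne' ha
  · rw [Function.update_of_ne hvw.symm, Function.update_self,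
      hK w _ x' (by simp [hvw.symm])]
    exact hpos hx' w

/-- The uniform distribution over the equal values of `u` and `w` with `v` constant. -/
noncomputable def correlated (u v w : Fin 3) (x : Fin 3 → Fin 2) : ℝ :=
  if x v = 0 ∧ x u = x w then 1 / 2 else 0

/-- The perfectly correlated distribution of three bits. -/
noncomputable def ghz (x : Fin 3 → Fin 2) : ℝ :=
  if x 0 = x 1 ∧ x 1 = x 2 then 1 / 2 else 0

/-- The uniform distribution over the bits with `x v = x u + x w`. -/
noncomputable def parity (u v w : Fin 3) (x : Fin 3 → Fin 2) : ℝ :=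
  if x v = x u + x w then 1 / 4 else 0

theorem correlated_pos_iff {x : Fin 3 → Fin 2} :
    0 < correlated u v w x ↔ x v = 0 ∧ x u = x w := by
  unfold correlated
  split_ifs with h <;> simp [h]

theorem ghz_pos_iff {x : Fin 3 → Fin 2} : 0 < ghz x ↔ x 0 = x 1 ∧ x 1 = x 2 := by
  unfold ghz
  split_ifs with h <;> simp [h]

theorem parity_pos_iff {x : Fin 3 → Fin 2} : 0 < parity u v w x ↔ x v = x u + x w := by
  unfold parity
  split_ifs with h <;> simp [h]

/-- The values 0, 0 and 1, 1 of `u`, `w` could be recombined to 0, 1. -/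
theorem correlated_notMem_collider (huv : u ≠ v) (huw : u ≠ w) (hvw : v ≠ w) :
    correlated u v w ∉ faceRealizable {(u, v), (w, v)} ∅ (fun _ => 2) := fun h => by
  obtain ⟨y, hy, hu, hw⟩ := exists_pos_of_mem_collider huv huw hvw h (x := fun _ => 0)
    (x' := Function.update (fun _ => 1) v 0) (correlated_pos_iff.2 (by simp))
    (correlated_pos_iff.2 (by simp [huv, hvw.symm]))
  have := (correlated_pos_iff.1 hy).2
  rw [hu, hw] at this
  simp [hvw.symm] at this

/-- As `v` is constant, the instrument cannot influence `w`: the value 0 of `w` would also be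
possible with the value 1 of `u`. -/
theorem correlated_notMem_instrumental (huv : u ≠ v) (huw : u ≠ w) (hvw : v ≠ w) :
    correlated u v w ∉ faceRealizable {(u, v), (v, w)} {{v, w}} (fun _ => 2) := fun h => by
  have := pos_of_mem_instrumental huv huw hvw h (x := fun _ => 0)
    (x' := Function.update (fun _ => 1) v 0) (correlated_pos_iff.2 (by simp))
    (correlated_pos_iff.2 (by simp [huv, hvw.symm])) fun y _ hy => (correlated_pos_iff.1 hy).1
  have := (correlated_pos_iff.1 this).2
  simp [huw.symm, huv] at this

/-- With `v = 0`, both `u = w = 0` and `u = w = 1` occur; exchanging the value of `w` breaks the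
parity. -/
theorem parity_notMem_noncollider {E : Finset (Fin 3 × Fin 3)} (huv : u ≠ v) (huw : u ≠ w)
    (hvw : v ≠ w) (hw : ∀ z, (w, z) ∉ E) (hv : ∀ z, (z, w) ∈ E → z = v) :
    parity u v w ∉ faceRealizable E ∅ (fun _ => 2) := fun h => by
  have := pos_of_mem_noncollider hw hv hvw h (x := fun _ => 0)
    (x' := Function.update (fun _ => 1) v 0) (parity_pos_iff.2 (by simp))
    (parity_pos_iff.2 (by simp [huv, hvw.symm])) (by simp)
  have := parity_pos_iff.1 this
  simp [huw, hvw, hvw.symm] at this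

/-- The children of the latent variables in the triangle scenario. -/
def triangleChildren (i : Fin 3) : Finset (Fin 3) := Finset.univ.erase i

/-- Node `i` does not read latent variable `i`. Take `l` behind the outcome 000 and `l'` behind 111.
Switching latent variable 2 to `l'` leaves node 2 able to give 0, so perfect correlation forces
nodes 0 and 1 to give 0. Then switching latent variable 0 leaves node 0 able to give 0, while node 1
now reads only values from `l'` and can give 1. -/
theorem ghz_notMem_triangle : ghz ∉ kernelRealizable ∅ triangleChildren (fun _ => 2) := by
  rintro ⟨M, hM⟩
  have hM' : ∀ x, 0 < M.dist x ↔ x 0 = x 1 ∧ x 1 = x 2 := fun x => by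
    rw [← ghz_pos_iff, ← hM]
  obtain ⟨l, hl, hxl⟩ := (M.dist_pos_iff fun _ => 0).1 ((hM' _).2 ⟨rfl, rfl⟩)
  obtain ⟨l', hl', hxl'⟩ := (M.dist_pos_iff fun _ => 1).1 ((hM' _).2 ⟨rfl, rfl⟩)
  have hcongr : ∀ {v : Fin 3} {x x' : Fin 3 → Fin 2} {l l' : ∀ i, M.Lat i} {y : Fin 2},
      0 < M.kernel v x l y → (∀ i, v ≠ i → l i = l' i) → 0 < M.kernel v x' l' y :=
    fun h hl => M.kernel_pos_congr h (by simp) fun i hi => hl i (by simpa [triangleChildren] using hi)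
  -- outcomes `a`, `b`, `d` that are possible for the same values of the latent variables agree
  have key : ∀ m : ∀ i, M.Lat i, (∀ i, 0 < M.weight i (m i)) → ∀ a b d : Fin 2,
      0 < M.kernel 0 (fun _ => 0) m a → 0 < M.kernel 1 (fun _ => 0) m b →
      0 < M.kernel 2 (fun _ => 0) m d → a = b ∧ b = d := fun m hm a b d ha hb hd => by
    have : 0 < M.dist ![a, b, d] := (M.dist_pos_iff _).2 ⟨m, hm, fun v => by
      fin_cases v
      · exact hcongr ha fun _ _ => rfl
      · exact hcongr hb fun _ _ => rfl
      · exact hcongr hd fun _ _ => rfl⟩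
    simpa using (hM' _).1 this
  have hweight : ∀ i (m : ∀ i, M.Lat i) (t : M.Lat i), (∀ i, 0 < M.weight i (m i)) →
      0 < M.weight i t → ∀ j, 0 < M.weight j (Function.update m i t j) := fun i m t hm ht j => by
    by_cases h : j = i
    · subst h
      simpa using ht
    · simpa [Function.update_of_ne h] using hm j
  have hm := hweight 2 l (l' 2) hl (hl' 2)
  obtain ⟨a, ha⟩ := M.exists_kernel_pos 0 (fun _ => 0) (Function.update l 2 (l' 2))
  obtain ⟨b, hb⟩ := M.exists_kernel_pos 1 (fun _ => 0) (Function.update l 2 (l' 2))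
  obtain ⟨rfl, rfl⟩ := key _ hm a b 0 ha hb (hcongr (hxl 2) fun i hi => by
    rw [Function.update_of_ne hi.symm])
  have hm' := hweight 0 _ (l' 0) hm (hl' 0)
  obtain ⟨d, hd⟩ := M.exists_kernel_pos 2 (fun _ => 0)
    (Function.update (Function.update l 2 (l' 2)) 0 (l' 0))
  have := key _ hm' 0 1 d (hcongr ha fun i hi => by rw [Function.update_of_ne hi.symm])
    (hcongr (hxl' 1) fun i hi => by
      fin_cases i
      · simp
      · exact (hi rfl).elim
      · simp) hd
  exact zero_ne_one this.1

/-- The children of the latent variables in the scenario with confounders of `0` and `1` and of `0`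
and `2`. -/
def evansChildren (i : Fin 2) : Finset (Fin 3) := ![{0, 1}, {0, 2}] i

/-- Combine the confounder of 0 and 1 from behind the outcome 000 with the confounder of 0 and 2
from behind 011. Node 0 must still give 0, so node 1 can give 0 and node 2 can give 1. -/
theorem correlated_notMem_evans :
    correlated 1 0 2 ∉ kernelRealizable {(0, 1), (0, 2)} evansChildren (fun _ => 2) := by
  rintro ⟨M, hM⟩
  have hM' : ∀ x, 0 < M.dist x ↔ x 0 = 0 ∧ x 1 = x 2 := fun x => by
    rw [← correlated_pos_iff (u := 1), ← hM]
  obtain ⟨l, hl, hxl⟩ := (M.dist_pos_iff fun _ => 0).1 ((hM' _).2 ⟨rfl, rfl⟩)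
  obtain ⟨l', hl', hxl'⟩ := (M.dist_pos_iff ![0, 1, 1]).1 ((hM' _).2 ⟨rfl, rfl⟩)
  have hm : ∀ i, 0 < M.weight i (Function.update l 1 (l' 1) i) := fun i => by
    fin_cases i
    · simpa using hl 0
    · simpa using hl' 1
  obtain ⟨a, ha⟩ := M.exists_kernel_pos 0 (fun _ => 0) (Function.update l 1 (l' 1))
  obtain ⟨b, hb⟩ := M.exists_kernel_pos 1 ![a, 0, 0] (Function.update l 1 (l' 1))
  obtain ⟨d, hd⟩ := M.exists_kernel_pos 2 ![a, 0, 0] (Function.update l 1 (l' 1))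
  have h0 : ∀ y z, 0 < M.kernel 0 ![a, y, z] (Function.update l 1 (l' 1)) a := fun y z =>
    M.kernel_pos_congr ha (by simp) fun _ _ => rfl
  have h1 := (hM' ![a, b, d]).1 ((M.dist_pos_iff _).2 ⟨_, hm, fun v => by
    fin_cases v
    · exact h0 b d
    · exact M.kernel_pos_congr hb (by simp) fun _ _ => rfl
    · exact M.kernel_pos_congr hd (by simp) fun _ _ => rfl⟩)
  obtain rfl : a = 0 := by simpa using h1.1
  have h2 := (hM' ![0, 0, 1]).1 ((M.dist_pos_iff _).2 ⟨_, hm, fun v => by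
    fin_cases v
    · exact h0 0 1
    · refine M.kernel_pos_congr (hxl 1) (by simp) fun i hi => ?_
      fin_cases i
      · simp
      · simp [evansChildren] at hi
    · refine M.kernel_pos_congr (hxl' 2) (by simp) fun i hi => ?_
      fin_cases i
      · simp [evansChildren] at hi
      · simp⟩)
  simp at h2

end ThreeNodes

/-! ### Models of some distributions -/

section Models

variable {u v w : Fin 3}

theorem correlated_mem (huv : u ≠ v) (huw : u ≠ w) (hvw : v ≠ w) :
    correlated u v w ∈ faceRealizable {(u, w)} ∅ (fun _ => 2) := by
  refine mem_faceRealizable_empty.2 ⟨fun i x y => if i = u then 1 / 2 else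
    if i = v then (if y = 0 then 1 else 0) else if y = x u then 1 else 0,
    fun i x y => by dsimp only; split_ifs <;> norm_num, fun i x => ?_, fun i x x' h => ?_,
    fun x => ?_⟩
  · dsimp only
    split_ifs <;> simp
  · revert i
    refine forall_fin_three huv huw hvw (by simp) (by simp) fun h => ?_
    simp [h u (by simp)]
  · rw [prod_fin_three huv huw hvw]
    simp only [correlated, if_true, if_neg huv.symm, if_neg huw.symm, if_neg hvw.symm, ite_and]
    by_cases h : x u = x w
    · simp [h]
    · simp [h, Ne.symm h]

/-- A tree with root `0` in which each of the other nodes has the parent `f i`. -/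
theorem ghz_mem {E : Finset (Fin 3 × Fin 3)} {t : Fin 3} (h1 : (0, 1) ∈ E) (h2 : (t, 2) ∈ E)
    (ht : t = 0 ∨ t = 1) : ghz ∈ faceRealizable E ∅ (fun _ => 2) := by
  refine mem_faceRealizable_empty.2 ⟨fun i x y => ![1 / 2, if y = x 0 then 1 else 0,
    if y = x t then 1 else 0] i, fun i x y => ?_, fun i x => ?_, fun i x x' h => ?_, fun x => ?_⟩
  · fin_cases i <;> simp <;> split_ifs <;> norm_num
  · fin_cases i <;> simp
  · fin_cases i
    · rfl
    · simp [h 0 h1]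
    · simp [h t h2]
  · simp only [ghz, Fin.prod_univ_three, Matrix.cons_val]
    obtain rfl | rfl := ht <;> generalize x 0 = a <;> generalize x 1 = b <;>
      generalize x 2 = d <;> fin_cases a <;> fin_cases b <;> fin_cases d <;> simp

theorem parity_mem (huv : u ≠ v) (huw : u ≠ w) (hvw : v ≠ w) :
    parity u v w ∈ faceRealizable {(u, v), (w, v)} ∅ (fun _ => 2) := by
  refine mem_faceRealizable_empty.2 ⟨fun i x y => if i = v then
    (if y = x u + x w then 1 else 0) else 1 / 2,
    fun i x y => by dsimp only; split_ifs <;> norm_num, fun i x => ?_, fun i x x' h => ?_,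
    fun x => ?_⟩
  · dsimp only
    split_ifs <;> simp
  · revert i
    refine forall_fin_three huv huw hvw (by simp [huv]) (fun h => ?_) (by simp [hvw.symm])
    simp [h u (by simp), h w (by simp)]
  · rw [prod_fin_three huv huw hvw]
    simp only [parity, if_true, if_neg huv, if_neg hvw.symm]
    split_ifs <;> norm_num

/-- A distribution of an instrument `u`, a treatment `v`, and an effect `w` that is not realizable
when the instrument and the effect exchange their roles. -/
noncomputable def instrumentWitness (u v w : Fin 3) (x : Fin 3 → Fin 3) : ℝ :=
  if x u ≠ 2 ∧ ((x v = 0 ∧ x w = x u) ∨ (x v = 1 ∧ x w = 2)) then 1 / 4 else 0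

theorem instrumentWitness_mem (huv : u ≠ v) (huw : u ≠ w) (hvw : v ≠ w) :
    instrumentWitness u v w ∈ faceRealizable {(u, v), (v, w)} {{v, w}} (fun _ => 3) := by
  rw [faceRealizable_singleton]
  -- The latent variable is a fair guess `m` of `u`: `v` reports by 0 that the guess is right, and
  -- then `w` outputs it; otherwise `w` outputs 2.
  refine mem_kernelRealizable_unit (W := Fin 2) (fun _ => 1 / 2) (fun i x m y =>
    if i = u then ![1 / 2, 1 / 2, 0] y else
    if i = v then (if y = (if x u = m.castSucc then 0 else 1) then 1 else 0) else
      (if y = (if x v = 0 then m.castSucc else 2) then 1 else 0))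
    (fun _ => by norm_num) (by norm_num) (fun i x m y => ?_) (fun i x m => ?_)
    (fun i x x' m m' h hm => ?_) fun x => ?_
  · generalize (if x u = m.castSucc then (0 : Fin 3) else 1) = s
    generalize (if x v = 0 then m.castSucc else (2 : Fin 3)) = t
    split_ifs
    · fin_cases y <;> simp
    all_goals norm_num
  · generalize (if x u = m.castSucc then (0 : Fin 3) else 1) = s
    generalize (if x v = 0 then m.castSucc else (2 : Fin 3)) = t
    split_ifs
    · simp [Fin.sum_univ_three]
      norm_num
    all_goals simp
  · revert i
    refine forall_fin_three huv huw hvw (by simp) (fun h hm => ?_) fun h hm => ?_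
    · simp [h u (by simp), hm (by simp), huv.symm]
    · simp [h v (by simp), hm (by simp), huw.symm, hvw.symm]
  · simp only [prod_fin_three huv huw hvw, instrumentWitness, if_true, if_neg huv.symm,
      if_neg huw.symm, if_neg hvw.symm, Fin.sum_univ_two]
    generalize x u = a
    generalize x v = b
    generalize x w = d
    fin_cases a <;> fin_cases b <;> fin_cases d <;> simp <;> norm_num

/-- With `w` as the instrument, its value 1 forces `v = 0`, so `u = 0` would be possible together
with `w = 1`. -/
theorem instrumentWitness_notMem (huv : u ≠ v) (huw : u ≠ w) (hvw : v ≠ w) :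
    instrumentWitness u v w ∉ faceRealizable {(w, v), (v, u)} {{v, u}} (fun _ => 3) := fun h => by
  have hpos : ∀ x, 0 < instrumentWitness u v w x ↔
      x u ≠ 2 ∧ ((x v = 0 ∧ x w = x u) ∨ (x v = 1 ∧ x w = 2)) := fun x => by
    unfold instrumentWitness
    split_ifs with h
    · exact iff_of_true (by norm_num) h
    · exact iff_of_false (lt_irrefl _) h
  have := pos_of_mem_instrumental hvw.symm huw.symm huv.symm h (x := fun _ => 0)
    (x' := Function.update (fun _ => 1) v 0) ((hpos _).2 (by simp))
    ((hpos _).2 (by simp [huv, hvw.symm])) fun y hy hy' => by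
      have := (hpos y).1 hy'
      rw [hy, Function.update_of_ne hvw.symm] at this
      obtain ⟨-, h | h⟩ := this
      · exact h.1
      · simp at h
  have := (hpos _).1 this
  simp [huw, hvw, hvw.symm] at this

/-- A point of a line of distributions, parametrized by the probability of `x v = 0`. -/
noncomputable def instrumentalBase (v w : Fin 3) (x : Fin 3 → Fin 2) : ℝ :=
  if x v = 1 ∧ x w = 0 then 1 / 2 else 0

/-- The latent variable guesses either value of `u` with probability `t` and gives up (value 2)
otherwise. A right guess is signalled by `v = 0` and reproduced by `w`, so postselecting on `v = 0`
simulates `correlated`; two guesses require `2 * t ≤ 1`. -/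
theorem instrumental_line_mem (huv : u ≠ v) (huw : u ≠ w) (hvw : v ≠ w) {t : ℝ} (ht : 0 ≤ t)
    (ht' : t ≤ 1 / 2) :
    instrumentalBase v w + t • (correlated u v w - instrumentalBase v w) ∈
      faceRealizable {(u, v), (v, w)} {{v, w}} (fun _ => 2) := by
  rw [faceRealizable_singleton]
  refine mem_kernelRealizable_unit (W := Fin 3) ![t, t, 1 - 2 * t] (fun i x m y =>
    if i = u then 1 / 2 else
    if i = v then (if y = (if m = (x u).castSucc then 0 else 1) then 1 else 0) else
      (if y = (if x v = 0 ∧ m = 1 then 1 else 0) then 1 else 0))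
    (fun m => ?_) ?_ (fun i x m y => ?_) (fun i x m => ?_)
    (fun i x x' m m' h hm => ?_) fun x => ?_
  · fin_cases m <;> simp <;> linarith
  · simp [Fin.sum_univ_three]
    ring
  · generalize (if m = (x u).castSucc then (0 : Fin 2) else 1) = s
    generalize (if x v = 0 ∧ m = 1 then (1 : Fin 2) else 0) = t
    split_ifs <;> norm_num
  · generalize (if m = (x u).castSucc then (0 : Fin 2) else 1) = s
    generalize (if x v = 0 ∧ m = 1 then (1 : Fin 2) else 0) = t
    split_ifs <;> simp
  · revert i
    refine forall_fin_three huv huw hvw (by simp) (fun h hm => ?_) fun h hm => ?_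
    · simp [h u (by simp), hm (by simp), huv.symm]
    · simp [h v (by simp), hm (by simp), huw.symm, hvw.symm]
  · simp only [prod_fin_three huv huw hvw, correlated, instrumentalBase, if_true, if_neg huv.symm,
      if_neg huw.symm, if_neg hvw.symm, Fin.sum_univ_three, Pi.add_apply, Pi.smul_apply,
      Pi.sub_apply, smul_eq_mul]
    generalize x u = a
    generalize x v = b
    generalize x w = d
    fin_cases a <;> fin_cases b <;> fin_cases d <;> simp <;> ring

/-- The point mass at `x 0 = 1`, `x 1 = x 2 = 0`. -/
noncomputable def evansBase (x : Fin 3 → Fin 2) : ℝ :=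
  if x 0 = 1 ∧ x 1 = 0 ∧ x 2 = 0 then 1 else 0

theorem evans_line_mem {t : ℝ} (ht : 0 ≤ t) (ht' : t ≤ 1 / 2) :
    evansBase + t • (correlated 1 0 2 - evansBase) ∈
      kernelRealizable {(0, 1), (0, 2)} evansChildren (fun _ => 2) := by
  -- Both confounders choose each bit with probability `s`, or give up. Node 0 gives 0 when they
  -- choose the same bit, which has probability `s * s` for each bit; nodes 1 and 2 then output it.
  obtain ⟨s, hs, hst⟩ : ∃ s : ℝ, 0 ≤ s ∧ s * s = t / 2 :=
    ⟨√(t / 2), Real.sqrt_nonneg _, Real.mul_self_sqrt (by linarith)⟩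
  have hs' : s ≤ 1 / 2 := by nlinarith
  refine ⟨{ Lat := fun _ => Fin 3
            latFintype := fun _ => inferInstance
            weight := fun _ => ![s, s, 1 - 2 * s]
            kernel := fun i x l y => ![
              if y = (if l 0 = l 1 ∧ l 0 ≠ 2 then 0 else 1) then 1 else 0,
              if y = (if x 0 = 0 ∧ l 0 = 1 then 1 else 0) then 1 else 0,
              if y = (if x 0 = 0 ∧ l 1 = 1 then 1 else 0) then 1 else 0] i
            weight_nonneg := fun i m => by fin_cases m <;> simp <;> linarith
            weight_sum := fun i => by simp [Fin.sum_univ_three]; ring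
            kernel_nonneg := fun i x l y => ?_
            kernel_sum := fun i x l => ?_
            kernel_congr := fun i x x' l l' h hl => ?_ }, ?_⟩
  · generalize (if l 0 = l 1 ∧ l 0 ≠ 2 then (0 : Fin 2) else 1) = a
    generalize (if x 0 = 0 ∧ l 0 = 1 then (1 : Fin 2) else 0) = b
    generalize (if x 0 = 0 ∧ l 1 = 1 then (1 : Fin 2) else 0) = d
    fin_cases i <;> simp <;> split_ifs <;> norm_num
  · generalize (if l 0 = l 1 ∧ l 0 ≠ 2 then (0 : Fin 2) else 1) = a
    generalize (if x 0 = 0 ∧ l 0 = 1 then (1 : Fin 2) else 0) = b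
    generalize (if x 0 = 0 ∧ l 1 = 1 then (1 : Fin 2) else 0) = d
    fin_cases i <;> simp
  · fin_cases i
    · simp [hl 0 (by simp [evansChildren]), hl 1 (by simp [evansChildren])]
    · simp [hl 0 (by simp [evansChildren]), h 0 (by simp)]
    · simp [hl 1 (by simp [evansChildren]), h 0 (by simp)]
  · funext x
    have : ∀ F : (Fin 2 → Fin 3) → ℝ, ∑ l, F l = ∑ a, ∑ b, F ![a, b] := fun F => by
      rw [← Fintype.sum_prod_type']
      exact Fintype.sum_equiv (finTwoArrowEquiv (Fin 3)) _ _ fun l => by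
        congr 1
        funext i
        fin_cases i <;> rfl
    simp only [KernelModel.dist]
    refine (this _).trans ?_
    simp only [Fin.prod_univ_three, Fin.prod_univ_two, Fin.sum_univ_three, Matrix.cons_val,
      correlated, evansBase, Pi.add_apply, Pi.smul_apply, Pi.sub_apply, smul_eq_mul]
    generalize x 0 = a
    generalize x 1 = b
    generalize x 2 = d
    fin_cases a <;> fin_cases b <;> fin_cases d <;> simp <;> linarith

theorem triangle_line_mem {t : ℝ} (ht : 0 ≤ t) (ht' : t ≤ 1 / 4) :
    (fun _ => 1 / 8) + t • (ghz - fun _ => 1 / 8) ∈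
      kernelRealizable ∅ triangleChildren (fun _ => 2) := by
  -- Each node copies either of its two fair latent bits with probability `p`, and is uniform
  -- otherwise. Two nodes have correlation `p * p`, from their common bit, and the triple
  -- correlation is 0 by symmetry, as on the line.
  obtain ⟨p, hp, hpt⟩ : ∃ p : ℝ, 0 ≤ p ∧ p * p = t :=
    ⟨√t, Real.sqrt_nonneg _, Real.mul_self_sqrt ht⟩
  have hp' : p ≤ 1 / 2 := by nlinarith
  refine ⟨{ Lat := fun _ => Fin 2
            latFintype := fun _ => inferInstance
            weight := fun _ _ => 1 / 2
            kernel := fun i x l y =>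
              (∑ j, if j ≠ i ∧ l j = y then p else 0) + (1 - 2 * p) / 2
            weight_nonneg := fun i m => by norm_num
            weight_sum := fun i => by norm_num
            kernel_nonneg := fun i x l y => add_nonneg (Finset.sum_nonneg fun j _ => by
              split_ifs <;> simp [hp]) (by linarith)
            kernel_sum := fun i x l => ?_
            kernel_congr := fun i x x' l l' h hl => ?_ }, ?_⟩
  · rw [Finset.sum_add_distrib, Finset.sum_comm]
    simp only [ite_and, Fin.sum_univ_three]
    fin_cases i <;> simp <;> ring
  · funext y
    congr 1
    refine Finset.sum_congr rfl fun j _ => ?_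
    by_cases hj : j = i
    · simp [hj]
    · rw [hl j (by simpa [triangleChildren] using Ne.symm hj)]
  · funext x
    have : ∀ F : (Fin 3 → Fin 2) → ℝ, ∑ l, F l = ∑ a, ∑ b, ∑ d, F ![a, b, d] := fun F => by
      simp_rw [← Fintype.sum_prod_type']
      exact Fintype.sum_equiv
        { toFun := fun l : Fin 3 → Fin 2 => ((l 0, l 1), l 2)
          invFun := fun m => ![m.1.1, m.1.2, m.2]
          left_inv := fun l => by
            funext i
            fin_cases i <;> rfl
          right_inv := fun m => rfl } F (fun m => F ![m.1.1, m.1.2, m.2]) fun l =>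
        congrArg F <| by
          funext i
          fin_cases i <;> rfl
    simp only [KernelModel.dist]
    refine (this _).trans ?_
    simp only [Fin.prod_univ_three, Fin.sum_univ_three, Fin.sum_univ_two, Matrix.cons_val,
      ghz, Pi.add_apply, Pi.smul_apply, Pi.sub_apply, smul_eq_mul, ← hpt]
    generalize x 0 = a
    generalize x 1 = b
    generalize x 2 = d
    fin_cases a <;> fin_cases b <;> fin_cases d <;> simp <;> ring

end Models

/-! ### Three-node mDAGs given by their directed edges and latent variables -/

section Codes

/-- The directed edges and the confounders of an mDAG. -/
abbrev Code := Finset (Fin 3 × Fin 3) × Finset (Finset (Fin 3))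

variable {c : Fin 3 → ℕ} {p q : Code}

/-- The distributions that have a kernel model with the given edges and confounders. -/
def Code.realizable (p : Code) (c : Fin 3 → ℕ) : Set ((∀ v, Fin (c v)) → ℝ) :=
  faceRealizable p.1 p.2 c

/-- `p` has fewer edges and confounders than `q`. -/
def Code.LE (p q : Code) : Prop := p.1 ⊆ q.1 ∧ ∀ A ∈ p.2, ∃ B ∈ q.2, A ⊆ B

instance : DecidableRel Code.LE := fun p q => by unfold Code.LE; infer_instance

theorem Code.LE.realizable_subset (h : p.LE q) : p.realizable c ⊆ q.realizable c :=
  faceRealizable_mono h.1 fun A hA => .inr (h.2 A hA)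

/-- An edge `u → w`, a confounder of `u` and `w`, or both. -/
def Code.variants (p : Code) (u w : Fin 3) : List Code :=
  [(insert (u, w) p.1, p.2), (p.1, insert {u, w} p.2), (insert (u, w) p.1, insert {u, w} p.2)]

/-- `p` and `q` differ at most in the way in which `u`, which has no other parents and no other
confounders, is connected to `w`. -/
def Code.SwapAt (u w : Fin 3) (p q : Code) : Prop :=
  u ≠ w ∧ (∀ y, (y, u) ∉ p.1) ∧ (∀ A ∈ p.2, u ∈ A → A = {u, w}) ∧
    p ∈ Code.variants (p.1.erase (u, w), p.2.erase {u, w}) u w ∧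
    q ∈ Code.variants (p.1.erase (u, w), p.2.erase {u, w}) u w

instance (u w : Fin 3) : DecidableRel (Code.SwapAt u w) := fun p q => by
  unfold Code.SwapAt
  infer_instance

/-- `p` and `q` are equal or differ in the way in which some node is connected to another one. -/
def Code.Swap (p q : Code) : Prop :=
  p = q ∨ ∃ u w : Fin 3, Code.SwapAt u w p q

instance : DecidableRel Code.Swap := fun p q => by
  unfold Code.Swap
  infer_instance

theorem Code.realizable_eq_of_mem_variants {r : Code} {u w : Fin 3} (huw : u ≠ w)
    (hE : ∀ y, (y, u) ∉ r.1) (hF : ∀ A ∈ r.2, u ∉ A) (hc : ∀ v, c v ≠ 0)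
    (hp : p ∈ r.variants u w) :
    p.realizable c = faceRealizable (insert (u, w) r.1) (insert {u, w} r.2) c := by
  simp only [Code.variants, List.mem_cons, List.not_mem_nil, or_false] at hp
  obtain rfl | rfl | rfl := hp
  · exact faceRealizable_edge_eq_both huw hE hF
  · exact faceRealizable_pair_eq_both huw hE hF hc
  · rfl

theorem Code.Swap.realizable_eq (h : p.Swap q) (hc : ∀ v, c v ≠ 0) :
    p.realizable c = q.realizable c := by
  obtain rfl | ⟨u, w, huw, hE, hF, hp, hq⟩ := h
  · rfl
  · have hE' : ∀ y, (y, u) ∉ p.1.erase (u, w) := fun y h => hE y (Finset.mem_of_mem_erase h)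
    have hF' : ∀ A ∈ p.2.erase {u, w}, u ∉ A := fun A hA h =>
      Finset.ne_of_mem_erase hA (hF A (Finset.mem_of_mem_erase hA) h)
    rw [Code.realizable_eq_of_mem_variants huw hE' hF' hc hp,
      Code.realizable_eq_of_mem_variants huw hE' hF' hc hq]

theorem Code.realizable_subset_of_edge {v w : Fin 3} (hvw : v ≠ w)
    (hpa : ∀ u, (u, v) ∈ p.1 → (u, w) ∈ p.1) (hlat : ∀ A ∈ p.2, v ∈ A → w ∈ A)
    (hF : ∃ B ∈ p.2, v ∈ B ∧ w ∈ B) (hc : ∀ v, c v ≠ 0) (hq : q.LE (insert (v, w) p.1, p.2)) :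
    q.realizable c ⊆ p.realizable c :=
  hq.realizable_subset.trans (faceRealizable_insert_edge hvw hpa hlat hF hc)

end Codes

/-! ### Equivalence of the members of a class with its representative -/

namespace ClassName

/-- A representative of each class, not necessarily consistent with the nodal ordering. -/
def rep : ClassName → Code
  | factorizing => (∅, ∅)
  | factorizingAB_C => ({ab}, ∅)
  | factorizingAC_B => ({ac}, ∅)
  | factorizingBC_A => ({bc}, ∅)
  | chain => ({ab, bc}, ∅)
  | fork => ({ab, ac}, ∅)
  | colliderA => ({(1, 0), (2, 0)}, ∅)
  | colliderB => ({ab, (2, 1)}, ∅)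
  | colliderC => ({ac, bc}, ∅)
  | instrumentalABC => ({ab, bc}, {BC})
  | instrumentalBAC => ({(1, 0), ac}, {AC})
  | instrumentalCAB => ({(2, 0), ab}, {AB})
  | evans => ({ab, ac}, {AB, AC})
  | triangle => (∅, {AB, AC, BC})
  | saturated => ({ab, ac, bc}, ∅)

variable {c : Fin 3 → ℕ}

theorem rank_lt_of_mem {p : Code} (hp : p.1 ⊆ {ab, ac, bc}) (u w : Fin 3) (h : (u, w) ∈ p.1) :
    u.val < w.val := by
  have hlt : ∀ e ∈ ({ab, ac, bc} : Finset (Fin 3 × Fin 3)), e.1.val < e.2.val := by decide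
  exact hlt _ (hp h)

theorem Code.realizable_subset_stdSimplex {p : Code} (hp : p.1 ⊆ {ab, ac, bc})
    (hc : ∀ v, c v ≠ 0) : p.realizable c ⊆ stdSimplex ℝ (∀ v, Fin (c v)) :=
  kernelRealizable_subset_stdSimplex (r := Fin.val) Fin.val_injective (rank_lt_of_mem hp) hc

theorem stdSimplex_subset_rep_saturated (hc : ∀ v, c v ≠ 0) :
    stdSimplex ℝ (∀ v, Fin (c v)) ⊆ (rep saturated).realizable c :=
  stdSimplex_subset_faceRealizable (r := Fin.val) Fin.val_injective (by decide) hc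

/-- The minimal elements among the members of the class `saturated`. -/
def minimalSaturated : List Code :=
  [(∅, {ABC}), ({ab}, {AC, BC}), ({ac}, {AB, BC}), ({bc}, {AB, AC}), ({ab, ac}, {BC}),
    ({ab, bc}, {AC}), ({ac, bc}, {AB}), ({ab, ac, bc}, ∅)]

/-- Each case starts from a complete DAG, which realizes everything, and trades edges for
confounders. -/
theorem stdSimplex_subset_minimalSaturated (hc : ∀ v, c v ≠ 0) :
    ∀ p ∈ minimalSaturated, stdSimplex ℝ (∀ v, Fin (c v)) ⊆ p.realizable c := by
  have hsat := stdSimplex_subset_rep_saturated hc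
  have h5 : stdSimplex ℝ (∀ v, Fin (c v)) ⊆ Code.realizable ({ab, ac}, {BC}) c :=
    hsat.trans (Code.realizable_subset_of_edge (v := 1) (w := 2) (by decide) (by decide)
      (by decide) (by decide) hc (by decide))
  simp only [minimalSaturated, List.forall_mem_cons, List.not_mem_nil, false_imp_iff,
    implies_true, and_true]
  refine ⟨?_, ?_, ?_, ?_, h5, ?_, ?_, hsat⟩
  -- The common cause of all three nodes replaces `b → c`, then `a → c`, then `a → b`; in this order
  -- each tail has no parents that its head lacks.
  · refine hsat.trans ((?_ : _ ⊆ Code.realizable ({ab, ac}, {ABC}) c).trans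
      ((?_ : _ ⊆ Code.realizable ({ab}, {ABC}) c).trans ?_))
    · exact Code.realizable_subset_of_edge (v := 1) (w := 2) (by decide) (by decide)
        (by decide) (by decide) hc (by decide)
    · exact Code.realizable_subset_of_edge (v := 0) (w := 2) (by decide) (by decide)
        (by decide) (by decide) hc (by decide)
    · exact Code.realizable_subset_of_edge (v := 0) (w := 1) (by decide) (by decide)
        (by decide) (by decide) hc (by decide)
  · rw [Code.Swap.realizable_eq (q := ({ab, ac}, {BC})) (by decide) hc]
    exact h5
  · rw [Code.Swap.realizable_eq (q := ({ab, ac}, {BC})) (by decide) hc]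
    exact h5
  -- Turning the confounder of `a` and `b` into `b → a` leads to the complete DAG of the order `b,
  -- c, a` with `c → a` traded for a confounder.
  · rw [Code.Swap.realizable_eq (q := ({(1, 0), bc}, {AC})) (by decide) hc]
    refine (stdSimplex_subset_faceRealizable (r := ![2, 0, 1]) (by decide)
      (E := {(1, 0), bc, (2, 0)}) (by decide) hc).trans
      (Code.realizable_subset_of_edge (q := ({(1, 0), bc, (2, 0)}, ∅)) (v := 2) (w := 0)
        (by decide) (by decide) (by decide) (by decide) hc (by decide))
  · rw [Code.Swap.realizable_eq (q := rep saturated) (by decide) hc]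
    exact hsat
  · rw [Code.Swap.realizable_eq (q := rep saturated) (by decide) hc]
    exact hsat

theorem table_saturated_le : ∀ p ∈ table saturated, ∃ m ∈ minimalSaturated, Code.LE m p := by
  simp only [table, List.forall_mem_cons, List.not_mem_nil, false_imp_iff, implies_true, and_true]
  and_intros <;> decide +kernel

/-- Members of a class through which its representative is reached by swaps. -/
def intermediate : ClassName → List Code
  | colliderA => [({(1, 0)}, {AC})]
  | colliderB => [({ab}, {BC})]
  | colliderC => [({ac, bc}, ∅), ({bc}, {AC}), ({ac, bc}, {AC})]
  | k => [k.rep]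

theorem exists_intermediate (k : ClassName) (hk : k ≠ saturated) :
    ∀ p ∈ k.table, ∃ q ∈ k.intermediate, Code.Swap p q ∧ Code.Swap q k.rep := by
  cases k <;> first | exact absurd rfl hk | skip
  all_goals
    simp only [table, List.forall_mem_cons, List.not_mem_nil, false_imp_iff, implies_true, and_true]
    and_intros <;> decide +kernel

theorem table_subset_edges (k : ClassName) : ∀ p ∈ k.table, p.1 ⊆ {ab, ac, bc} := by
  cases k <;>
    simp only [table, List.forall_mem_cons, List.not_mem_nil, false_imp_iff, implies_true,
      and_true] <;>
    and_intros <;> decide +kernel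

/-- Outside `saturated`, two swaps suffice. In `saturated`, both sides are the whole simplex. -/
theorem realizable_eq_rep {k : ClassName} {p : Code} (hp : p ∈ k.table) (hc : ∀ v, c v ≠ 0) :
    p.realizable c = k.rep.realizable c := by
  by_cases hk : k = saturated
  · subst hk
    obtain ⟨m, hm, hmp⟩ := table_saturated_le p hp
    exact ((Code.realizable_subset_stdSimplex (table_subset_edges _ p hp) hc).trans
      (stdSimplex_subset_rep_saturated hc)).antisymm
      ((Code.realizable_subset_stdSimplex (by decide) hc).trans
        ((stdSimplex_subset_minimalSaturated hc m hm).trans (Code.LE.realizable_subset hmp)))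
  · obtain ⟨q, -, hpq, hq⟩ := exists_intermediate k hk p hp
    exact (Code.Swap.realizable_eq hpq hc).trans (Code.Swap.realizable_eq hq hc)

end ClassName

/-! ### Dominance between the classes -/

namespace ClassName

/-- The representative of `k` observationally dominates that of `l`. -/
def Dom (k l : ClassName) : Prop :=
  ∀ c : Fin 3 → ℕ, (∀ v, c v ≠ 0) → l.rep.realizable c ⊆ k.rep.realizable c

theorem Dom.refl (k : ClassName) : Dom k k := fun _ _ => subset_rfl

theorem Dom.trans {k l m : ClassName} (h : Dom k l) (h' : Dom l m) : Dom k m :=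
  fun c hc => (h' c hc).trans (h c hc)

/-- The classes at the lower ends of the descending paths that start at a given class. -/
def descendants : ClassName → List ClassName
  | saturated => [saturated, triangle, evans, instrumentalABC, instrumentalBAC, instrumentalCAB,
      colliderA, colliderB, colliderC, fork, chain, factorizingAB_C, factorizingAC_B,
      factorizingBC_A, factorizing]
  | evans => [evans, instrumentalBAC, instrumentalCAB, colliderA, fork, factorizingAB_C,
      factorizingAC_B, factorizing]
  | triangle => [triangle, colliderA, colliderB, colliderC, factorizingAB_C, factorizingAC_B,
      factorizingBC_A, factorizing]
  | instrumentalABC => [instrumentalABC, colliderB, chain, factorizingAB_C, factorizingBC_A,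
      factorizing]
  | instrumentalBAC => [instrumentalBAC, colliderA, fork, factorizingAB_C, factorizingAC_B,
      factorizing]
  | instrumentalCAB => [instrumentalCAB, colliderA, fork, factorizingAB_C, factorizingAC_B,
      factorizing]
  | colliderA => [colliderA, factorizingAB_C, factorizingAC_B, factorizing]
  | colliderB => [colliderB, factorizingAB_C, factorizingBC_A, factorizing]
  | colliderC => [colliderC, factorizingAC_B, factorizingBC_A, factorizing]
  | fork => [fork, factorizingAB_C, factorizingAC_B, factorizing]
  | chain => [chain, factorizingAB_C, factorizingBC_A, factorizing]
  | factorizingAB_C => [factorizingAB_C, factorizing]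
  | factorizingAC_B => [factorizingAC_B, factorizing]
  | factorizingBC_A => [factorizingBC_A, factorizing]
  | factorizing => [factorizing]

instance : Fintype ClassName where
  elems := {saturated, triangle, evans, instrumentalABC, instrumentalBAC, instrumentalCAB,
    colliderA, colliderB, colliderC, fork, chain, factorizingAB_C, factorizingAC_B,
    factorizingBC_A, factorizing}
  complete k := by cases k <;> decide

instance : DecidableRel Line := fun k l => inferInstanceAs (Decidable (l ∈ k.below))

theorem mem_descendants_of_line : ∀ k l m : ClassName, l ∈ k.descendants → Line l m →
    m ∈ k.descendants := by
  intro k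
  cases k <;> decide +kernel

theorem eq_or_exists_line : ∀ k l : ClassName, l ∈ k.descendants →
    l = k ∨ ∃ m, Line k m ∧ l ∈ m.descendants := by
  intro k
  cases k <;> decide +kernel

theorem length_descendants_lt : ∀ k m : ClassName, Line k m →
    m.descendants.length < k.descendants.length := by
  intro k
  cases k <;> decide +kernel

theorem mem_descendants_self : ∀ k : ClassName, k ∈ k.descendants := by decide +kernel

/-- Makes reachability decidable; paths are built by induction because the list of descendants
shrinks along each line. -/
theorem reflTransGen_line_iff {k l : ClassName} :
    Relation.ReflTransGen Line k l ↔ l ∈ k.descendants := by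
  constructor
  · intro h
    induction h with
    | refl => exact mem_descendants_self k
    | tail _ h ih => exact mem_descendants_of_line _ _ _ ih h
  · induction hn : k.descendants.length using Nat.strong_induction_on generalizing k with
    | _ n ih =>
      intro h
      obtain rfl | ⟨m, hm, hl⟩ := eq_or_exists_line k l h
      · exact .refl
      · exact .head hm (ih _ (hn ▸ length_descendants_lt k m hm) rfl hl)

/-- Suitable members of the two classes are comparable by inclusion, even where the representatives
are not. -/
theorem line_exists_le : ∀ k l : ClassName, Line k l →
    ∃ p ∈ k.table, ∃ q ∈ l.table, Code.LE q p := by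
  intro k
  cases k <;> decide +kernel

theorem dom_of_line {k l : ClassName} (h : Line k l) : Dom k l := fun c hc => by
  obtain ⟨p, hp, q, hq, hqp⟩ := line_exists_le k l h
  rw [← realizable_eq_rep hp hc, ← realizable_eq_rep hq hc]
  exact Code.LE.realizable_subset hqp

theorem dom_of_reflTransGen {k l : ClassName} (h : Relation.ReflTransGen Line k l) : Dom k l := by
  induction h with
  | refl => exact .refl k
  | tail _ h ih => exact ih.trans (dom_of_line h)

theorem rep_evans_subset {c : Fin 3 → ℕ} :
    (rep evans).realizable c ⊆ kernelRealizable {(0, 1), (0, 2)} evansChildren c :=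
  kernelRealizable_mono subset_rfl (fun A => if A.1 = {0, 1} then 0 else 1) (by decide +kernel)

theorem rep_triangle_subset {c : Fin 3 → ℕ} :
    (rep triangle).realizable c ⊆ kernelRealizable ∅ triangleChildren c :=
  kernelRealizable_mono subset_rfl
    (fun A => if A.1 = {0, 1} then 2 else if A.1 = {0, 2} then 1 else 0) (by decide +kernel)

theorem subset_rep_evans {c : Fin 3 → ℕ} :
    kernelRealizable {(0, 1), (0, 2)} evansChildren c ⊆ (rep evans).realizable c :=
  kernelRealizable_mono subset_rfl ![⟨{0, 1}, by decide⟩, ⟨{0, 2}, by decide⟩] (by decide)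

theorem subset_rep_triangle {c : Fin 3 → ℕ} :
    kernelRealizable ∅ triangleChildren c ⊆ (rep triangle).realizable c :=
  kernelRealizable_mono subset_rfl
    ![⟨{1, 2}, by decide⟩, ⟨{0, 2}, by decide⟩, ⟨{0, 1}, by decide⟩] (by decide)

/-- Pairs of classes without dominance from which all others can be derived. -/
def criticalPairs : List (ClassName × ClassName) :=
  [(colliderC, factorizingAB_C), (instrumentalABC, factorizingAC_B), (evans, factorizingBC_A),
    (triangle, fork), (triangle, chain), (fork, colliderA), (chain, colliderB),
    (instrumentalBAC, instrumentalCAB), (instrumentalCAB, instrumentalBAC)]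

theorem not_dom_of_mem {k l : ClassName} (n : ℕ) (hn : n ≠ 0) {P : (Fin 3 → Fin n) → ℝ}
    (h : P ∈ l.rep.realizable fun _ => n) (h' : P ∉ k.rep.realizable fun _ => n) : ¬ Dom k l :=
  fun hd => h' (hd _ (fun _ => hn) h)

theorem not_dom_criticalPairs : ∀ p ∈ criticalPairs, ¬ Dom p.1 p.2 := by
  simp only [criticalPairs, List.forall_mem_cons, List.not_mem_nil, false_imp_iff,
    implies_true, and_true]
  refine ⟨?_, ?_, ?_, ?_, ?_, ?_, ?_, ?_, ?_⟩
  · exact not_dom_of_mem 2 (by decide) (correlated_mem (u := 0) (v := 2) (w := 1) (by decide)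
      (by decide) (by decide)) (correlated_notMem_collider (by decide) (by decide) (by decide))
  · exact not_dom_of_mem 2 (by decide) (correlated_mem (u := 0) (v := 1) (w := 2) (by decide)
      (by decide) (by decide)) (correlated_notMem_instrumental (by decide) (by decide) (by decide))
  · exact not_dom_of_mem 2 (by decide) (correlated_mem (u := 1) (v := 0) (w := 2) (by decide)
      (by decide) (by decide)) fun h => correlated_notMem_evans (rep_evans_subset h)
  · exact not_dom_of_mem 2 (by decide) (ghz_mem (t := 0) (by decide) (by decide) (by decide))
      fun h => ghz_notMem_triangle (rep_triangle_subset h)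
  · exact not_dom_of_mem 2 (by decide) (ghz_mem (t := 1) (by decide) (by decide) (by decide))
      fun h => ghz_notMem_triangle (rep_triangle_subset h)
  · exact not_dom_of_mem 2 (by decide) (parity_mem (u := 1) (v := 0) (w := 2) (by decide)
      (by decide) (by decide)) (parity_notMem_noncollider (by decide) (by decide) (by decide)
      (by decide) (by decide))
  · exact not_dom_of_mem 2 (by decide) (parity_mem (u := 0) (v := 1) (w := 2) (by decide)
      (by decide) (by decide)) (parity_notMem_noncollider (by decide) (by decide) (by decide)
      (by decide) (by decide))
  · exact not_dom_of_mem 3 (by decide) (instrumentWitness_mem (u := 2) (v := 0) (w := 1)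
      (by decide) (by decide) (by decide))
      (instrumentWitness_notMem (by decide) (by decide) (by decide))
  · exact not_dom_of_mem 3 (by decide) (instrumentWitness_mem (u := 1) (v := 0) (w := 2)
      (by decide) (by decide) (by decide))
      (instrumentWitness_notMem (by decide) (by decide) (by decide))

/-- Here `p.1` dominates `k` and `l` dominates `p.2`, so a dominance of `l` by `k` would extend to
the critical pair. -/
theorem exists_criticalPair : ∀ k l : ClassName, l ∉ k.descendants →
    ∃ p ∈ criticalPairs, k ∈ p.1.descendants ∧ p.2 ∈ l.descendants := by
  intro k
  cases k <;> decide +kernel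

theorem dom_iff {k l : ClassName} : Dom k l ↔ Relation.ReflTransGen Line k l := by
  refine ⟨fun h => ?_, dom_of_reflTransGen⟩
  by_contra hkl
  obtain ⟨p, hp, h1, h2⟩ := exists_criticalPair k l fun h => hkl (reflTransGen_line_iff.2 h)
  exact not_dom_criticalPairs p hp
    ((dom_of_reflTransGen (reflTransGen_line_iff.2 h1)).trans
      (h.trans (dom_of_reflTransGen (reflTransGen_line_iff.2 h2))))

theorem dom_antisymm {k l : ClassName} (h : Dom k l) (h' : Dom l k) : k = l := by
  rw [dom_iff, reflTransGen_line_iff] at h h'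
  revert h h'
  revert k l
  decide +kernel

theorem line_iff_covers (k l : ClassName) : Line k l ↔ (Dom k l ∧ k ≠ l) ∧
    ¬ ∃ m, (Dom k m ∧ k ≠ m) ∧ Dom m l ∧ m ≠ l := by
  simp only [dom_iff, reflTransGen_line_iff]
  revert l
  cases k <;> decide +kernel

end ClassName

/-! ### d-separation in three-node mDAGs -/

theorem exists_crossing {α : Type} {R : α → α → Prop} {S : α → Prop} {p : List α}
    (hp : p.IsChain R) {x y : α} (hx : p.head? = some x) (hy : p.getLast? = some y)
    (hSx : S x) (hSy : ¬ S y) :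
    ∃ l₁ m n l₂, p = l₁ ++ m :: n :: l₂ ∧ S m ∧ ¬ S n ∧ R m n := by
  induction p generalizing x with
  | nil => simp at hx
  | cons a p ih =>
    obtain rfl : a = x := by simpa using hx
    cases p with
    | nil =>
      obtain rfl : a = y := by simpa using hy
      exact (hSy hSx).elim
    | cons b p =>
      rw [List.isChain_cons_cons] at hp
      by_cases hb : S b
      · obtain ⟨l₁, m, n, l₂, h, hm⟩ := ih hp.2 (x := b) rfl (by simpa using hy) hb
        exact ⟨a :: l₁, m, n, l₂, by rw [h]; rfl, hm⟩
      · exact ⟨[], a, b, p, rfl, hSx, hb, hp.1⟩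

namespace MDAG

variable {V : Type} [DecidableEq V] {G : MDAG V} {u w z : V}

theorem exists_facet {B : Finset V} (hB : B ∈ G.faces) : ∃ A ∈ G.facets, B ⊆ A := by
  obtain ⟨A, hBA, hA⟩ := G.faces.exists_le_maximal hB
  exact ⟨A, Finset.mem_filter.2 ⟨hA.1, fun C hC h => h.antisymm (hA.2 hC h)⟩, hBA⟩

theorem mem_faces_of_mem_facets {A : Finset V} (hA : A ∈ G.facets) : A ∈ G.faces :=
  (Finset.mem_filter.1 hA).1

variable (G) in
/-- There is a directed edge from `u` to `z` or a face containing both. -/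
def Into (u z : V) : Prop := (u, z) ∈ G.edges ∨ ∃ B ∈ G.faces, u ∈ B ∧ z ∈ B

variable (G) in
/-- `m` is `u` or a latent variable with the child `u`. -/
def Side (u : V) : V ⊕ {A // A ∈ G.facets} → Prop
  | Sum.inl v => v = u
  | Sum.inr A => u ∈ A.1

variable (G) in
/-- `m` and `n` are joined by an edge of the canonical pDAG. -/
def Linked (m n : V ⊕ {A // A ∈ G.facets}) : Prop := G.canonical.edge m n ∨ G.canonical.edge n m

theorem not_edge_inr (m : V ⊕ {A // A ∈ G.facets}) (A : {A // A ∈ G.facets}) :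
    ¬ G.canonical.edge m (Sum.inr A) := by
  rcases m with m | m <;> exact id

theorem not_edge_edge {m n : V ⊕ {A // A ∈ G.facets}} (h : G.canonical.edge m n) :
    ¬ G.canonical.edge n m := fun h' => G.canonical.acyclic m (.head h (.single h'))

/-- Leaving `u` and its latent parents directly for `w` would make `u` and `w` adjacent, so the only
exit is `z`. -/
theorem eq_of_linked_of_side (hV : ∀ v, v = u ∨ v = w ∨ v = z) (huw : u ≠ w)
    (h : ¬ G.skeleton.Adj u w) {m n : V ⊕ {A // A ∈ G.facets}} (hm : G.Side u m)
    (hn : ¬ G.Side u n) (hmn : G.Linked m n) : n = Sum.inl z := by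
  rcases m with v | A <;> rcases n with v' | A'
  · obtain rfl : v = u := hm
    obtain rfl | rfl | rfl := hV v'
    · exact (hn rfl).elim
    · exact (h ⟨huw, hmn.imp id .inl⟩).elim
    · rfl
  · obtain rfl : v = u := hm
    exact (hmn.elim (fun h => h) hn).elim
  · have hv' : v' ∈ A.1 := hmn.elim id fun h => h.elim
    obtain rfl | rfl | rfl := hV v'
    · exact (hn rfl).elim
    · exact (h ⟨huw, .inr (.inr ⟨A.1, mem_faces_of_mem_facets A.2, hm, hv'⟩)⟩).elim
    · rfl
  · exact hmn.elim (fun h => h.elim) fun h => h.elim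

/-- A path between nonadjacent nodes goes through the third node. -/
theorem exists_infix_of_isPath (hV : ∀ v, v = u ∨ v = w ∨ v = z) (huw : u ≠ w)
    (h : ¬ G.skeleton.Adj u w) {p : List (V ⊕ {A // A ∈ G.facets})}
    (hp : G.canonical.IsPath (Sum.inl u) (Sum.inl w) p) :
    ∃ m n, [m, Sum.inl z, n] <:+: p ∧ G.Side u m ∧ G.Side w n ∧ G.Linked m (Sum.inl z) ∧
      G.Linked n (Sum.inl z) := by
  obtain ⟨hchain, hnodup, hhead, hlast⟩ := hp
  obtain ⟨l₁, m, z₁, l₂, h₁, hm, hz₁, hmz⟩ := exists_crossing (S := G.Side u) hchain hhead hlast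
    rfl fun h : w = u => huw h.symm
  obtain rfl := eq_of_linked_of_side hV huw h hm hz₁ hmz
  -- The path leaves the side of `u` into `z` and enters the side of `w` from `z`. As its nodes are
  -- distinct, this is the same occurrence of `z`.
  obtain ⟨l₃, z₂, n, l₄, h₂, hz₂, hn, hzn⟩ := exists_crossing (S := fun x => ¬ G.Side w x) hchain
    hhead hlast (fun h : u = w => huw h) (not_not_intro rfl)
  rw [not_not] at hn
  obtain rfl := eq_of_linked_of_side (z := z) (fun v => by have := hV v; tauto) huw.symm
    (fun h' => h h'.symm) hn hz₂ hzn.symm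
  have h₁' : p = (l₁ ++ [m]) ++ Sum.inl z :: l₂ := by simp [h₁]
  have hn₁ : Sum.inl z ∉ l₁ ++ [m] := by
    rw [h₁', List.nodup_append] at hnodup
    exact fun hz => hnodup.2.2 _ hz _ (by simp) rfl
  have hn₂ : Sum.inl z ∉ l₂ := by
    rw [h₁', List.nodup_append] at hnodup
    exact (List.nodup_cons.1 hnodup.2.1).1
  obtain ⟨rfl, -, rfl⟩ := (List.append_cons_inj_of_notMem hn₁ hn₂).1 (h₁'.symm.trans h₂)
  exact ⟨m, n, ⟨l₁, l₄, by simp [h₁]⟩, hm, hn, hmz, hzn.symm⟩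

/-- Adjacent nodes are joined by an edge or through one latent node, and a latent node is neither a
collider nor in `C`. -/
theorem not_dSep_of_adj (h : G.skeleton.Adj u w) (C : Finset V) :
    ¬ G.canonical.DSep {u} {w} C := by
  obtain ⟨huw, h⟩ := h
  intro hd
  have hd' := fun p => hd u (by simp) w (by simp) p
  have direct : G.Linked (Sum.inl u) (Sum.inl w) → False := fun hl => by
    obtain ⟨a, m, b, hab, -⟩ := hd' [Sum.inl u, Sum.inl w] ⟨by simpa [Linked] using hl, by simp [huw],
      rfl, rfl⟩
    simpa using hab.length_le
  obtain h | h | ⟨B, hB, hu, hw⟩ := h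
  · exact direct (.inl h)
  · exact direct (.inr h)
  · obtain ⟨A, hA, hBA⟩ := exists_facet hB
    have e₁ : G.canonical.edge (Sum.inr ⟨A, hA⟩) (Sum.inl u) := hBA hu
    have e₂ : G.canonical.edge (Sum.inr ⟨A, hA⟩) (Sum.inl w) := hBA hw
    obtain ⟨a, m, b, hab, hm⟩ := hd' [Sum.inl u, Sum.inr ⟨A, hA⟩, Sum.inl w]
      ⟨by simp [e₁, e₂], by simp [huw], rfl, rfl⟩
    obtain ⟨rfl, rfl, rfl⟩ : a = Sum.inl u ∧ m = Sum.inr ⟨A, hA⟩ ∧ b = Sum.inl w := by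
      simpa using hab.eq_of_length rfl
    simp [not_edge_inr] at hm

/-- If `u` and `w` are linked to `z` through `m` and `n`, then there is a path that is only blocked
at `z`. -/
theorem exists_isPath (huw : u ≠ w) (hzu : z ≠ u) (hzw : z ≠ w) (h : ¬ G.skeleton.Adj u w)
    {m n : V ⊕ {A // A ∈ G.facets}} (hm : G.Side u m) (hn : G.Side w n)
    (hmz : G.Linked m (Sum.inl z)) (hnz : G.Linked n (Sum.inl z)) :
    ∃ p, G.canonical.IsPath (Sum.inl u) (Sum.inl w) p ∧ ∀ C, G.canonical.Blocked C p →
      ((G.canonical.edge m (Sum.inl z) ∧ G.canonical.edge n (Sum.inl z)) ∧ z ∉ C ∨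
        ¬ (G.canonical.edge m (Sum.inl z) ∧ G.canonical.edge n (Sum.inl z)) ∧ z ∈ C) := by
  have key : ∀ (C : Finset V), ((G.canonical.edge m (Sum.inl z) ∧ G.canonical.edge n (Sum.inl z) ∧
      ∀ y ∈ C, Sum.inl z ≠ (Sum.inl y : V ⊕ {A // A ∈ G.facets}) ∧
        ¬ G.canonical.Ancestor (Sum.inl z) (Sum.inl y)) ∨
      (¬ (G.canonical.edge m (Sum.inl z) ∧ G.canonical.edge n (Sum.inl z)) ∧
        ∃ y ∈ C, Sum.inl z = (Sum.inl y : V ⊕ {A // A ∈ G.facets}))) →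
      ((G.canonical.edge m (Sum.inl z) ∧ G.canonical.edge n (Sum.inl z)) ∧ z ∉ C ∨
        ¬ (G.canonical.edge m (Sum.inl z) ∧ G.canonical.edge n (Sum.inl z)) ∧ z ∈ C) := by
    rintro C (⟨h₁, h₂, h₃⟩ | ⟨h₁, y, hy, hzy⟩)
    · exact .inl ⟨⟨h₁, h₂⟩, fun hz => (h₃ z hz).1 rfl⟩
    · obtain rfl := Sum.inl.inj hzy
      exact .inr ⟨h₁, hy⟩
  -- Inner latent nodes never block.
  have hlat : ∀ (a b : V ⊕ {A // A ∈ G.facets}) (A : {A // A ∈ G.facets}) (C : Finset V),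
      ¬ ((G.canonical.edge a (Sum.inr A) ∧ G.canonical.edge b (Sum.inr A) ∧
        ∀ y ∈ C, (Sum.inr A : V ⊕ {A // A ∈ G.facets}) ≠ Sum.inl y ∧
          ¬ G.canonical.Ancestor (Sum.inr A) (Sum.inl y)) ∨
      (¬ (G.canonical.edge a (Sum.inr A) ∧ G.canonical.edge b (Sum.inr A)) ∧
        ∃ y ∈ C, (Sum.inr A : V ⊕ {A // A ∈ G.facets}) = Sum.inl y)) := by
    simp [not_edge_inr]
  have hside : ∀ {x : V} {A : {A // A ∈ G.facets}}, G.Side x (Sum.inr A) →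
      G.Linked (Sum.inl x) (Sum.inr A) := fun h => .inr h
  rcases m with v | A <;> rcases n with v' | B
  · obtain rfl : v = u := hm
    obtain rfl : v' = w := hn
    refine ⟨[Sum.inl v, Sum.inl z, Sum.inl v'], ⟨?_, ?_, rfl, rfl⟩, ?_⟩
    · simp only [List.isChain_cons_cons, List.isChain_singleton, and_true]
      exact ⟨hmz, hnz.symm⟩
    · simp [huw, hzu.symm, hzw]
    · rintro C ⟨a, x, b, hab, hx⟩
      simp only [List.infix_cons_iff, List.cons_prefix_cons, List.infix_nil, List.prefix_nil,
        reduceCtorEq, and_false, or_false, and_true] at hab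
      obtain ⟨rfl, rfl, rfl⟩ := hab
      exact key C hx
  · obtain rfl : v = u := hm
    refine ⟨[Sum.inl v, Sum.inl z, Sum.inr B, Sum.inl w], ⟨?_, ?_, rfl, rfl⟩, ?_⟩
    · simp only [List.isChain_cons_cons, List.isChain_singleton, and_true]
      exact ⟨hmz, hnz.symm, (hside hn).symm⟩
    · simp [huw, hzu.symm, hzw]
    · rintro C ⟨a, x, b, hab, hx⟩
      simp only [List.infix_cons_iff, List.cons_prefix_cons, List.infix_nil, List.prefix_nil,
        List.nil_prefix, reduceCtorEq, and_false, or_false, and_true] at hab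
      obtain ⟨rfl, rfl, rfl⟩ | ⟨rfl, rfl, rfl⟩ := hab
      · exact key C hx
      · exact (hlat _ _ _ _ hx).elim
  · obtain rfl : v' = w := hn
    refine ⟨[Sum.inl u, Sum.inr A, Sum.inl z, Sum.inl v'], ⟨?_, ?_, rfl, rfl⟩, ?_⟩
    · simp only [List.isChain_cons_cons, List.isChain_singleton, and_true]
      exact ⟨hside hm, hmz, hnz.symm⟩
    · simp [huw, hzu.symm, hzw]
    · rintro C ⟨a, x, b, hab, hx⟩
      simp only [List.infix_cons_iff, List.cons_prefix_cons, List.infix_nil, List.prefix_nil,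
        List.nil_prefix, reduceCtorEq, and_false, or_false, and_true] at hab
      obtain ⟨rfl, rfl, rfl⟩ | ⟨rfl, rfl, rfl⟩ := hab
      · exact (hlat _ _ _ _ hx).elim
      · exact key C hx
  · have hAB : A ≠ B := by
      rintro rfl
      exact h ⟨huw, .inr (.inr ⟨A.1, mem_faces_of_mem_facets A.2, hm, hn⟩)⟩
    refine ⟨[Sum.inl u, Sum.inr A, Sum.inl z, Sum.inr B, Sum.inl w], ⟨?_, ?_, rfl, rfl⟩, ?_⟩
    · simp only [List.isChain_cons_cons, List.isChain_singleton, and_true]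
      exact ⟨hside hm, hmz, hnz.symm, (hside hn).symm⟩
    · simp [huw, hzu.symm, hzw, hAB]
    · rintro C ⟨a, x, b, hab, hx⟩
      simp only [List.infix_cons_iff, List.cons_prefix_cons, List.infix_nil, List.prefix_nil,
        List.nil_prefix, reduceCtorEq, and_false, or_false, and_true] at hab
      obtain ⟨rfl, rfl, rfl⟩ | ⟨rfl, rfl, rfl⟩ | ⟨rfl, rfl, rfl⟩ := hab
      · exact (hlat _ _ _ _ hx).elim
      · exact key C hx
      · exact (hlat _ _ _ _ hx).elim

theorem adj_of_side (hzu : z ≠ u) {m : V ⊕ {A // A ∈ G.facets}} (hm : G.Side u m)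
    (hmz : G.Linked m (Sum.inl z)) : G.skeleton.Adj u z := by
  refine ⟨hzu.symm, ?_⟩
  rcases m with v | A
  · obtain rfl : v = u := hm
    exact hmz.imp id .inl
  · exact .inr (.inr ⟨A.1, mem_faces_of_mem_facets A.2, hm, hmz.elim id fun h => h.elim⟩)

theorem into_iff : G.Into u z ↔
    ∃ m, G.Side u m ∧ G.canonical.edge m (Sum.inl z) := by
  constructor
  · rintro (h | ⟨B, hB, hu, hz⟩)
    · exact ⟨Sum.inl u, rfl, h⟩
    · obtain ⟨A, hA, hBA⟩ := exists_facet hB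
      exact ⟨Sum.inr ⟨A, hA⟩, hBA hu, hBA hz⟩
  · rintro ⟨v | A, hm, h⟩
    · obtain rfl : v = u := hm
      exact .inl h
    · exact .inr ⟨A.1, mem_faces_of_mem_facets A.2, hm, h⟩

theorem exists_side_of_adj (h : G.skeleton.Adj u z) :
    ∃ m, G.Side u m ∧ G.Linked m (Sum.inl z) := by
  obtain ⟨-, h | h | h⟩ := h
  · exact ⟨Sum.inl u, rfl, .inl h⟩
  · exact ⟨Sum.inl u, rfl, .inr h⟩
  · obtain ⟨m, hm, hz⟩ := into_iff.1 (.inr h)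
    exact ⟨m, hm, .inl hz⟩

/-- With nothing conditioned on, all paths must collide at `z`. This fails exactly when a path
through `z` exists and an edge from `z` to `u` or `w` can be used on one. -/
theorem dSep_empty_iff (hV : ∀ v, v = u ∨ v = w ∨ v = z) (huw : u ≠ w) (hzu : z ≠ u)
    (hzw : z ≠ w) : G.canonical.DSep {u} {w} ∅ ↔ ¬ G.skeleton.Adj u w ∧
      ¬ (G.skeleton.Adj u z ∧ G.skeleton.Adj w z ∧ ((z, u) ∈ G.edges ∨ (z, w) ∈ G.edges)) := by
  constructor
  · intro hd
    have hadj : ¬ G.skeleton.Adj u w := fun h => not_dSep_of_adj h _ hd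
    refine ⟨hadj, ?_⟩
    have aux : ∀ {m n : V ⊕ {A // A ∈ G.facets}}, G.Side u m → G.Side w n →
        G.Linked m (Sum.inl z) → G.Linked n (Sum.inl z) →
        G.canonical.edge m (Sum.inl z) ∧ G.canonical.edge n (Sum.inl z) :=
      fun hm hn hmz hnz => by
        obtain ⟨p, hp, h⟩ := exists_isPath huw hzu hzw hadj hm hn hmz hnz
        obtain h | h := h _ (hd u (by simp) w (by simp) p hp)
        · exact h.1
        · simp at h
    rintro ⟨hu, hw, h | h⟩
    · obtain ⟨n, hn, hnz⟩ := exists_side_of_adj hw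
      exact not_edge_edge (aux (m := Sum.inl u) rfl hn (.inr h) hnz).1 h
    · obtain ⟨m, hm, hmz⟩ := exists_side_of_adj hu
      exact not_edge_edge (aux (n := Sum.inl w) hm rfl hmz (.inr h)).2 h
  · rintro ⟨hadj, h⟩ u' hu' w' hw' p hp
    obtain rfl := Finset.mem_singleton.1 hu'
    obtain rfl := Finset.mem_singleton.1 hw'
    obtain ⟨m, n, hmn, hm, hn, hmz, hnz⟩ := exists_infix_of_isPath hV huw hadj hp
    have hu := adj_of_side hzu hm hmz
    have hw := adj_of_side hzw hn hnz
    refine ⟨m, Sum.inl z, n, hmn, .inl ⟨?_, ?_, by simp⟩⟩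
    · refine hmz.resolve_right fun hz => ?_
      rcases m with v | A
      · obtain rfl : v = u' := hm
        exact h ⟨hu, hw, .inl hz⟩
      · exact hz
    · refine hnz.resolve_right fun hz => ?_
      rcases n with v | A
      · obtain rfl : v = w' := hn
        exact h ⟨hu, hw, .inr hz⟩
      · exact hz

/-- Conditioning on `z` opens precisely the paths that collide there. -/
theorem dSep_singleton_iff (hV : ∀ v, v = u ∨ v = w ∨ v = z) (huw : u ≠ w) (hzu : z ≠ u)
    (hzw : z ≠ w) : G.canonical.DSep {u} {w} {z} ↔
      ¬ G.skeleton.Adj u w ∧ ¬ (G.Into u z ∧ G.Into w z) := by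
  constructor
  · intro hd
    have hadj : ¬ G.skeleton.Adj u w := fun h => not_dSep_of_adj h _ hd
    refine ⟨hadj, ?_⟩
    rw [into_iff, into_iff]
    rintro ⟨⟨m, hm, hmz⟩, n, hn, hnz⟩
    obtain ⟨p, hp, h⟩ := exists_isPath huw hzu hzw hadj hm hn (.inl hmz) (.inl hnz)
    obtain h | h := h _ (hd u (by simp) w (by simp) p hp)
    · simp at h
    · exact h.1 ⟨hmz, hnz⟩
  · rintro ⟨hadj, h⟩ u' hu' w' hw' p hp
    obtain rfl := Finset.mem_singleton.1 hu'
    obtain rfl := Finset.mem_singleton.1 hw'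
    obtain ⟨m, n, hmn, hm, hn, hmz, hnz⟩ := exists_infix_of_isPath hV huw hadj hp
    exact ⟨m, Sum.inl z, n, hmn, .inr ⟨fun h' => h ⟨into_iff.2 ⟨m, hm, h'.1⟩,
      into_iff.2 ⟨n, hn, h'.2⟩⟩, z, by simp, rfl⟩⟩

theorem dSep_iff_forall {A B C : Finset V} :
    G.canonical.DSep A B C ↔ ∀ u ∈ A, ∀ w ∈ B, G.canonical.DSep {u} {w} C := by
  simp [PDAG.DSep]

end MDAG

/-! ### The three-node mDAGs consistent with the nodal ordering -/

namespace MDAG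

section General

variable {V : Type} [DecidableEq V]

/-- The confounders determine the complex, which makes `code` injective. -/
theorem mem_faces_iff [Nonempty V] (G : MDAG V) (A : Finset V) :
    A ∈ G.faces ↔ A.card ≤ 1 ∨ ∃ B ∈ G.confounders, A ⊆ B := by
  constructor
  · intro hA
    obtain ⟨B, hB, hAB⟩ := exists_facet hA
    by_cases h : A.card ≤ 1
    · exact .inl h
    · have := Finset.card_le_card hAB
      exact .inr ⟨B, Finset.mem_filter.2 ⟨hB, by omega⟩, hAB⟩
  · rintro (h | ⟨B, hB, hAB⟩)
    · obtain ⟨v, hv⟩ := Finset.card_le_one_iff_subset_singleton.1 h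
      exact G.down_closed _ _ hv (G.singleton_mem v)
    · exact G.down_closed _ _ hAB (mem_faces_of_mem_facets (Finset.mem_filter.1 hB).1)

theorem exists_face_iff (G : MDAG V) {u w : V} (huw : u ≠ w) :
    (∃ B ∈ G.faces, u ∈ B ∧ w ∈ B) ↔ ∃ B ∈ G.confounders, u ∈ B ∧ w ∈ B := by
  constructor
  · rintro ⟨B, hB, hu, hw⟩
    obtain ⟨A, hA, hBA⟩ := exists_facet hB
    exact ⟨A, Finset.mem_filter.2 ⟨hA, Finset.one_lt_card.2 ⟨u, hBA hu, w, hBA hw, huw⟩⟩,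
      hBA hu, hBA hw⟩
  · rintro ⟨B, hB, h⟩
    exact ⟨B, mem_faces_of_mem_facets (Finset.mem_filter.1 hB).1, h⟩

theorem eq_of_subset_of_mem_confounders (G : MDAG V) {A B : Finset V} (hA : A ∈ G.confounders)
    (hB : B ∈ G.confounders) (h : A ⊆ B) : A = B :=
  (Finset.mem_filter.1 (Finset.mem_filter.1 hA).1).2 B
    (mem_faces_of_mem_facets (Finset.mem_filter.1 hB).1) h

/-- The mDAG with the directed edges `E` and the confounders `F`. -/
def ofConfounders [Fintype V] (E : Finset (V × V))
    (hE : ∀ v, ¬ Relation.TransGen (fun u w => (u, w) ∈ E) v v) (F : Finset (Finset V)) :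
    MDAG V where
  edges := E
  acyclic := hE
  faces := Finset.univ.filter fun A => A.card ≤ 1 ∨ ∃ B ∈ F, A ⊆ B
  singleton_mem v := by simp
  down_closed A B hAB hB := by
    simp only [Finset.mem_filter, Finset.mem_univ, true_and] at hB ⊢
    exact hB.imp (Finset.card_le_card hAB).trans fun ⟨C, hC, h⟩ => ⟨C, hC, hAB.trans h⟩

theorem confounders_ofConfounders [Fintype V] {E : Finset (V × V)}
    {hE : ∀ v, ¬ Relation.TransGen (fun u w => (u, w) ∈ E) v v} {F : Finset (Finset V)}
    (hF : ∀ A ∈ F, 2 ≤ A.card) (hF' : ∀ A ∈ F, ∀ B ∈ F, A ⊆ B → A = B) :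
    (ofConfounders E hE F).confounders = F := by
  ext A
  simp only [confounders, facets, ofConfounders, Finset.mem_filter, Finset.mem_univ, true_and]
  constructor
  · rintro ⟨⟨h | ⟨B, hB, hAB⟩, hmax⟩, hA⟩
    · omega
    · rwa [hmax B (.inr ⟨B, hB, subset_rfl⟩) hAB]
  · intro hA
    refine ⟨⟨.inr ⟨A, hA, subset_rfl⟩, ?_⟩, hF A hA⟩
    rintro B (h | ⟨C, hC, hBC⟩) hAB
    · have := hF A hA
      have := Finset.card_le_card hAB
      omega
    · exact hAB.antisymm (hF' A hA C hC (hAB.trans hBC) ▸ hBC)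

end General

/-- The directed edges and the confounders. -/
def code (G : MDAG (Fin 3)) : Code := (G.edges, G.confounders)

theorem code_injective : Function.Injective code := fun G H h => by
  have h₁ : G.edges = H.edges := congrArg Prod.fst h
  have h₂ : G.confounders = H.confounders := congrArg Prod.snd h
  refine MDAG.ext h₁ ?_
  ext A
  rw [mem_faces_iff, mem_faces_iff, h₂]

end MDAG

open ClassName

/-- The possible sets of confounders of three nodes. -/
def complexes : Finset (Finset (Finset (Fin 3))) :=
  {∅, {AB}, {AC}, {BC}, {AB, AC}, {AB, BC}, {AC, BC}, {AB, AC, BC}, {ABC}}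

/-- The possible sets of directed edges. -/
def edgeSets : Finset (Finset (Fin 3 × Fin 3)) :=
  {∅, {ab}, {ac}, {bc}, {ab, ac}, {ab, bc}, {ac, bc}, {ab, ac, bc}}

theorem mem_ordered_iff {G : MDAG (Fin 3)} : G ∈ ordered ↔ G.edges ⊆ {ab, ac, bc} := by
  constructor
  · rintro hG ⟨u, w⟩ h
    have h1 : u ≠ w := by
      rintro rfl
      exact G.acyclic u (.single h)
    have h2 : ¬ w < u := fun hwu => hG w u hwu (.single h)
    revert h1 h2
    clear h
    revert u w
    decide
  · intro hG i j hij h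
    obtain ⟨w, hw, h⟩ := G.transGen_canonicalEdge h
    obtain rfl : i = w := Sum.inl.inj hw
    have : ∀ a b, Relation.TransGen (fun u w => (u, w) ∈ G.edges) a b → a < b := fun a b h => by
      induction h with
      | single h => exact rank_lt_of_mem (p := G.code) hG _ _ h
      | tail _ h ih => exact ih.trans (rank_lt_of_mem (p := G.code) hG _ _ h)
    exact (this _ _ h).asymm hij

/-- Confounders form an antichain of sets with at least two elements; the list of such antichains is
checked by enumeration. -/
theorem confounders_mem_complexes (G : MDAG (Fin 3)) : G.confounders ∈ complexes := by
  have h0 : ∀ A : Finset (Fin 3), 2 ≤ A.card →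
      A ∈ ({AB, AC, BC, ABC} : Finset (Finset (Fin 3))) := by decide
  have h1 : ∀ F ∈ ({AB, AC, BC, ABC} : Finset (Finset (Fin 3))).powerset,
      F ∈ complexes ∨ ∃ q ∈ F ×ˢ F, q.1 ⊆ q.2 ∧ q.1 ≠ q.2 := by decide +kernel
  refine (h1 _ (Finset.mem_powerset.2 fun A hA =>
    h0 A (Finset.mem_filter.1 hA).2)).resolve_right ?_
  rintro ⟨⟨A, B⟩, hAB, hsub, hne⟩
  rw [Finset.mem_product] at hAB
  exact hne (G.eq_of_subset_of_mem_confounders hAB.1 hAB.2 hsub)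

theorem mem_complexes {F : Finset (Finset (Fin 3))} (hF : F ∈ complexes) :
    (∀ A ∈ F, 2 ≤ A.card) ∧ ∀ A ∈ F, ∀ B ∈ F, A ⊆ B → A = B := by
  revert F
  decide +kernel

theorem mem_edgeSets_iff {E : Finset (Fin 3 × Fin 3)} :
    E ∈ edgeSets ↔ E ⊆ {ab, ac, bc} := by
  have : edgeSets = ({ab, ac, bc} : Finset (Fin 3 × Fin 3)).powerset := by decide +kernel
  rw [this, Finset.mem_powerset]

theorem exists_code_eq {p : Code} (h₁ : p.1 ∈ edgeSets) (h₂ : p.2 ∈ complexes) :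
    ∃ G ∈ ordered, G.code = p := by
  have hlt := rank_lt_of_mem (mem_edgeSets_iff.1 h₁)
  have hacyc : ∀ v, ¬ Relation.TransGen (fun u w => (u, w) ∈ p.1) v v := fun v h => by
    have : ∀ a b, Relation.TransGen (fun u w => (u, w) ∈ p.1) a b → a < b := fun a b h => by
      induction h with
      | single h => exact hlt _ _ h
      | tail _ h ih => exact ih.trans (hlt _ _ h)
    exact (this v v h).false
  refine ⟨MDAG.ofConfounders p.1 hacyc p.2, mem_ordered_iff.2 (mem_edgeSets_iff.1 h₁), ?_⟩
  exact Prod.ext rfl (MDAG.confounders_ofConfounders (mem_complexes h₂).1 (mem_complexes h₂).2)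

theorem image_code_ordered : MDAG.code '' ordered = ↑(edgeSets ×ˢ complexes) := by
  ext p
  simp only [Set.mem_image, Finset.coe_product, Set.mem_prod, Finset.mem_coe]
  constructor
  · rintro ⟨G, hG, rfl⟩
    exact ⟨mem_edgeSets_iff.2 (mem_ordered_iff.1 hG), confounders_mem_complexes G⟩
  · rintro ⟨h₁, h₂⟩
    exact exists_code_eq h₁ h₂

theorem ncard_ordered : ordered.ncard = 72 := by
  rw [← Set.ncard_image_of_injective _ MDAG.code_injective, image_code_ordered,
    Set.ncard_coe_finset, Finset.card_product]
  have h₁ : edgeSets.card = 8 := by decide +kernel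
  have h₂ : complexes.card = 9 := by decide +kernel
  rw [h₁, h₂]

/-! ### The listed classes as observational equivalence classes -/

namespace ClassName

theorem mem_complexes_of_mem_table (k : ClassName) : ∀ p ∈ k.table, p.2 ∈ complexes := by
  cases k <;>
    simp only [table, List.forall_mem_cons, List.not_mem_nil, false_imp_iff, implies_true,
      and_true] <;>
    and_intros <;> decide +kernel

theorem exists_mem_table {E : Finset (Fin 3 × Fin 3)} {F : Finset (Finset (Fin 3))}
    (hE : E ∈ edgeSets) (hF : F ∈ complexes) : ∃ k : ClassName, (E, F) ∈ k.table := by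
  simp only [edgeSets, Finset.mem_insert, Finset.mem_singleton] at hE
  simp only [complexes, Finset.mem_insert, Finset.mem_singleton] at hF
  obtain rfl | rfl | rfl | rfl | rfl | rfl | rfl | rfl := hE <;>
    obtain rfl | rfl | rfl | rfl | rfl | rfl | rfl | rfl | rfl := hF <;> decide +kernel

theorem members_subset_ordered (k : ClassName) : k.members ⊆ ordered := fun _ hG =>
  mem_ordered_iff.2 (table_subset_edges k _ hG)

theorem exists_mem_members {G : MDAG (Fin 3)} (hG : G ∈ ordered) :
    ∃ k : ClassName, G ∈ k.members :=
  exists_mem_table (mem_edgeSets_iff.2 (mem_ordered_iff.1 hG)) (confounders_mem_complexes G)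

theorem exists_member {k : ClassName} {p : Code} (hp : p ∈ k.table) :
    ∃ G ∈ k.members, G.code = p := by
  obtain ⟨G, -, rfl⟩ := exists_code_eq (mem_edgeSets_iff.2 (table_subset_edges k p hp))
    (mem_complexes_of_mem_table k p hp)
  exact ⟨G, hp, rfl⟩

theorem members_nonempty (k : ClassName) : k.members.Nonempty := by
  obtain ⟨p, hp⟩ : ∃ p, p ∈ k.table := by cases k <;> exact ⟨_, List.mem_cons_self⟩
  obtain ⟨G, hG, -⟩ := exists_member hp
  exact ⟨G, hG⟩

variable {k l : ClassName} {G H : MDAG (Fin 3)}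

theorem realizable_of_mem_members (hG : G ∈ k.members) {c : Fin 3 → ℕ} (hc : ∀ v, c v ≠ 0) :
    G.canonical.Realizable c = k.rep.realizable c :=
  (G.realizable_eq hc).trans (realizable_eq_rep (p := G.code) hG hc)

theorem dominates_iff_dom (hG : G ∈ k.members) (hH : H ∈ l.members) :
    G.Dominates H ↔ Dom k l := by
  constructor
  · intro h c hc
    rw [← realizable_of_mem_members hG hc, ← realizable_of_mem_members hH hc]
    exact h c
  · intro h c
    by_cases hc : ∀ v, c v ≠ 0
    · rw [realizable_of_mem_members hG hc, realizable_of_mem_members hH hc]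
      exact h c hc
    · rw [PDAG.realizable_eq_empty hc]
      exact Set.empty_subset _

theorem obsEquiv_iff (hG : G ∈ k.members) (hH : H ∈ l.members) : G.ObsEquiv H ↔ k = l := by
  have : G.ObsEquiv H ↔ G.Dominates H ∧ H.Dominates G :=
    ⟨fun h => ⟨fun c => (h c).subset, fun c => (h c).superset⟩,
      fun h c => (h.1 c).antisymm (h.2 c)⟩
  rw [this, dominates_iff_dom hG hH, dominates_iff_dom hH hG]
  constructor
  · exact fun h => dom_antisymm h.1 h.2
  · rintro rfl
    exact ⟨.refl k, .refl k⟩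

/-- The tables are disjoint because a common member would make the classes dominate each other. -/
theorem eq_of_mem_members (hG : G ∈ k.members) (hG' : G ∈ l.members) : k = l :=
  (obsEquiv_iff hG hG').1 fun _ => rfl

theorem members_injective : Function.Injective members := fun k l h => by
  obtain ⟨G, hG⟩ := k.members_nonempty
  exact eq_of_mem_members hG (h ▸ hG)

theorem members_eq_of_mem (hG : G ∈ k.members) :
    k.members = {H | H ∈ ordered ∧ G.ObsEquiv H} := by
  ext H
  constructor
  · exact fun hH => ⟨members_subset_ordered k hH, (obsEquiv_iff hG hH).2 rfl⟩
  · rintro ⟨hH, h⟩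
    obtain ⟨l, hl⟩ := exists_mem_members hH
    rwa [(obsEquiv_iff hG hl).1 h]

theorem range_members : Set.range members = obsClasses := by
  ext K
  constructor
  · rintro ⟨k, rfl⟩
    obtain ⟨G, hG⟩ := k.members_nonempty
    exact ⟨G, members_subset_ordered k hG, members_eq_of_mem hG⟩
  · rintro ⟨G, hG, rfl⟩
    obtain ⟨k, hk⟩ := exists_mem_members hG
    exact ⟨k, members_eq_of_mem hk⟩

theorem ncard_obsClasses : obsClasses.ncard = 15 := by
  rw [← range_members, ← Set.image_univ, Set.ncard_image_of_injective _ members_injective,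
    Set.ncard_univ, Nat.card_eq_fintype_card]
  rfl

theorem strictlyDominates_iff : StrictlyDominates k.members l.members ↔ Dom k l ∧ k ≠ l := by
  constructor
  · intro h
    obtain ⟨G, hG⟩ := k.members_nonempty
    obtain ⟨H, hH⟩ := l.members_nonempty
    have := h G hG H hH
    rwa [dominates_iff_dom hG hH, obsEquiv_iff hG hH] at this
  · intro h G hG H hH
    rwa [dominates_iff_dom hG hH, obsEquiv_iff hG hH]

/-! ### Algebraic and nonalgebraic classes -/

/-- The representatives of the algebraic classes are DAGs without latent variables, so the Markov
description applies to them. -/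
theorem exists_rank (hk : k ∉ [triangle, evans, instrumentalABC, instrumentalBAC,
    instrumentalCAB]) : k.rep.2 = ∅ ∧ ∃ r : Fin 3 → ℕ, Function.Injective r ∧
      ∀ u w, (u, w) ∈ k.rep.1 → r u < r w := by
  cases k <;> first | exact absurd hk (by decide) | refine ⟨rfl, ?_⟩
  case colliderA => exact ⟨![2, 0, 1], by decide, by decide⟩
  case colliderB => exact ⟨![0, 2, 1], by decide, by decide⟩
  all_goals exact ⟨![0, 1, 2], by decide, by decide⟩

theorem algebraic_of_notMem (hk : k ∉ [triangle, evans, instrumentalABC, instrumentalBAC,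
    instrumentalCAB]) (hG : G ∈ k.members) : G.Algebraic := by
  obtain ⟨h, r, hr, hE⟩ := exists_rank hk
  refine PDAG.algebraic_of_realizable_eq hr hE fun c hc => ?_
  rw [realizable_of_mem_members hG hc, Code.realizable, h]

theorem not_algebraic_of_line (hG : G ∈ k.members) {P Q : (Fin 3 → Fin 2) → ℝ} {b : ℝ}
    (hb : 0 < b) (h : ∀ t, 0 ≤ t → t ≤ b → P + t • (Q - P) ∈ k.rep.realizable fun _ => 2)
    (hQ : Q ∈ stdSimplex ℝ (Fin 3 → Fin 2)) (hQ' : Q ∉ k.rep.realizable fun _ => 2) :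
    ¬ G.Algebraic := by
  have h1 : P + (1 : ℝ) • (Q - P) = Q := by simp
  refine PDAG.not_algebraic_of_line (c := fun _ => 2) (P₀ := P) (P₁ := Q - P)
    (Set.Icc_infinite hb) (fun t ht => ?_) (t := 1) ?_ ?_
  · rw [realizable_of_mem_members hG fun _ => two_ne_zero]
    exact h t ht.1 ht.2
  · rwa [h1]
  · rwa [h1, realizable_of_mem_members hG fun _ => two_ne_zero]

theorem correlated_mem_stdSimplex {u v w : Fin 3} (huv : u ≠ v) (huw : u ≠ w) (hvw : v ≠ w) :
    correlated u v w ∈ stdSimplex ℝ (Fin 3 → Fin 2) :=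
  -- The cyclic shift gives `u` the lowest rank, as the edge `u → w` requires.
  kernelRealizable_subset_stdSimplex (c := fun _ => 2) (r := fun i => (i - u).val)
    (fun i j h => sub_left_injective (Fin.val_injective h)) (fun i j h => by
      obtain ⟨rfl, rfl⟩ : i = u ∧ j = w := by simpa using h
      have : ∀ i j : Fin 3, i ≠ j → (i - i).val < (j - i).val := by decide
      exact this i j huw) (fun _ => two_ne_zero) (correlated_mem huv huw hvw)

theorem instrumental_not_algebraic {u v w : Fin 3} (huv : u ≠ v) (huw : u ≠ w) (hvw : v ≠ w)
    (hk : k.rep = ({(u, v), (v, w)}, {{v, w}})) (hG : G ∈ k.members) : ¬ G.Algebraic := by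
  refine not_algebraic_of_line hG (P := instrumentalBase v w) (Q := correlated u v w)
    (b := 1 / 2) (by norm_num) (fun t ht ht' => ?_) (correlated_mem_stdSimplex huv huw hvw) ?_
  · rw [hk]
    exact instrumental_line_mem huv huw hvw ht ht'
  · rw [hk]
    exact correlated_notMem_instrumental huv huw hvw

theorem not_algebraic_of_mem (hk : k ∈ [triangle, evans, instrumentalABC, instrumentalBAC,
    instrumentalCAB]) (hG : G ∈ k.members) : ¬ G.Algebraic := by
  simp only [List.mem_cons, List.not_mem_nil, or_false] at hk
  obtain rfl | rfl | rfl | rfl | rfl := hk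
  · exact not_algebraic_of_line hG (b := 1 / 4) (by norm_num)
      (fun t ht ht' => subset_rep_triangle (triangle_line_mem ht ht'))
      (Code.realizable_subset_stdSimplex (p := rep fork) (by decide) (fun _ => two_ne_zero)
        (ghz_mem (t := 0) (by decide) (by decide) (by decide)))
      fun h => ghz_notMem_triangle (rep_triangle_subset h)
  · exact not_algebraic_of_line hG (b := 1 / 2) (by norm_num)
      (fun t ht ht' => subset_rep_evans (evans_line_mem ht ht'))
      (correlated_mem_stdSimplex (by decide) (by decide) (by decide))
      fun h => correlated_notMem_evans (rep_evans_subset h)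
  · exact instrumental_not_algebraic (u := 0) (v := 1) (w := 2) (by decide) (by decide)
      (by decide) rfl hG
  · exact instrumental_not_algebraic (u := 1) (v := 0) (w := 2) (by decide) (by decide)
      (by decide) rfl hG
  · exact instrumental_not_algebraic (u := 2) (v := 0) (w := 1) (by decide) (by decide)
      (by decide) rfl hG

end ClassName

/-! ### d-separation and skeletons of the classes -/

/-- Adjacency of two different nodes in the skeleton. -/
abbrev Code.Adj (p : Code) (u w : Fin 3) : Prop :=
  (u, w) ∈ p.1 ∨ (w, u) ∈ p.1 ∨ ∃ B ∈ p.2, u ∈ B ∧ w ∈ B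

/-- There is a directed edge from `u` to `z` or a confounder of both. -/
abbrev Code.Into (p : Code) (u z : Fin 3) : Prop :=
  (u, z) ∈ p.1 ∨ ∃ B ∈ p.2, u ∈ B ∧ z ∈ B

/-- The skeleton. -/
def Code.skeleton (p : Code) (u w : Fin 3) : Bool := decide (u ≠ w ∧ p.Adj u w)

/-- Two different nodes are d-separated by the third one (`b = true`) or by the empty set
(`b = false`). -/
def Code.sep (p : Code) (u w : Fin 3) (b : Bool) : Bool :=
  decide (u ≠ w ∧ ¬ p.Adj u w ∧
    if b then ¬ (p.Into u (-(u + w)) ∧ p.Into w (-(u + w)))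
    else ¬ (p.Adj u (-(u + w)) ∧ p.Adj w (-(u + w)) ∧
      ((-(u + w), u) ∈ p.1 ∨ (-(u + w), w) ∈ p.1)))

/-- The elements of `Fin 3` sum to 0, so `-(u + w)` is the third node. -/
theorem third_ne : ∀ {u w : Fin 3}, u ≠ w → -(u + w) ≠ u ∧ -(u + w) ≠ w := by decide

theorem eq_or_eq_or_eq_third :
    ∀ {u w : Fin 3}, u ≠ w → ∀ v, v = u ∨ v = w ∨ v = -(u + w) := by decide

namespace MDAG

variable {G H : MDAG (Fin 3)} {u w : Fin 3}

theorem adj_iff_code (huw : u ≠ w) : G.skeleton.Adj u w ↔ G.code.Adj u w := by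
  simp only [skeleton, exists_face_iff G huw, Code.Adj, code]
  exact and_iff_right huw

theorem into_iff_code (huw : u ≠ w) : G.Into u w ↔ G.code.Into u w := by
  simp only [Into, exists_face_iff G huw, Code.Into, code]

theorem dSep_iff_sep (huw : u ≠ w) (b : Bool) :
    G.canonical.DSep {u} {w} (if b then {-(u + w)} else ∅) ↔ G.code.sep u w b = true := by
  obtain ⟨hu, hw⟩ := third_ne huw
  have hV := eq_or_eq_or_eq_third huw
  rw [Code.sep, decide_eq_true_iff, and_iff_right huw]
  cases b
  · rw [if_neg Bool.false_ne_true, if_neg Bool.false_ne_true, dSep_empty_iff hV huw hu hw,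
      adj_iff_code huw, adj_iff_code hu.symm, adj_iff_code hw.symm]
    rfl
  · rw [if_pos rfl, if_pos rfl, dSep_singleton_iff hV huw hu hw, adj_iff_code huw,
      into_iff_code hu.symm, into_iff_code hw.symm]

theorem exists_eq_ite {C : Finset (Fin 3)} (huw : u ≠ w) (hu : u ∉ C) (hw : w ∉ C) :
    ∃ b : Bool, C = if b then {-(u + w)} else ∅ := by
  revert u w C
  decide

theorem disjoint_ite (huw : u ≠ w) (b : Bool) :
    Disjoint ({u} : Finset (Fin 3)) (if b then {-(u + w)} else ∅) ∧
      Disjoint ({w} : Finset (Fin 3)) (if b then {-(u + w)} else ∅) := by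
  revert u w b
  decide

/-- D-separation of sets reduces to pairs of nodes, for which the conditioning set is empty or the
third node. -/
theorem sameDSep_iff : G.SameDSep H ↔ G.code.sep = H.code.sep := by
  constructor
  · intro h
    funext u w b
    by_cases huw : u = w
    · simp [Code.sep, huw]
    · rw [Bool.eq_iff_iff, ← dSep_iff_sep huw, ← dSep_iff_sep huw]
      exact h _ _ _ (by simpa using huw) (disjoint_ite huw b).1 (disjoint_ite huw b).2
  · intro h A B C hAB hAC hBC
    rw [dSep_iff_forall, dSep_iff_forall (G := H)]
    refine forall₂_congr fun u hu => forall₂_congr fun w hw => ?_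
    have huw : u ≠ w := fun h => Finset.disjoint_left.1 hAB hu (h ▸ hw)
    obtain ⟨b, rfl⟩ := exists_eq_ite huw (Finset.disjoint_left.1 hAC hu)
      (Finset.disjoint_left.1 hBC hw)
    rw [dSep_iff_sep huw, dSep_iff_sep huw, h]

theorem hasDSepRelation_iff : G.HasDSepRelation ↔ ∃ u w b, G.code.sep u w b = true := by
  constructor
  · rintro ⟨A, B, C, ⟨u, hu⟩, ⟨w, hw⟩, hAB, hAC, hBC, h⟩
    have huw : u ≠ w := fun h => Finset.disjoint_left.1 hAB hu (h ▸ hw)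
    obtain ⟨b, rfl⟩ := exists_eq_ite huw (Finset.disjoint_left.1 hAC hu)
      (Finset.disjoint_left.1 hBC hw)
    exact ⟨u, w, b, (dSep_iff_sep huw b).1 (dSep_iff_forall.1 h u hu w hw)⟩
  · rintro ⟨u, w, b, h⟩
    have huw : u ≠ w := (of_decide_eq_true h).1
    exact ⟨_, _, _, Finset.singleton_nonempty u, Finset.singleton_nonempty w,
      by simpa using huw, (disjoint_ite huw b).1, (disjoint_ite huw b).2,
      (dSep_iff_sep huw b).2 h⟩

theorem skeleton_eq_iff : G.skeleton = H.skeleton ↔ G.code.skeleton = H.code.skeleton := by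
  have key : ∀ (G : MDAG (Fin 3)) u w, G.skeleton.Adj u w ↔ G.code.skeleton u w = true := by
    intro G u w
    rw [Code.skeleton, decide_eq_true_iff]
    by_cases huw : u = w
    · simp [huw]
    · rw [adj_iff_code huw, and_iff_right huw]
  constructor
  · intro h
    funext u w
    rw [Bool.eq_iff_iff, ← key, ← key, h]
  · intro h
    ext u w
    rw [key, key, h]

end MDAG

namespace ClassName

variable {G H : MDAG (Fin 3)} {k l : ClassName}

theorem sep_of_mem_table (k : ClassName) : ∀ p ∈ k.table, Code.sep p = Code.sep k.rep := by
  cases k <;> simp only [table, List.forall_mem_cons, List.not_mem_nil, false_imp_iff,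
    implies_true, and_true] <;> and_intros <;> decide +kernel

theorem skeleton_of_mem_table (k : ClassName) :
    ∀ p ∈ k.table, Code.skeleton p = Code.skeleton k.rep := by
  cases k <;> simp only [table, List.forall_mem_cons, List.not_mem_nil, false_imp_iff,
    implies_true, and_true] <;> and_intros <;> decide +kernel

theorem sep_of_mem_members (hG : G ∈ k.members) : G.code.sep = Code.sep k.rep :=
  sep_of_mem_table k _ hG

theorem skeleton_of_mem_members (hG : G ∈ k.members) : G.code.skeleton = Code.skeleton k.rep :=
  skeleton_of_mem_table k _ hG

/-- When the features are constant on classes, it suffices to compare their values `f` on the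
fifteen names. -/
theorem singledOutBy_iff {α : Type} {R : MDAG (Fin 3) → MDAG (Fin 3) → Prop}
    {f : ClassName → α}
    (hR : ∀ {G H k l}, G ∈ members k → H ∈ members l → (R G H ↔ f k = f l)) :
    SingledOutBy R k.members ↔ ∀ l, f k = f l → k = l := by
  constructor
  · intro h l hl
    obtain ⟨G, hG⟩ := members_nonempty k
    obtain ⟨H, hH⟩ := members_nonempty l
    exact eq_of_mem_members (h G hG H (members_subset_ordered l hH) ((hR hG hH).2 hl)) hH
  · intro h G hG H hH hGH
    obtain ⟨l, hl⟩ := exists_mem_members hH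
    exact h l ((hR hG hl).1 hGH) ▸ hl

theorem singledOutBy_sameDSep_iff : SingledOutBy MDAG.SameDSep k.members ↔
    k ∈ [factorizing, factorizingAB_C, factorizingAC_B, factorizingBC_A,
      colliderA, colliderB, colliderC, fork, chain] := by
  rw [singledOutBy_iff (f := fun k => Code.sep k.rep) fun hG hH => by
    rw [MDAG.sameDSep_iff, sep_of_mem_members hG, sep_of_mem_members hH]]
  revert k
  decide +kernel

theorem singledOutBy_sameDSepSkeleton_iff : SingledOutBy MDAG.SameDSepSkeleton k.members ↔
    k ∈ [factorizing, factorizingAB_C, factorizingAC_B, factorizingBC_A,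
      colliderA, colliderB, colliderC, fork, chain, instrumentalABC] := by
  rw [singledOutBy_iff (f := fun k => (Code.sep k.rep, Code.skeleton k.rep)) fun hG hH => by
    rw [MDAG.SameDSepSkeleton, MDAG.sameDSep_iff, MDAG.skeleton_eq_iff, sep_of_mem_members hG,
      sep_of_mem_members hH, skeleton_of_mem_members hG, skeleton_of_mem_members hH,
      Prod.mk.injEq]]
  revert k
  decide +kernel

theorem not_hasDSepRelation_iff (hG : G ∈ k.members) : ¬ G.HasDSepRelation ↔
    k ∈ [saturated, triangle, evans, instrumentalABC, instrumentalBAC, instrumentalCAB] := by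
  rw [MDAG.hasDSepRelation_iff, sep_of_mem_members hG]
  clear hG
  revert k
  decide +kernel

end ClassName

end CausalOrder

open CausalOrder ClassName in
theorem mainTheorem1 :
    -- there are 72 ordered three-node mDAGs, and they fall into exactly 15 classes
    ordered.ncard = 72 ∧
    obsClasses.ncard = 15 ∧
    -- the classes are the listed ones, and different names stand for different classes
    Set.range members = obsClasses ∧
    Function.Injective members ∧
    -- dominance holds exactly along descending lines of the diagram
    (∀ k l : ClassName, ∀ G ∈ k.members, ∀ H ∈ l.members,
      (G.Dominates H ↔ Relation.ReflTransGen Line k l)) ∧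
    -- the lines are exactly the strict dominances with no class in between
    (∀ k l : ClassName, Line k l ↔
      StrictlyDominates k.members l.members ∧
        ¬ ∃ m : ClassName, StrictlyDominates k.members m.members ∧
          StrictlyDominates m.members l.members) ∧
    -- five classes are nonalgebraic
    (∀ k : ClassName, ∀ G ∈ k.members, (¬ G.Algebraic ↔
      k ∈ [triangle, evans, instrumentalABC, instrumentalBAC, instrumentalCAB])) ∧
    -- six classes have no d-separation relations
    (∀ k : ClassName, ∀ G ∈ k.members, (¬ G.HasDSepRelation ↔
      k ∈ [saturated, triangle, evans, instrumentalABC, instrumentalBAC, instrumentalCAB])) ∧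
    -- nine classes are singled out by the d-separation relations alone
    (∀ k : ClassName, SingledOutBy MDAG.SameDSep k.members ↔
      k ∈ [factorizing, factorizingAB_C, factorizingAC_B, factorizingBC_A,
        colliderA, colliderB, colliderC, fork, chain]) ∧
    -- ten classes are singled out by the d-separation relations together with the skeleton
    (∀ k : ClassName, SingledOutBy MDAG.SameDSepSkeleton k.members ↔
      k ∈ [factorizing, factorizingAB_C, factorizingAC_B, factorizingBC_A,
        colliderA, colliderB, colliderC, fork, chain, instrumentalABC]) := by
  refine ⟨ncard_ordered, ncard_obsClasses, range_members, members_injective,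
    fun k l G hG H hH => (dominates_iff_dom hG hH).trans dom_iff, fun k l => ?_,
    fun k G hG => ⟨fun h => ?_, fun h => not_algebraic_of_mem h hG⟩,
    fun k G hG => not_hasDSepRelation_iff hG, fun k => singledOutBy_sameDSep_iff,
    fun k => singledOutBy_sameDSepSkeleton_iff⟩
  · simp only [strictlyDominates_iff]
    exact line_iff_covers k l
  · by_contra hk
    exact h (algebraic_of_notMem hk hG)
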